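/- Let $\mathcal A$, $\mathcal B$ be abelian categories, each equipped with a symmetric monoidal structure whose tensor product is additive and right exact in each variable. Call an object $P$ *flat* if $P\otimes-$ is exact. Assume that both categories have finite Tor-dimension (there is $n$ such that every object has a flat resolution of length $\le n$), and that $\mathcal A$ has enough injectives. Write $D^+$ for the bounded-below derived category, $Rf_*\colon D^+\mathcal A\to D^+\mathcal B$ for the right derived functor of $f_*$, and $R^nf_*A=H^n(Rf_*A)$ for an object $A$ placed in degree $0$. A functor $f_*\colon\mathcal A\to\mathcal B$ is a *pre-$\cup$-functor* if it has a left adjoint $f^*$ which is exact and preserves flat objects. A *cup-pairing* $f_*\cup g_*\to h_*$ is a morphism $f_*A\otimes g_*B\to h_*(A\otimes B)$, natural in $A,B\in\mathcal A$; applied to summands it extends to a morphism of complexes $f_*K\otimes g_*L\to h_*(K\otimes L)$ for bounded-below complexes $K,L$. **Theorem.** The tensor product of bounded-below complexes has a left derived functor $\otimes^{L}$ on $D^+\mathcal A$ and on $D^+\mathcal B$, and $K\otimes^LL\to K\otimes L$ is an isomorphism whenever $K$ or $L$ consists of flat objects. There is a unique family of natural morphisms $$\alpha\colon H^p(X)\otimes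 H^q(Y)\to H^{p+q}(X\otimes^LY)\qquad (X,Y\in D^+\mathcal B,\ p,q\in\mathbb Z)$$ which, for complexes $X=K$, $Y=L$, becomes $[x]\otimes[y]\mapsto[x\otimes y]$ after composition with $H^{p+q}(K\otimes^LL)\to H^{p+q}(K\otimes L)$. Let $f_*,g_*,h_*\colon\mathcal A\to\mathcal B$ be pre-$\cup$-functors and $\pi\colon f_*\cup g_*\to h_*$ a cup-pairing. Then: 1. There is a *derived cup product*: a morphism $$Rf_*X\otimes^LRg_*Y\to Rh_*(X\otimes^LY),$$ natural in $X,Y\in D^+\mathcal A$, which extends $\pi$: for all bounded-below complexes $K,L$ in $\mathcal A$ the composites $$f_*K\otimes^Lg_*L\to Rf_*K\otimes^LRg_*L\to Rh_*(K\otimes^LL)\to Rh_*(K\otimes L)$$ and $$f_*K\otimes^Lg_*L\to f_*K\otimes g_*L\to h_*(K\otimes L)\to Rh_*(K\otimes L)$$ are equal. 2. For $r,s\in\mathbb N$ and $A,B\in\mathcal A$ let the *cup product* $$\cup\colon R^rf_*A\otimes R^sg_*B\to R^{r+s}h_*(A\otimes B)$$ be the composite of $\alpha\colon R^rf_*A\otimes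 R^sg_*B\to H^{r+s}(Rf_*A\otimes^LRg_*B)$, of $H^{r+s}$ of the derived cup product, and of the map induced by $A\otimes^LB\to A\otimes B$. It is natural in $A$ and $B$. 3. For $r=s=0$ it is $\pi$, that is, $\pi$ corresponds to it under the canonical morphisms $f_*\to R^0f_*$, $g_*\to R^0g_*$, $h_*\to R^0h_*$. 4. The cup product is compatible with connecting morphisms $\delta$. If $0\to A'\to A\to A''\to0$ is exact, $B\in\mathcal A$, and $0\to A'\otimes B\to A\otimes B\to A''\otimes B\to0$ is exact, then $$\delta\circ\cup=\cup\circ(\delta\otimes\mathrm{id})\colon R^rf_*A''\otimes R^sg_*B\to R^{r+s+1}h_*(A'\otimes B).$$ If $0\to B'\to B\to B''\to0$ is exact, $A\in\mathcal A$, and $0\to A\otimes B'\to A\otimes B\to A\otimes B''\to0$ is exact, then $$\delta\circ\cup=(-1)^r\,\cup\circ(\mathrm{id}\otimes\delta)\colon R^rf_*A\otimes R^sg_*B''\to R^{r+s+1}h_*(A\otimes B').$$ More generally, without exactness of the tensored sequence: for every short exact sequence $0\to T'\to T\to T''\to0$ in $\mathcal A$ and every morphism $\varphi$ of sequences from $A'\otimes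 B\to A\otimes B\to A''\otimes B$ to it, $$\delta_T\circ R^{r+s}h_*(\varphi'')\circ\cup=R^{r+s+1}h_*(\varphi')\circ\cup\circ(\delta\otimes\mathrm{id}),$$ and the analogous identity, with the sign $(-1)^r$, holds in the second variable. 5. Any family of morphisms $R^rf_*A\otimes R^sg_*B\to R^{r+s}h_*(A\otimes B)$ $(r,s\in\mathbb N$, $A,B\in\mathcal A)$, not assumed natural, that satisfies 3 and the first two identities of 4 is equal to the cup product. -/

import Mathlib

open CategoryTheory Limits MonoidalCategory

universe w w₁ w₂ v v₁ v₂ u u₁ u₂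

set_option linter.unusedSectionVars false

noncomputable section

namespace CupProduct

section Tensor

variable (C : Type u) [Category.{v} C] [Abelian C] [MonoidalCategory C] [MonoidalPreadditive C]

variable {C} in
/-- An object is flat if tensoring with it is exact (right exactness is a standing assumption on
the tensor product, so that only the preservation of finite limits has to be required). -/
def IsFlat (P : C) : Prop := PreservesFiniteLimits (tensorLeft P)

/-- Finite Tor-dimension: for some `n`, every object has a resolution by flat objects
`0 ⟶ P n ⟶ ⋯ ⟶ P 0 ⟶ X ⟶ 0` of length at most `n`. -/
def HasFiniteTorDimension : Prop :=
  ∃ n : ℕ, ∀ X : C, ∃ (P : ChainComplex C ℕ) (π : P ⟶ (ChainComplex.single₀ C).obj X),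
    QuasiIso π ∧ (∀ i, IsFlat (P.X i)) ∧ ∀ i, n < i → IsZero (P.X i)

variable {C} in
/-- A family of objects with only finitely many nonzero members has a coproduct. -/
lemma hasCoproduct_of_finite {ι : Type*} (F : ι → C) (s : Set ι) (hs : s.Finite)
    (hF : ∀ i, i ∉ s → IsZero (F i)) : HasCoproduct F := by
  classical
  have := hs.to_subtype
  let c : Cofan F := Cofan.mk (∐ fun i : s => F i)
    (fun i => if h : i ∈ s then Sigma.ι (fun i : s => F i) ⟨i, h⟩ else 0)
  refine ⟨⟨⟨c, Cofan.IsColimit.mk _ (fun t => Sigma.desc (fun i : s => t.inj i.1)) ?_ ?_⟩⟩⟩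
  · intro t i
    by_cases h : i ∈ s
    · simp [c, h]
    · exact (hF i h).eq_of_src _ _
  · intro t m hm
    refine Sigma.hom_ext (f := fun i : s => F i) _ _ (fun i => ?_)
    have := hm i.1
    simp only [c, cofan_mk_inj, i.2, dif_pos] at this
    simpa using this

instance hasTensor (K L : CochainComplex.Plus C) :
    HomologicalComplex.HasTensor K.obj L.obj := by
  intro n
  obtain ⟨a, ha⟩ := K.property
  obtain ⟨b, hb⟩ := L.property
  refine hasCoproduct_of_finite _
    ((fun i => i.1) ⁻¹' ((Set.Icc a (n - b)) ×ˢ (Set.Icc b (n - a)))) ?_ ?_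
  · exact (((Set.finite_Icc a (n - b)).prod (Set.finite_Icc b (n - a))).preimage
      Subtype.val_injective.injOn)
  · rintro ⟨⟨p, q⟩, hpq⟩ h
    have hpq' : p + q = n := hpq
    by_cases hp : p < a
    · exact ((tensorRight (L.obj.X q)).map_isZero (K.obj.isZero_of_isStrictlyGE a p hp))
    · refine ((tensorLeft (K.obj.X p)).map_isZero (L.obj.isZero_of_isStrictlyGE b q ?_))
      by_contra hq
      apply h
      simp only [Set.mem_preimage, Set.mem_prod, Set.mem_Icc]
      omega

variable {C} in
/-- The tensor product of two bounded below complexes: in degree `n` it is the (finite) direct sum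
of the `K.X p ⊗ L.X q` with `p + q = n`, with differential
`x ⊗ y ↦ d x ⊗ y + (-1) ^ p • x ⊗ d y`. -/
def tensorComplex (K L : CochainComplex.Plus C) : CochainComplex.Plus C :=
  ⟨HomologicalComplex.tensorObj K.obj L.obj, by
    obtain ⟨a, ha⟩ := K.property
    obtain ⟨b, hb⟩ := L.property
    refine ⟨a + b, ?_⟩
    rw [CochainComplex.isStrictlyGE_iff]
    intro n hn
    rw [IsZero.iff_id_eq_zero]
    apply HomologicalComplex.mapBifunctor.hom_ext
    intro p q hpq
    have hpq' : p + q = n := hpq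
    by_cases hp : p < a
    · exact ((tensorRight (L.obj.X q)).map_isZero
        (K.obj.isZero_of_isStrictlyGE a p hp)).eq_of_src _ _
    · exact ((tensorLeft (K.obj.X p)).map_isZero
        (L.obj.isZero_of_isStrictlyGE b q (by omega))).eq_of_src _ _⟩

variable {C} in
lemma ιTensorObj_d
    (K L : CochainComplex C ℤ) [HomologicalComplex.HasTensor K L] (p q n : ℤ)
    (h : p + q = n) :
    HomologicalComplex.ιTensorObj K L p q n h ≫ (HomologicalComplex.tensorObj K L).d n (n + 1) =
      K.d p (p + 1) ▷ L.X q ≫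
          HomologicalComplex.ιTensorObj K L (p + 1) q (n + 1) (by omega) +
        p.negOnePow • (K.X p ◁ L.d q (q + 1) ≫
          HomologicalComplex.ιTensorObj K L p (q + 1) (n + 1) (by omega)) := by
  rw [HomologicalComplex.mapBifunctor.d_eq, Preadditive.comp_add,
    HomologicalComplex.mapBifunctor.ι_D₁, HomologicalComplex.mapBifunctor.ι_D₂,
    HomologicalComplex.mapBifunctor.d₁_eq _ _ _ _ (i₁' := p + 1) (by simp) _ _ (by simp; omega),
    HomologicalComplex.mapBifunctor.d₂_eq _ _ _ _ _ (i₂' := q + 1) (by simp) _ (by simp; omega)]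
  simp only [curriedTensor_obj_obj, curriedTensor_map_app, curriedTensor_obj_map]
  rw [show ComplexShape.ε₁ (.up ℤ) (.up ℤ) (.up ℤ) (p, q) = 1 from rfl, one_smul]
  rfl

/-- The tensor product of bounded below complexes as a functor in two variables. -/
def tensorComplexFunctor :
    CochainComplex.Plus C × CochainComplex.Plus C ⥤ CochainComplex.Plus C where
  obj K := tensorComplex K.1 K.2
  map f := ObjectProperty.homMk (HomologicalComplex.tensorHom f.1.hom f.2.hom)
  map_id K := by
    ext n
    apply HomologicalComplex.mapBifunctor.hom_ext
    intro p q h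
    simp [tensorComplex]
  map_comp f g := by
    ext n
    apply HomologicalComplex.mapBifunctor.hom_ext
    intro p q h
    simp [tensorComplex, whisker_exchange_assoc]

end Tensor

section DerivedTensor

variable (C : Type u) [Category.{v} C] [Abelian C] [HasDerivedCategory.{w} C]

instance : (DerivedCategory.Plus.Q (C := C)).IsLocalization (CochainComplex.Plus.quasiIso C) :=
  inferInstanceAs ((HomotopyCategory.Plus.quotient C ⋙
    DerivedCategory.Plus.Qh).IsLocalization (CochainComplex.Plus.quasiIso C))

instance : (CochainComplex.Plus.quasiIso C).ContainsIdentities := by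
  dsimp [CochainComplex.Plus.quasiIso]
  infer_instance

variable [MonoidalCategory C] [MonoidalPreadditive C]

/-- The left derived functor of the tensor product exists on the bounded below derived category. -/
abbrev HasDerivedTensor : Prop :=
  (tensorComplexFunctor C ⋙ DerivedCategory.Plus.Q).HasLeftDerivedFunctor
    ((CochainComplex.Plus.quasiIso C).prod (CochainComplex.Plus.quasiIso C))

variable [HasDerivedTensor C]

/-- The derived tensor product `(X, Y) ↦ X ⊗ᴸ Y` on the bounded below derived category. -/
def derivedTensor :
    DerivedCategory.Plus C × DerivedCategory.Plus C ⥤ DerivedCategory.Plus C :=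
  (tensorComplexFunctor C ⋙ DerivedCategory.Plus.Q).totalLeftDerived
    (DerivedCategory.Plus.Q.prod DerivedCategory.Plus.Q)
    ((CochainComplex.Plus.quasiIso C).prod (CochainComplex.Plus.quasiIso C))

/-- The canonical morphism `K ⊗ᴸ L ⟶ K ⊗ L` for bounded below complexes `K`, `L`. -/
def derivedTensorCounit :
    (DerivedCategory.Plus.Q (C := C)).prod (DerivedCategory.Plus.Q (C := C)) ⋙ derivedTensor C ⟶
      tensorComplexFunctor C ⋙ DerivedCategory.Plus.Q :=
  (tensorComplexFunctor C ⋙ DerivedCategory.Plus.Q).totalLeftDerivedCounit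
    (DerivedCategory.Plus.Q.prod DerivedCategory.Plus.Q)
    ((CochainComplex.Plus.quasiIso C).prod (CochainComplex.Plus.quasiIso C))

/-- The derived tensor product is computed by flat complexes: `K ⊗ᴸ L ⟶ K ⊗ L` is an isomorphism
as soon as `K` or `L` consists of flat objects. -/
def IsComputedByFlat : Prop :=
  ∀ K L : CochainComplex.Plus C, ((∀ n, IsFlat (K.obj.X n)) ∨ ∀ n, IsFlat (L.obj.X n)) →
    IsIso ((derivedTensorCounit C).app (K, L))

end DerivedTensor

section ExteriorProduct

variable {C : Type u} [Category.{v} C] [Abelian C] [HasDerivedCategory.{w} C]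

/-- The class in `Hⁿ(K)` of a cycle of degree `n` of a complex `K`. -/
def cyclesToHomology (K : CochainComplex.Plus C) (n : ℤ) :
    K.obj.cycles n ⟶
      (DerivedCategory.Plus.homologyFunctor C n).obj (DerivedCategory.Plus.Q.obj K) :=
  K.obj.homologyπ n ≫ (DerivedCategory.homologyFunctorFactors C n).inv.app K.obj

variable [MonoidalCategory C] [MonoidalPreadditive C]

/-- The tensor product `x ⊗ y` of a cycle `x` of degree `p` and a cycle `y` of degree `q`,
as a cycle of the tensor product complex. -/
def cyclesTensor (K L : CochainComplex.Plus C) (p q n : ℤ) (h : p + q = n) :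
    K.obj.cycles p ⊗ L.obj.cycles q ⟶ (tensorComplex K L).obj.cycles n :=
  (tensorComplex K L).obj.liftCycles
    ((K.obj.iCycles p ⊗ₘ L.obj.iCycles q) ≫
      HomologicalComplex.ιTensorObj K.obj L.obj p q n h) (n + 1) (by simp) (by
    have h₁ : K.obj.iCycles p ≫ K.obj.d p (p + 1) = 0 := by simp
    have h₂ : L.obj.iCycles q ≫ L.obj.d q (q + 1) = 0 := by simp
    dsimp [tensorComplex]
    rw [HomologicalComplex.mapBifunctor.d_eq]
    simp only [Preadditive.comp_add, Category.assoc,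
      HomologicalComplex.mapBifunctor.ι_D₁, HomologicalComplex.mapBifunctor.ι_D₂]
    rw [HomologicalComplex.mapBifunctor.d₁_eq' _ _ _ _ (i₁' := p + 1) (by simp),
      HomologicalComplex.mapBifunctor.d₂_eq' _ _ _ _ _ (i₂' := q + 1) (by simp)]
    simp only [Linear.comp_units_smul, curriedTensor_obj_obj, curriedTensor_map_app,
      curriedTensor_obj_map]
    have e₁ : (K.obj.iCycles p ⊗ₘ L.obj.iCycles q) ≫ K.obj.d p (p + 1) ▷ L.obj.X q = 0 := by
      rw [tensorHom_comp_whiskerRight, h₁, MonoidalPreadditive.zero_tensor]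
    have e₂ : (K.obj.iCycles p ⊗ₘ L.obj.iCycles q) ≫ K.obj.X p ◁ L.obj.d q (q + 1) = 0 := by
      rw [tensorHom_comp_whiskerLeft, h₂, MonoidalPreadditive.tensor_zero]
    rw [reassoc_of% e₁, reassoc_of% e₂]
    simp
    rfl)

variable [HasDerivedTensor C]

/-- A family of natural morphisms `Hᵖ(X) ⊗ H^q(Y) ⟶ H^{p+q}(X ⊗ᴸ Y)` on the bounded below derived
category. -/
abbrev HomologyPairing : Type _ :=
  ∀ p q n : ℤ, p + q = n →
    ((DerivedCategory.Plus.homologyFunctor C p).prod (DerivedCategory.Plus.homologyFunctor C q) ⋙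
      tensor C ⟶ derivedTensor C ⋙ DerivedCategory.Plus.homologyFunctor C n)

/-- The canonical family `α : Hᵖ(X) ⊗ H^q(Y) ⟶ H^{p+q}(X ⊗ᴸ Y)`: for complexes `K`, `L`, after
composition with `H^{p+q}(K ⊗ᴸ L) ⟶ H^{p+q}(K ⊗ L)`, it is given on cycles by
`[x] ⊗ [y] ↦ [x ⊗ y]`. -/
def HomologyPairing.IsCanonical (α : HomologyPairing (C := C)) : Prop :=
  ∀ (p q n : ℤ) (h : p + q = n) (K L : CochainComplex.Plus C),
    (cyclesToHomology K p ⊗ₘ cyclesToHomology L q) ≫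
        (α p q n h).app (DerivedCategory.Plus.Q.obj K, DerivedCategory.Plus.Q.obj L) ≫
        (DerivedCategory.Plus.homologyFunctor C n).map ((derivedTensorCounit C).app (K, L)) =
      cyclesTensor K L p q n h ≫ cyclesToHomology (tensorComplex K L) n

end ExteriorProduct

section CupFunctors

variable {A : Type u₁} [Category.{v₁} A] [Abelian A] [MonoidalCategory A] [MonoidalPreadditive A]
  {B : Type u₂} [Category.{v₂} B] [Abelian B] [MonoidalCategory B] [MonoidalPreadditive B]

/-- Pre-cup-functors: functors with a left adjoint that is exact and preserves flat objects. -/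
class IsPreCupFunctor (f : A ⥤ B) : Prop where
  isRightAdjoint : f.IsRightAdjoint
  exact : PreservesFiniteLimits f.leftAdjoint
  flat (P : B) : IsFlat P → IsFlat (f.leftAdjoint.obj P)

instance additive_of_isPreCupFunctor (f : A ⥤ B) [IsPreCupFunctor f] : f.Additive := by
  have := IsPreCupFunctor.isRightAdjoint (f := f)
  have : PreservesLimitsOfSize.{0, 0} f :=
    (Adjunction.ofIsRightAdjoint f).rightAdjoint_preservesLimits
  exact f.additive_of_preserves_binary_products

/-- A cup-pairing `f ∪ g ⟶ h`: a natural morphism `f X ⊗ g Y ⟶ h (X ⊗ Y)`. -/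
abbrev CupPairing (f g h : A ⥤ B) : Type _ := f.prod g ⋙ tensor B ⟶ tensor A ⋙ h

/-- The components `f X ⊗ g Y ⟶ h (X ⊗ Y)` of a cup-pairing. -/
def CupPairing.hom {f g h : A ⥤ B} (π : CupPairing f g h) (X Y : A) :
    f.obj X ⊗ g.obj Y ⟶ h.obj (X ⊗ Y) := π.app (X, Y)

lemma CupPairing.hom_whiskerRight {f g h : A ⥤ B} (π : CupPairing f g h) {X X' : A} (a : X ⟶ X')
    (Y : A) : f.map a ▷ g.obj Y ≫ π.hom X' Y = π.hom X Y ≫ h.map (a ▷ Y) := by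
  simpa using! π.naturality ((a, 𝟙 Y) : (X, Y) ⟶ (X', Y))

lemma CupPairing.hom_whiskerLeft {f g h : A ⥤ B} (π : CupPairing f g h) (X : A) {Y Y' : A}
    (b : Y ⟶ Y') : f.obj X ◁ g.map b ≫ π.hom X Y' = π.hom X Y ≫ h.map (X ◁ b) := by
  simpa using! π.naturality ((𝟙 X, b) : (X, Y) ⟶ (X, Y'))

lemma comp_eq_comp_of_summands {Z H H₁ H₂ W X₁ X₂ T : B} (ε : ℤˣ) {x : Z ⟶ H} {h₁ : H ⟶ H₁}
    {i₁ : H₁ ⟶ W} {h₂ : H ⟶ H₂} {i₂ : H₂ ⟶ W} {l : H ⟶ W} {u₁ : Z ⟶ X₁} {j₁ : X₁ ⟶ T}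
    {u₂ : Z ⟶ X₂} {j₂ : X₂ ⟶ T} {r : Z ⟶ T} {t : T ⟶ W} {p₁ : X₁ ⟶ H₁} {p₂ : X₂ ⟶ H₂}
    (hl : l = h₁ ≫ i₁ + ε • (h₂ ≫ i₂)) (hr : r = u₁ ≫ j₁ + ε • (u₂ ≫ j₂))
    (e₁ : u₁ ≫ p₁ = x ≫ h₁) (e₂ : u₂ ≫ p₂ = x ≫ h₂) (f₁ : j₁ ≫ t = p₁ ≫ i₁)
    (f₂ : j₂ ≫ t = p₂ ≫ i₂) : x ≫ l = r ≫ t := by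
  rw [hl, hr, Preadditive.comp_add, Preadditive.add_comp, Linear.comp_units_smul,
    Linear.units_smul_comp, Category.assoc, Category.assoc, f₁, f₂, reassoc_of% e₁, reassoc_of% e₂]

/-- The extension of a cup-pairing to complexes: the morphism of complexes `f K ⊗ g L ⟶ h (K ⊗ L)`
which on the summand `f (K.X p) ⊗ g (L.X q)` is the given pairing
`f (K.X p) ⊗ g (L.X q) ⟶ h (K.X p ⊗ L.X q)`. -/
def cupComplexHom {f g h : A ⥤ B} [f.Additive] [g.Additive] [h.Additive] (π : CupPairing f g h)
    (K L : CochainComplex A ℤ) [HomologicalComplex.HasTensor K L]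
    [HomologicalComplex.HasTensor ((f.mapHomologicalComplex _).obj K)
      ((g.mapHomologicalComplex _).obj L)] :
    HomologicalComplex.tensorObj ((f.mapHomologicalComplex _).obj K)
        ((g.mapHomologicalComplex _).obj L) ⟶
      (h.mapHomologicalComplex _).obj (HomologicalComplex.tensorObj K L) where
  f n := HomologicalComplex.mapBifunctorDesc (fun p q hpq =>
    π.hom (K.X p) (L.X q) ≫ h.map (HomologicalComplex.ιTensorObj K L p q n hpq))
  comm' n m hnm := by
    obtain rfl : n + 1 = m := hnm
    apply HomologicalComplex.mapBifunctor.hom_ext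
    intro p q hpq
    have hl := congr_arg h.map (ιTensorObj_d K L p q n hpq)
    rw [h.map_comp, h.map_add, Functor.map_units_smul, h.map_comp, h.map_comp] at hl
    have hr := ιTensorObj_d ((f.mapHomologicalComplex _).obj K)
      ((g.mapHomologicalComplex _).obj L) p q n hpq
    rw [HomologicalComplex.ι_mapBifunctorDesc_assoc, ← Category.assoc _ _
      (HomologicalComplex.mapBifunctorDesc _)]
    exact (Category.assoc _ _ _).trans (comp_eq_comp_of_summands _ hl hr
      (π.hom_whiskerRight _ _) (π.hom_whiskerLeft _ _)
      (HomologicalComplex.ι_mapBifunctorDesc ..) (HomologicalComplex.ι_mapBifunctorDesc ..))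

/-- The morphism `f K ⊗ g L ⟶ h (K ⊗ L)` for bounded below complexes. -/
def cupComplex {f g h : A ⥤ B} [f.Additive] [g.Additive] [h.Additive] (π : CupPairing f g h)
    (K L : CochainComplex.Plus A) :
    tensorComplex (f.mapCochainComplexPlus.obj K) (g.mapCochainComplexPlus.obj L) ⟶
      h.mapCochainComplexPlus.obj (tensorComplex K L) :=
  have : HomologicalComplex.HasTensor ((f.mapHomologicalComplex _).obj K.obj)
      ((g.mapHomologicalComplex _).obj L.obj) :=
    hasTensor B (f.mapCochainComplexPlus.obj K) (g.mapCochainComplexPlus.obj L)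
  ObjectProperty.homMk (cupComplexHom π K.obj L.obj)

/-- An object, as a complex concentrated in degree `0`. -/
def single (A : Type u₁) [Category.{v₁} A] [Abelian A] : A ⥤ CochainComplex.Plus A :=
  ObjectProperty.lift _ (HomologicalComplex.single A (ComplexShape.up ℤ) 0)
    (fun X => ⟨0, by
      rw [CochainComplex.isStrictlyGE_iff]
      exact fun i hi => HomologicalComplex.isZero_single_obj_X _ _ _ _ (by omega)⟩)

/-- The morphism of complexes `X[0] ⊗ Y[0] ⟶ (X ⊗ Y)[0]` which is the identity of `X ⊗ Y` in
degree `0`. -/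
def tensorSingle (X Y : A) :
    tensorComplex ((single A).obj X) ((single A).obj Y) ⟶ (single A).obj (X ⊗ Y) :=
  ObjectProperty.homMk (HomologicalComplex.mkHomToSingle
    (HomologicalComplex.mapBifunctorDesc (fun p q hpq =>
      if h : p = 0 ∧ q = 0 then
        (HomologicalComplex.singleObjXIsoOfEq (ComplexShape.up ℤ) 0 X p h.1).hom ⊗ₘ
          (HomologicalComplex.singleObjXIsoOfEq (ComplexShape.up ℤ) 0 Y q h.2).hom
      else 0)) (by
    intro i hi
    apply HomologicalComplex.mapBifunctor.hom_ext
    intro p q hpq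
    have hpq' : p + q = i := hpq
    have hi' : i + 1 = 0 := hi
    by_cases hp : p = 0
    · exact ((tensorLeft _).map_isZero
        (HomologicalComplex.isZero_single_obj_X _ _ _ q (by omega))).eq_of_src _ _
    · exact ((tensorRight _).map_isZero
        (HomologicalComplex.isZero_single_obj_X _ _ _ p hp)).eq_of_src _ _))

end CupFunctors

section RightDerived

variable {A : Type u₁} [Category.{v₁} A] [Abelian A] [HasDerivedCategory.{w₁} A]
  [EnoughInjectives A]
  {B : Type u₂} [Category.{v₂} B] [Abelian B] [HasDerivedCategory.{w₂} B]

/-- The canonical morphism `f K ⟶ Rf K` in the derived category, for a complex `K`. -/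
def derivedUnit (f : A ⥤ B) [f.Additive] (K : CochainComplex.Plus A) :
    DerivedCategory.Plus.Q.obj (f.mapCochainComplexPlus.obj K) ⟶
      f.rightDerivedFunctorPlus.obj (DerivedCategory.Plus.Q.obj K) :=
  f.rightDerivedFunctorPlusUnit.app ((HomotopyCategory.Plus.quotient A).obj K)

/-- The derived functors `Rⁿf : X ↦ Hⁿ(Rf X)`, where `X` is placed in degree `0`. -/
def higherDirectImage (f : A ⥤ B) [f.Additive] (n : ℤ) : A ⥤ B :=
  single A ⋙ DerivedCategory.Plus.Q ⋙ f.rightDerivedFunctorPlus ⋙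
    DerivedCategory.Plus.homologyFunctor B n

/-- The canonical morphism `f X ⟶ R⁰f X`: an element of `f X`, as a cycle of the complex `f (X[0])`,
is sent to its class in `H⁰(f (X[0]))` and then to `H⁰(Rf X)`. -/
def toHigherDirectImage (f : A ⥤ B) [f.Additive] (X : A) (n : ℤ) (hn : n = 0) :
    f.obj X ⟶ (higherDirectImage f n).obj X :=
  (f.mapCochainComplexPlus.obj ((single A).obj X)).obj.liftCycles
      (f.map (HomologicalComplex.singleObjXIsoOfEq (ComplexShape.up ℤ) 0 X n hn).inv)
      (n + 1) (by simp) (by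
        have hd : ((single A).obj X).obj.d n (n + 1) = 0 := HomologicalComplex.single_obj_d ..
        change f.map _ ≫ f.map (((single A).obj X).obj.d n (n + 1)) = 0
        rw [hd, f.map_zero, comp_zero]) ≫
    cyclesToHomology _ n ≫
    (DerivedCategory.Plus.homologyFunctor B n).map (derivedUnit f ((single A).obj X))

/-- Auxiliary morphism `f K ⟶ (Rf (K⟦-1⟧))⟦1⟧`, natural in the complex `K`. -/
def shiftUnit (f : A ⥤ B) [f.Additive] :
    f.mapHomotopyCategoryPlus ⋙ DerivedCategory.Plus.Qh ⟶
      DerivedCategory.Plus.Qh ⋙ shiftFunctor (DerivedCategory.Plus A) (-1 : ℤ) ⋙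
        f.rightDerivedFunctorPlus ⋙ shiftFunctor (DerivedCategory.Plus B) (1 : ℤ) :=
  Functor.whiskerLeft (f.mapHomotopyCategoryPlus ⋙ DerivedCategory.Plus.Qh)
      (shiftFunctorCompIsoId (DerivedCategory.Plus B) (-1 : ℤ) 1 (by simp)).inv ≫
    Functor.whiskerRight
      (((f.mapHomotopyCategoryPlus ⋙ DerivedCategory.Plus.Qh).commShiftIso (-1 : ℤ)).inv ≫
        Functor.whiskerLeft (shiftFunctor (HomotopyCategory.Plus A) (-1 : ℤ))
          f.rightDerivedFunctorPlusUnit ≫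
        Functor.whiskerRight ((DerivedCategory.Plus.Qh (C := A)).commShiftIso (-1 : ℤ)).hom
          f.rightDerivedFunctorPlus)
      (shiftFunctor (DerivedCategory.Plus B) (1 : ℤ))

/-- The canonical morphism `Rf (X⟦1⟧) ⟶ (Rf X)⟦1⟧`, induced by the identification of `f (K⟦1⟧)` and
`(f K)⟦1⟧` for complexes `K` and the universal property of `Rf`. -/
def derivedShift (f : A ⥤ B) [f.Additive] (X : DerivedCategory.Plus A) :
    f.rightDerivedFunctorPlus.obj (X⟦(1 : ℤ)⟧) ⟶ (f.rightDerivedFunctorPlus.obj X)⟦(1 : ℤ)⟧ :=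
  (f.rightDerivedFunctorPlus.rightDerivedDesc f.rightDerivedFunctorPlusUnit
      (HomotopyCategory.Plus.quasiIso A) _ (shiftUnit f)).app (X⟦(1 : ℤ)⟧) ≫
    (f.rightDerivedFunctorPlus.map
      ((shiftFunctorCompIsoId (DerivedCategory.Plus A) (1 : ℤ) (-1) (by simp)).hom.app X))⟦(1 : ℤ)⟧'

/-- The connecting morphism `X₃ ⟶ X₁⟦1⟧` in the derived category attached to a short exact
sequence. -/
def derivedδ {S : ShortComplex A} (hS : S.ShortExact) :
    DerivedCategory.Plus.Q.obj ((single A).obj S.X₃) ⟶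
      (DerivedCategory.Plus.Q.obj ((single A).obj S.X₁))⟦(1 : ℤ)⟧ :=
  ObjectProperty.homMk (DerivedCategory.triangleOfSESδ
      (hS.map_of_exact (HomologicalComplex.single A (ComplexShape.up ℤ) 0)) ≫
    (DerivedCategory.Plus.ι.commShiftIso (1 : ℤ)).inv.app
      (DerivedCategory.Plus.Q.obj ((single A).obj S.X₁)))

/-- The connecting morphism `Rⁿf X₃ ⟶ Rⁿ⁺¹f X₁` attached to a short exact sequence. -/
def connecting (f : A ⥤ B) [f.Additive] {S : ShortComplex A} (hS : S.ShortExact)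
    (n₀ n₁ : ℤ) (h : 1 + n₀ = n₁) :
    (higherDirectImage f n₀).obj S.X₃ ⟶ (higherDirectImage f n₁).obj S.X₁ :=
  (DerivedCategory.homologyFunctor B 0).shiftMap
    (DerivedCategory.Plus.ι.map (f.rightDerivedFunctorPlus.map (derivedδ hS) ≫ derivedShift f _) ≫
      (DerivedCategory.Plus.ι.commShiftIso (1 : ℤ)).hom.app _) n₀ n₁ h

end RightDerived

section CupProducts

variable {A : Type u₁} [Category.{v₁} A] [Abelian A] [MonoidalCategory A] [MonoidalPreadditive A]
  [HasDerivedCategory.{w₁} A] [EnoughInjectives A]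
  {B : Type u₂} [Category.{v₂} B] [Abelian B] [MonoidalCategory B] [MonoidalPreadditive B]
  [HasDerivedCategory.{w₂} B]
  {f g h : A ⥤ B} [f.Additive] [g.Additive] [h.Additive]

section

variable [HasDerivedTensor A] [HasDerivedTensor B]

variable (f g h) in
/-- Natural morphisms `Rf X ⊗ᴸ Rg Y ⟶ Rh (X ⊗ᴸ Y)` on the bounded below derived category. -/
abbrev DerivedCupPairing : Type _ :=
  f.rightDerivedFunctorPlus.prod g.rightDerivedFunctorPlus ⋙ derivedTensor B ⟶
    derivedTensor A ⋙ h.rightDerivedFunctorPlus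

/-- A derived cup-pairing `Φ` extends a cup-pairing `π`: for all complexes `K`, `L` the two
morphisms `f K ⊗ᴸ g L ⟶ Rf K ⊗ᴸ Rg L ⟶ Rh (K ⊗ᴸ L) ⟶ Rh (K ⊗ L)` (through `Φ`) and
`f K ⊗ᴸ g L ⟶ f K ⊗ g L ⟶ h (K ⊗ L) ⟶ Rh (K ⊗ L)` (through `π`) are equal. -/
def DerivedCupPairing.Extends (Φ : DerivedCupPairing f g h) (π : CupPairing f g h) : Prop :=
  ∀ K L : CochainComplex.Plus A,
    (derivedTensor B).map (Prod.mkHom (derivedUnit f K) (derivedUnit g L)) ≫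
        Φ.app (DerivedCategory.Plus.Q.obj K, DerivedCategory.Plus.Q.obj L) ≫
        h.rightDerivedFunctorPlus.map ((derivedTensorCounit A).app (K, L)) =
      (derivedTensorCounit B).app
          (f.mapCochainComplexPlus.obj K, g.mapCochainComplexPlus.obj L) ≫
        DerivedCategory.Plus.Q.map (cupComplex π K L) ≫ derivedUnit h (tensorComplex K L)

/-- The canonical morphism `X ⊗ᴸ Y ⟶ X ⊗ Y` for objects `X`, `Y`, placed in degree `0`. -/
def derivedTensorSingle (X Y : A) :
    (derivedTensor A).obj (DerivedCategory.Plus.Q.obj ((single A).obj X),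
        DerivedCategory.Plus.Q.obj ((single A).obj Y)) ⟶
      DerivedCategory.Plus.Q.obj ((single A).obj (X ⊗ Y)) :=
  (derivedTensorCounit A).app ((single A).obj X, (single A).obj Y) ≫
    DerivedCategory.Plus.Q.map (tensorSingle X Y)

end

variable (f g h) in
/-- A family of morphisms `Rʳf X ⊗ Rˢg Y ⟶ Rʳ⁺ˢh (X ⊗ Y)`. -/
abbrev CupFamily : Type _ :=
  ∀ (r s : ℕ) (X Y : A), (higherDirectImage f r).obj X ⊗ (higherDirectImage g s).obj Y ⟶
    (higherDirectImage h (r + s)).obj (X ⊗ Y)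

/-- The cup product induced by a derived cup-pairing `Φ`: the composition
`Rʳf X ⊗ Rˢg Y ⟶ Hʳ⁺ˢ(Rf X ⊗ᴸ Rg Y) ⟶ Hʳ⁺ˢ(Rh (X ⊗ᴸ Y)) ⟶ Rʳ⁺ˢh (X ⊗ Y)`. -/
def inducedCup [HasDerivedTensor A] [HasDerivedTensor B] (α : HomologyPairing (C := B))
    (Φ : DerivedCupPairing f g h) : CupFamily f g h := fun r s X Y =>
  (α r s (r + s) rfl).app
      (f.rightDerivedFunctorPlus.obj (DerivedCategory.Plus.Q.obj ((single A).obj X)),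
        g.rightDerivedFunctorPlus.obj (DerivedCategory.Plus.Q.obj ((single A).obj Y))) ≫
    (DerivedCategory.Plus.homologyFunctor B (r + s)).map
      (Φ.app (DerivedCategory.Plus.Q.obj ((single A).obj X),
          DerivedCategory.Plus.Q.obj ((single A).obj Y)) ≫
        h.rightDerivedFunctorPlus.map (derivedTensorSingle X Y))

/-- The family is natural in both objects. -/
def CupFamily.IsNatural (c : CupFamily f g h) : Prop :=
  ∀ (r s : ℕ) {X X' Y Y' : A} (a : X ⟶ X') (b : Y ⟶ Y'),
    ((higherDirectImage f r).map a ⊗ₘ (higherDirectImage g s).map b) ≫ c r s X' Y' =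
      c r s X Y ≫ (higherDirectImage h (r + s)).map (a ⊗ₘ b)

/-- The family is the pairing `π` in degree `0`, is compatible with connecting morphisms in the
first variable, and is compatible with connecting morphisms up to the sign `(-1)ʳ` in the second
variable. The exactness of the sequence of tensor products is needed for the connecting morphism
of `h` to be defined. -/
structure CupFamily.IsCupProduct (c : CupFamily f g h) (π : CupPairing f g h) : Prop where
  zero (X Y : A) :
    (toHigherDirectImage f X ((0 : ℕ) : ℤ) rfl ⊗ₘ toHigherDirectImage g Y ((0 : ℕ) : ℤ) rfl) ≫
        c 0 0 X Y =
      π.hom X Y ≫ toHigherDirectImage h (X ⊗ Y) (((0 : ℕ) : ℤ) + ((0 : ℕ) : ℤ)) rfl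
  left (r s : ℕ) (S : ShortComplex A) (hS : S.ShortExact) (Y : A)
    (hSY : (S.map (tensorRight Y)).ShortExact) :
    c r s S.X₃ Y ≫ connecting h hSY (r + s) ((r + 1 : ℕ) + s) (by push_cast; ring) =
      connecting f hS r (r + 1 : ℕ) (by push_cast; ring) ▷ (higherDirectImage g s).obj Y ≫
        c (r + 1) s S.X₁ Y
  right (r s : ℕ) (X : A) (S : ShortComplex A) (hS : S.ShortExact)
    (hXS : (S.map (tensorLeft X)).ShortExact) :
    c r s X S.X₃ ≫ connecting h hXS (r + s) (r + (s + 1 : ℕ)) (by push_cast; ring) =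
      (-1 : ℤ) ^ r • ((higherDirectImage f r).obj X ◁ connecting g hS s (s + 1 : ℕ)
          (by push_cast; ring) ≫ c r (s + 1) X S.X₁)

/-- Compatibility with connecting morphisms in the first variable without any exactness assumption
on the sequence `S ⊗ Y`, which is compared to an arbitrary short exact sequence `T`. -/
def CupFamily.IsCompatibleLeft (c : CupFamily f g h) : Prop :=
  ∀ (r s : ℕ) (S T : ShortComplex A) (hS : S.ShortExact) (hT : T.ShortExact) (Y : A)
    (φ : S.map (tensorRight Y) ⟶ T),
    c r s S.X₃ Y ≫ (higherDirectImage h (r + s)).map φ.τ₃ ≫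
        connecting h hT (r + s) ((r + 1 : ℕ) + s) (by push_cast; ring) =
      connecting f hS r (r + 1 : ℕ) (by push_cast; ring) ▷ (higherDirectImage g s).obj Y ≫
        c (r + 1) s S.X₁ Y ≫ (higherDirectImage h ((r + 1 : ℕ) + s)).map φ.τ₁

/-- Compatibility with connecting morphisms in the second variable without any exactness
assumption on the sequence `X ⊗ S`, which is compared to an arbitrary short exact sequence `T`. -/
def CupFamily.IsCompatibleRight (c : CupFamily f g h) : Prop :=
  ∀ (r s : ℕ) (X : A) (S T : ShortComplex A) (hS : S.ShortExact) (hT : T.ShortExact)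
    (φ : S.map (tensorLeft X) ⟶ T),
    c r s X S.X₃ ≫ (higherDirectImage h (r + s)).map φ.τ₃ ≫
        connecting h hT (r + s) (r + (s + 1 : ℕ)) (by push_cast; ring) =
      (-1 : ℤ) ^ r • ((higherDirectImage f r).obj X ◁ connecting g hS s (s + 1 : ℕ)
          (by push_cast; ring) ≫ c r (s + 1) X S.X₁ ≫
            (higherDirectImage h (r + (s + 1 : ℕ))).map φ.τ₁)

end CupProducts

end CupProduct

end

/-! The tensor product is derived with flat resolutions, the functors `f`, `g`, `h` with injective
ones, and the two kinds are never compared directly. What links them is the adjunction between the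
exact functor `f'` on derived categories (`f'` left adjoint to `f`) and `Rf` (`derivedAdjunction`).
By it, a transformation from `S (Rf X, Rg Y)` to `N (X ⊗ᴸ Y)` amounts to a transformation from `S
(Z, W)` to `N (f' Z ⊗ᴸ g' W)`. Since `f'` and `g'` are exact and preserve flat objects, the latter
target is the left derived functor of `N (f' K ⊗ g' L)` (`isLeftDerivedFunctor_tensorPullback`), so
everything is constructed and compared on complexes. Existence comes from `K ⊗ L ⟶ f f' K ⊗ g g' L ⟶
h (f' K ⊗ g' L)` (`exists_derivedCupPairing`); equalities come from `hom_ext_of_derivedUnit`.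

Existence of `⊗ᴸ` rests on two facts. A quasi-isomorphism tensored with a bounded below complex of
flat objects stays a quasi-isomorphism (`quasiIso_map_id`), because an acyclic bounded below complex
stays acyclic (`acyclic_of_flat_right`). Finite Tor-dimension gives every bounded below complex a
bounded below flat resolution (`exists_flat_resolution`). The formal criterion `IsLeftResolving`
turns these into a left derived functor, whose universal property survives composition with any
functor. Applied with `Hⁿ`, this gives the exterior product `α` and its uniqueness.

For connecting morphisms, `δ` is represented by the roof `X₃ ← cone ⟶ X₁⟦1⟧`. A morphism from `S ⊗
Y` to an exact sequence `T` induces a map of cones even if `S ⊗ Y` is not exact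
(`derivedTensorSingle_derivedδ`). The exterior product (`hom_homologyShiftMap`) and the derived cup
product (`hom_derivedShift`) commute with the shift of the first variable without sign. The second
variable is reduced to the first by the symmetry, which contributes `(-1)^(pq)` before and
`(-1)^(p(q+1))` after the connecting morphism, hence the sign `(-1)^p`.

Uniqueness is dimension shifting along sequences that remain exact after every tensor product.
`exists_flat_epi_connecting` embeds `X` in an object `Y` with flat quotient `F` such that `Rᵏf F ⟶
Rᵏ⁺¹f X` is an epimorphism. Flatness of the quotient makes the tensored sequence exact, and
surjectivity of `δ` propagates equality from degree `k` to `k + 1`. The base case holds because `f X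
⟶ R⁰f X` is an epimorphism. -/

noncomputable section

namespace CupProduct

/-! ### Summands of the tensor product of complexes -/

section TensorComplexes

variable {C : Type u} [Category.{v} C] [Abelian C] [MonoidalCategory C] [MonoidalPreadditive C]

namespace tensorComplex

/-- The inclusion of the summand `K.X p ⊗ L.X q` in degree `n = p + q` of the tensor product. -/
def inc (K L : CochainComplex.Plus C) (p q n : ℤ) (h : p + q = n) :
    K.obj.X p ⊗ L.obj.X q ⟶ (tensorComplex K L).obj.X n :=
  HomologicalComplex.ιTensorObj K.obj L.obj p q n h

lemma hom_ext {K L : CochainComplex.Plus C} {n : ℤ} {Z : C}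
    {f g : (tensorComplex K L).obj.X n ⟶ Z}
    (h : ∀ p q hpq, inc K L p q n hpq ≫ f = inc K L p q n hpq ≫ g) : f = g :=
  HomologicalComplex.mapBifunctor.hom_ext h

/-- Constructor for morphisms from the tensor product in a given degree. -/
def desc {K L : CochainComplex.Plus C} {n : ℤ} {Z : C}
    (f : ∀ p q, p + q = n → (K.obj.X p ⊗ L.obj.X q ⟶ Z)) : (tensorComplex K L).obj.X n ⟶ Z :=
  HomologicalComplex.mapBifunctorDesc f

lemma inc_desc {K L : CochainComplex.Plus C} {n : ℤ} {Z : C}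
    (f : ∀ p q, p + q = n → (K.obj.X p ⊗ L.obj.X q ⟶ Z)) (p q : ℤ) (h : p + q = n) :
    inc K L p q n h ≫ desc f = f p q h :=
  HomologicalComplex.ι_mapBifunctorDesc ..

lemma inc_d (K L : CochainComplex.Plus C) (p q n : ℤ) (h : p + q = n) (p' q' n' : ℤ)
    (hp : p + 1 = p') (hq : q + 1 = q') (hn : n + 1 = n') :
    inc K L p q n h ≫ (tensorComplex K L).obj.d n n' =
      K.obj.d p p' ▷ L.obj.X q ≫ inc K L p' q n' (by omega) +
        p.negOnePow • (K.obj.X p ◁ L.obj.d q q' ≫ inc K L p q' n' (by omega)) := by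
  subst hp hq hn
  exact ιTensorObj_d K.obj L.obj p q n h

/-- The functoriality of the tensor product of complexes. -/
abbrev map {K K' L L' : CochainComplex.Plus C} (f : K ⟶ K') (g : L ⟶ L') :
    tensorComplex K L ⟶ tensorComplex K' L' :=
  (tensorComplexFunctor C).map (X := (K, L)) (Y := (K', L')) (Prod.mkHom f g)

lemma inc_map {K K' L L' : CochainComplex.Plus C} (f : K ⟶ K') (g : L ⟶ L')
    (p q n : ℤ) (h : p + q = n) :
    inc K L p q n h ≫ (map f g).hom.f n =
      (f.hom.f p ⊗ₘ g.hom.f q) ≫ inc K' L' p q n h := by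
  dsimp [inc, map, tensorComplexFunctor, tensorComplex]
  simp [MonoidalCategory.tensorHom_def]

/-- The projection to the summand `K.X p ⊗ L.X q` of the tensor product. -/
def proj (K L : CochainComplex.Plus C) (p q n : ℤ) (h : p + q = n) :
    (tensorComplex K L).obj.X n ⟶ K.obj.X p ⊗ L.obj.X q :=
  desc fun p' q' _ => if e : p' = p then
      (K.obj.XIsoOfEq e).hom ⊗ₘ (L.obj.XIsoOfEq (show q' = q by omega)).hom else 0

@[simp]
lemma inc_proj (K L : CochainComplex.Plus C) (p q n : ℤ) (h : p + q = n) :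
    inc K L p q n h ≫ proj K L p q n h = 𝟙 _ := by
  simp [proj, inc_desc]

@[simp]
lemma inc_proj_assoc (K L : CochainComplex.Plus C) (p q n : ℤ) (h : p + q = n) {Z : C}
    (k : K.obj.X p ⊗ L.obj.X q ⟶ Z) : inc K L p q n h ≫ proj K L p q n h ≫ k = k := by
  rw [reassoc_of% (inc_proj K L p q n h)]

lemma inc_proj_of_ne (K L : CochainComplex.Plus C) (p q p' q' n : ℤ) (h : p + q = n)
    (h' : p' + q' = n) (hp : p' ≠ p) :
    inc K L p' q' n h' ≫ proj K L p q n h = 0 := by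
  simp [proj, inc_desc, hp]

/-- Boundedness below leaves finitely many nonzero summands, so the direct sum is also a product:
the identity is a finite sum of terms `proj ≫ inc`. Maps into the tensor product can therefore be
tested componentwise, dually to `hom_ext`. -/
lemma proj_ext {K L : CochainComplex.Plus C} {n : ℤ} {Z : C}
    {f g : Z ⟶ (tensorComplex K L).obj.X n}
    (h : ∀ p q hpq, f ≫ proj K L p q n hpq = g ≫ proj K L p q n hpq) : f = g := by
  obtain ⟨a, ha⟩ := K.property
  obtain ⟨b, hb⟩ := L.property
  -- For `p` outside this interval one of the two factors vanishes: either `p < a`, or `q = n - p <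
  -- b`.
  have hid : 𝟙 ((tensorComplex K L).obj.X n) = ∑ p ∈ Finset.Icc a (n - b),
      proj K L p (n - p) n (by omega) ≫ inc K L p (n - p) n (by omega) := by
    refine hom_ext fun p q hpq => ?_
    rw [Category.comp_id, Preadditive.comp_sum]
    by_cases hp : p < a
    · exact ((tensorRight (L.obj.X q)).map_isZero
        (K.obj.isZero_of_isStrictlyGE a p hp)).eq_of_src _ _
    by_cases hq : q < b
    · exact ((tensorLeft (K.obj.X p)).map_isZero
        (L.obj.isZero_of_isStrictlyGE b q hq)).eq_of_src _ _
    obtain rfl : q = n - p := by omega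
    rw [Finset.sum_eq_single p, reassoc_of% @inc_proj]
    · intro p' _ hp'
      rw [reassoc_of% (inc_proj_of_ne _ _ _ _ _ _ _ _ _ hp'.symm), zero_comp]
    · intro hp'
      simp only [Finset.mem_Icc] at hp'
      omega
  rw [← Category.comp_id f, ← Category.comp_id g, hid]
  simp only [Preadditive.comp_sum]
  refine Finset.sum_congr rfl fun p _ => ?_
  rw [reassoc_of% h]

lemma map_proj {K K' L L' : CochainComplex.Plus C} (f : K ⟶ K') (g : L ⟶ L')
    (p q n : ℤ) (h : p + q = n) :
    (map f g).hom.f n ≫ proj K' L' p q n h =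
      proj K L p q n h ≫ (f.hom.f p ⊗ₘ g.hom.f q) := by
  refine hom_ext fun p' q' h' => ?_
  rw [reassoc_of% @inc_map]
  by_cases hp : p' = p
  · obtain rfl := hp
    obtain rfl : q' = q := by omega
    simp
  · rw [inc_proj_of_ne _ _ _ _ _ _ _ _ _ hp, reassoc_of% (inc_proj_of_ne _ _ _ _ _ _ _ _ _ hp)]
    simp

/-- The summand `(p', q')` receives the differential only from `(p, q')` and `(p', q)`; the sign is
that of `p'`, the left degree of the second source. -/
lemma d_proj (K L : CochainComplex.Plus C) (p q p' q' n n' : ℤ) (h : p' + q' = n')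
    (hp : p + 1 = p') (hq : q + 1 = q') (hn : n + 1 = n') :
    (tensorComplex K L).obj.d n n' ≫ proj K L p' q' n' h =
      proj K L p q' n (by omega) ≫ K.obj.d p p' ▷ L.obj.X q' +
        p'.negOnePow • (proj K L p' q n (by omega) ≫ K.obj.X p' ◁ L.obj.d q q') := by
  refine hom_ext fun i j hij => ?_
  rw [reassoc_of% (inc_d _ _ _ _ _ _ _ _ _ rfl rfl hn)]
  simp only [Preadditive.add_comp, Preadditive.comp_add, Linear.units_smul_comp, Category.assoc,
    Linear.comp_units_smul]
  congr 1
  · by_cases hi : i = p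
    · subst hi hp
      obtain rfl : j = q' := by omega
      simp
    · rw [inc_proj_of_ne _ _ _ _ _ _ _ _ _ (by omega),
        reassoc_of% (inc_proj_of_ne _ _ _ _ _ _ _ _ _ hi)]
      simp
  · by_cases hi : i = p'
    · subst hi hq
      obtain rfl : j = q := by omega
      simp
    · rw [inc_proj_of_ne _ _ _ _ _ _ _ _ _ hi,
        reassoc_of% (inc_proj_of_ne _ _ _ _ _ _ _ _ _ hi)]
      simp

end tensorComplex

end TensorComplexes

/-! ### Flat objects and acyclicity of tensor products -/

section Flat

variable {C : Type u} [Category.{v} C] [Abelian C] [MonoidalCategory C] [SymmetricCategory C]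
  [MonoidalPreadditive C]

instance preservesFiniteColimits_tensorRight [∀ X : C, PreservesFiniteColimits (tensorLeft X)]
    (X : C) : PreservesFiniteColimits (tensorRight X) :=
  preservesFiniteColimits_of_natIso (BraidedCategory.tensorLeftIsoTensorRight X)

lemma IsFlat.preservesFiniteLimits_tensorRight {P : C} (hP : IsFlat P) :
    PreservesFiniteLimits (tensorRight P) :=
  have : PreservesFiniteLimits (tensorLeft P) := hP
  preservesFiniteLimits_of_natIso (BraidedCategory.tensorLeftIsoTensorRight P)

lemma IsFlat.mono_whiskerRight {P : C} (hP : IsFlat P) {X Y : C} (f : X ⟶ Y) [Mono f] :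
    Mono (f ▷ P) := by
  have := hP.preservesFiniteLimits_tensorRight
  exact inferInstanceAs (Mono ((tensorRight P).map f))

lemma IsFlat.mono_whiskerLeft {P : C} (hP : IsFlat P) {X Y : C} (f : X ⟶ Y) [Mono f] :
    Mono (P ◁ f) := by
  have : PreservesFiniteLimits (tensorLeft P) := hP
  exact inferInstanceAs (Mono ((tensorLeft P).map f))

variable [∀ X : C, PreservesFiniteColimits (tensorLeft X)]

/-- Right exactness is given, so monomorphisms are all that tensoring can destroy. -/
lemma isFlat_iff_mono (P : C) : IsFlat P ↔ ∀ ⦃X Y : C⦄ (f : X ⟶ Y) [Mono f], Mono (P ◁ f) := by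
  refine ⟨fun h X Y f _ => h.mono_whiskerLeft f, fun h => ?_⟩
  have : (tensorLeft P).PreservesMonomorphisms := ⟨fun f _ => h f⟩
  refine ((Functor.preservesFiniteLimits_tfae (tensorLeft P)).out 3 0).2 fun S hS => ?_
  have := hS.mono_f
  have := hS.epi_g
  exact ⟨hS.exact.map_of_epi_of_preservesCokernel _ inferInstance inferInstance, h S.f⟩

namespace tensorComplex

/-- Tensor product with a fixed complex `L` on the right. -/
abbrev withRight (L : CochainComplex.Plus C) : CochainComplex.Plus C ⥤ CochainComplex.Plus C :=
  Prod.sectL _ L ⋙ tensorComplexFunctor C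

instance (L : CochainComplex.Plus C) : (withRight L).Additive where
  map_add {K K' f g} := by
    ext n
    refine hom_ext fun p q h => ?_
    have h₁ := inc_map (f + g) (𝟙 L) p q n h
    have h₂ := inc_map f (𝟙 L) p q n h
    have h₃ := inc_map g (𝟙 L) p q n h
    have h₄ : (f + g).hom.f p = f.hom.f p + g.hom.f p := rfl
    rw [h₄, MonoidalPreadditive.add_tensor, Preadditive.add_comp, ← h₂, ← h₃,
      ← Preadditive.comp_add] at h₁
    exact h₁

/-- Exactness is tested in each degree and then on each summand, where it is the flatness of one
term of `L`. -/
lemma shortExact_withRight (S : ShortComplex (CochainComplex.Plus C))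
    (hS : (S.map (CochainComplex.Plus.ι C)).ShortExact) (L : CochainComplex.Plus C)
    (hL : ∀ n, IsFlat (L.obj.X n)) :
    ((S.map (withRight L)).map (CochainComplex.Plus.ι C)).ShortExact := by
  apply HomologicalComplex.shortExact_of_degreewise_shortExact
  intro n
  have hw (p q : ℤ) : S.f.hom.f p ▷ L.obj.X q ≫ S.g.hom.f p ▷ L.obj.X q = 0 := by
    have : S.f.hom.f p ≫ S.g.hom.f p = 0 := by
      rw [← HomologicalComplex.comp_f, ← ObjectProperty.FullSubcategory.comp_hom, S.zero]
      rfl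
    rw [← comp_whiskerRight, this, MonoidalPreadditive.zero_whiskerRight]
  have hSp (p q : ℤ) : (ShortComplex.mk _ _ (hw p q)).ShortExact := by
    have := (hL q).preservesFiniteLimits_tensorRight
    exact (hS.map_of_exact (HomologicalComplex.eval C _ p)).map_of_exact
      (tensorRight (L.obj.X q))
  have h₁ (p q h) : inc S.X₁ L p q n h ≫ (map S.f (𝟙 L)).hom.f n =
      S.f.hom.f p ▷ L.obj.X q ≫ inc S.X₂ L p q n h := by
    simpa using! inc_map S.f (𝟙 L) p q n h
  have h₂ (p q h) : inc S.X₂ L p q n h ≫ (map S.g (𝟙 L)).hom.f n =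
      S.g.hom.f p ▷ L.obj.X q ≫ inc S.X₃ L p q n h := by
    simpa using! inc_map S.g (𝟙 L) p q n h
  have h₃ (p q h) : (map S.f (𝟙 L)).hom.f n ≫ proj S.X₂ L p q n h =
      proj S.X₁ L p q n h ≫ S.f.hom.f p ▷ L.obj.X q := by
    simpa using! map_proj S.f (𝟙 L) p q n h
  have hzero : (map S.f (𝟙 L)).hom.f n ≫ (map S.g (𝟙 L)).hom.f n = 0 :=
    (((S.map (withRight L)).map (CochainComplex.Plus.ι C)).map
      (HomologicalComplex.eval C _ n)).zero
  have (p q : ℤ) : Mono (S.f.hom.f p ▷ L.obj.X q) := (hSp p q).mono_f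
  have (p q : ℤ) : Epi (S.g.hom.f p ▷ L.obj.X q) := (hSp p q).epi_g
  have hmono : Mono ((map S.f (𝟙 L)).hom.f n) := by
    rw [Preadditive.mono_iff_cancel_zero]
    intro Z g hg
    refine proj_ext fun p q h => ?_
    rw [zero_comp, ← cancel_mono (S.f.hom.f p ▷ L.obj.X q), zero_comp, Category.assoc, ← h₃,
      reassoc_of% hg, zero_comp]
  have hepi : Epi ((map S.g (𝟙 L)).hom.f n) := by
    rw [Preadditive.epi_iff_cancel_zero]
    intro Z g hg
    refine hom_ext fun p q h => ?_
    rw [comp_zero, ← cancel_epi (S.g.hom.f p ▷ L.obj.X q), comp_zero, ← Category.assoc, ← h₂,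
      Category.assoc, hg, comp_zero]
  suffices (ShortComplex.mk _ _ hzero).ShortExact from this
  -- A map killing the subobject is factored through the quotient on every summand, and the
  -- factorisations are reassembled by `desc`.
  refine ⟨ShortComplex.exact_of_g_is_cokernel _
    (CokernelCofork.IsColimit.ofπ' _ _ (fun {A} k hk => ?_))⟩
  dsimp at k hk
  have hk' (p q h) : S.f.hom.f p ▷ L.obj.X q ≫ inc S.X₂ L p q n h ≫ k = 0 := by
    rw [← Category.assoc, ← h₁, Category.assoc, hk, comp_zero]
  have hd (p q h) : S.g.hom.f p ▷ L.obj.X q ≫ (hSp p q).exact.desc _ (hk' p q h) =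
    inc S.X₂ L p q n h ≫ k := (hSp p q).exact.g_desc _ _
  refine ⟨desc (fun p q h => (hSp p q).exact.desc _ (hk' p q h)), ?_⟩
  refine hom_ext fun p q h => ?_
  rw [← Category.assoc, h₂, Category.assoc, inc_desc, hd]

/-- A cycle is shown to be a boundary row by row, a row being the set of summands with fixed degree
`q` in `L`. The first nonzero component is a cycle of `K ⊗ L.X q`, which is exact because `L.X q` is
flat. Subtracting a boundary clears this row, and only finitely many rows occur. -/
lemma acyclic_of_flat_right (K L : CochainComplex.Plus C) (hK : K.obj.Acyclic)
    (hL : ∀ n, IsFlat (L.obj.X n)) : (tensorComplex K L).obj.Acyclic := by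
  intro n
  rw [HomologicalComplex.exactAt_iff' _ (n - 1) n (n + 1) (by simp) (by simp),
    ShortComplex.exact_iff_exact_up_to_refinements]
  obtain ⟨a, ha⟩ := K.property
  -- Here the rows `q < k` of `x` are already zero and `m` bounds the number of rows left. Once `n -
  -- a < k`, the rows from `k` on vanish too, since their left degree `n - q` is below `a`.
  have key (m : ℕ) : ∀ (k : ℤ) (_ : n - a < k + m) {T : C}
      (x : T ⟶ (tensorComplex K L).obj.X n) (_ : x ≫ (tensorComplex K L).obj.d n (n + 1) = 0)
      (_ : ∀ p q h, q < k → x ≫ proj K L p q n h = 0),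
      ∃ (T' : C) (π : T' ⟶ T) (_ : Epi π) (y : T' ⟶ (tensorComplex K L).obj.X (n - 1)),
        π ≫ x = y ≫ (tensorComplex K L).obj.d (n - 1) n := by
    induction m with
    | zero =>
      intro k hk T x hx h
      refine ⟨T, 𝟙 _, inferInstance, 0, ?_⟩
      refine proj_ext fun p q hpq => ?_
      by_cases hq : q < k
      · simp [h p q hpq hq]
      · exact ((tensorRight (L.obj.X q)).map_isZero
          (K.obj.isZero_of_isStrictlyGE a p (by omega))).eq_of_tgt _ _
    | succ m hm =>
      intro k hk T x hx h
      have hflat := (hL k).preservesFiniteLimits_tensorRight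
      have hex := ((K.obj.exactAt_iff' (n - k - 1) (n - k) (n - k + 1) (by simp) (by simp)).1
        (hK (n - k))).map (tensorRight (L.obj.X k))
      -- The component `(n - k + 1, k)` of the boundary of `x` receives contributions from rows `k`
      -- and `k - 1` only, and the second is zero.
      have hxk : (x ≫ proj K L (n - k) k n (by omega)) ≫
          K.obj.d (n - k) (n - k + 1) ▷ L.obj.X k = 0 := by
        have := hx =≫ proj K L (n - k + 1) k (n + 1) (by omega)
        rw [Category.assoc, d_proj _ _ (n - k) (k - 1) _ _ _ _ _ rfl (by omega) rfl,
          Preadditive.comp_add, Linear.comp_units_smul, ← Category.assoc x,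
          ← Category.assoc x, h (n - k + 1) (k - 1) (by omega) (by omega)] at this
        simpa using this
      obtain ⟨T₁, π₁, hπ₁, y₁, hy₁⟩ : ∃ (T₁ : C) (π₁ : T₁ ⟶ T) (_ : Epi π₁)
          (y₁ : T₁ ⟶ K.obj.X (n - k - 1) ⊗ L.obj.X k),
          π₁ ≫ x ≫ proj K L (n - k) k n (by omega) =
            y₁ ≫ K.obj.d (n - k - 1) (n - k) ▷ L.obj.X k := hex.exact_up_to_refinements _ hxk
      let y : T₁ ⟶ (tensorComplex K L).obj.X (n - 1) :=
        y₁ ≫ inc K L (n - k - 1) k (n - 1) (by omega)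
      have hy : y ≫ (tensorComplex K L).obj.d (n - 1) n =
          π₁ ≫ x ≫ proj K L (n - k) k n (by omega) ≫ inc K L (n - k) k n (by omega) +
            (n - k - 1).negOnePow • (y₁ ≫ K.obj.X (n - k - 1) ◁ L.obj.d k (k + 1) ≫
              inc K L (n - k - 1) (k + 1) n (by omega)) := by
        dsimp [y]
        rw [Category.assoc, inc_d _ _ _ _ _ _ (n - k) (k + 1) _ (by omega) rfl (by omega),
          Preadditive.comp_add, Linear.comp_units_smul]
        congr 1
        simpa using! (hy₁ =≫ inc K L (n - k) k n (by omega)).symm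
      -- The boundary of `y` has the right component in row `k` and otherwise meets only row `k +
      -- 1`, so the difference falls under the induction hypothesis for `k + 1`.
      obtain ⟨T₂, π₂, hπ₂, z, hz⟩ := hm (k + 1) (by push_cast at hk; omega) (π₁ ≫ x - y ≫ (tensorComplex K L).obj.d (n - 1) n)
        (by simp [hx]) (fun p q hpq hq => by
          rw [hy]
          simp only [Preadditive.sub_comp, Preadditive.add_comp, Linear.units_smul_comp,
            Category.assoc]
          by_cases hqk : q = k
          · subst hqk
            obtain rfl : p = n - q := by omega
            rw [inc_proj, inc_proj_of_ne _ _ _ _ (n - q - 1) _ _ _ _ (by omega)]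
            simp
          · rw [h p q hpq (by omega), inc_proj_of_ne _ _ _ _ (n - k) _ _ _ _ (by omega),
              inc_proj_of_ne _ _ _ _ (n - k - 1) _ _ _ _ (by omega)]
            simp)
      refine ⟨T₂, π₂ ≫ π₁, epi_comp _ _, z + π₂ ≫ y, ?_⟩
      rw [Preadditive.add_comp, ← hz]
      simp
  intro T x hx
  obtain ⟨b, hb⟩ := L.property
  -- The descent starts at the lower bound `b` of `L`. If the integer under `toNat` is negative,
  -- then already `n - a < b` and no row is left.
  exact key (n - a + 1 - b).toNat b (by omega) x hx (fun p q hpq hq =>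
    ((tensorLeft (K.obj.X p)).map_isZero (L.obj.isZero_of_isStrictlyGE b q hq)).eq_of_tgt _ _)

end tensorComplex

end Flat

/-! ### The symmetry of the tensor product of complexes -/

section Braiding

variable {C : Type u} [Category.{v} C] [Abelian C] [MonoidalCategory C] [SymmetricCategory C]
  [MonoidalPreadditive C]

namespace tensorComplex

/-- The symmetry `x ⊗ y ↦ (-1) ^ (p * q) • y ⊗ x` of the tensor product of complexes. -/
def braid (K L : CochainComplex.Plus C) : tensorComplex K L ⟶ tensorComplex L K :=
  ObjectProperty.homMk
    { f n := desc fun p q h => (p * q).negOnePow •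
        ((β_ (K.obj.X p) (L.obj.X q)).hom ≫ inc L K q p n (by omega))
      comm' n n' hn := by
        refine hom_ext fun p q h => ?_
        rw [reassoc_of% @inc_desc, reassoc_of% (inc_d _ _ _ _ _ _ _ _ _ rfl rfl hn), Preadditive.add_comp,
          Linear.units_smul_comp, Linear.units_smul_comp, Category.assoc, Category.assoc,
          Category.assoc, inc_desc, inc_desc, inc_d _ _ _ _ _ _ _ _ _ rfl rfl hn,
          Preadditive.comp_add, smul_add, add_comm]
        simp only [Linear.comp_units_smul, smul_smul, ← Int.negOnePow_add,
          BraidedCategory.braiding_naturality_left_assoc,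
          BraidedCategory.braiding_naturality_right_assoc]
        congr 2
        · congr 1; ring
        -- The exponents to compare are `p * q` and `p + p * (q + 1)`, which differ by `2 * p`.
        · rw [Int.negOnePow_eq_iff]
          exact ⟨-p, by ring⟩ }

lemma inc_braid (K L : CochainComplex.Plus C) (p q n : ℤ) (h : p + q = n) :
    inc K L p q n h ≫ (braid K L).hom.f n = (p * q).negOnePow •
      ((β_ (K.obj.X p) (L.obj.X q)).hom ≫ inc L K q p n (by omega)) :=
  inc_desc (fun p q h => (p * q).negOnePow •
    ((β_ (K.obj.X p) (L.obj.X q)).hom ≫ inc L K q p n (by omega))) p q h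

@[simp]
lemma braid_braid (K L : CochainComplex.Plus C) : braid K L ≫ braid L K = 𝟙 _ := by
  ext n
  refine hom_ext fun p q h => ?_
  change inc K L p q n h ≫ (braid K L).hom.f n ≫ (braid L K).hom.f n = inc K L p q n h ≫ 𝟙 _
  rw [reassoc_of% @inc_braid, Linear.units_smul_comp, Category.assoc, inc_braid, Linear.comp_units_smul,
    smul_smul, mul_comm q p, Int.units_mul_self, one_smul, SymmetricCategory.symmetry_assoc,
    Category.comp_id]

instance (K L : CochainComplex.Plus C) : IsIso (braid K L) :=
  ⟨braid L K, braid_braid K L, braid_braid L K⟩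

lemma braid_naturality {K K' L L' : CochainComplex.Plus C} (f : K ⟶ K') (g : L ⟶ L') :
    map f g ≫ braid K' L' = braid K L ≫ map g f := by
  ext n
  refine hom_ext fun p q h => ?_
  change inc K L p q n h ≫ (map f g).hom.f n ≫ (braid K' L').hom.f n =
    inc K L p q n h ≫ (braid K L).hom.f n ≫ (map g f).hom.f n
  rw [reassoc_of% @inc_map, inc_braid, reassoc_of% @inc_braid, Linear.units_smul_comp, Category.assoc, inc_map,
    Linear.comp_units_smul, BraidedCategory.braiding_naturality_assoc]

end tensorComplex

end Braiding

/-! ### Tensoring quasi-isomorphisms with flat complexes -/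

section QuasiIso

variable {C : Type u} [Category.{v} C] [Abelian C]

/-- A bounded below complex receives an epimorphism from an acyclic complex which in each degree
is the sum of two terms of a prescribed family of objects mapping onto its terms. -/
lemma exists_acyclic_epi (L : CochainComplex.Plus C) (E : ℤ → C) (e : ∀ n, E n ⟶ L.obj.X n)
    [∀ n, Epi (e n)] (a : ℤ) (hE : ∀ n, n < a → IsZero (E n)) :
    ∃ (G : CochainComplex.Plus C) (g : G ⟶ L), G.obj.Acyclic ∧ (∀ n, Epi (g.hom.f n)) ∧
      ∀ n, ∃ i j, Nonempty (G.obj.X n ≅ E i ⊞ E j) := by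
  -- The complex sought is the cone of the identity of `Z`, which is contractible. The index shift
  -- makes its term of degree `n` the sum of `E n` and `E (n - 1)`, so that `e n` is one of the two
  -- components of the map to `L`.
  let Z : CochainComplex C ℤ := { X n := E (n - 1), d _ _ := 0 }
  let α : CochainComplex.HomComplex.Cochain Z L.obj (-1) :=
    CochainComplex.HomComplex.Cochain.mk
      (fun p q hpq => e (p - 1) ≫ (L.obj.XIsoOfEq (show p - 1 = q by omega)).hom)
  -- A map out of the cone of an identity is determined by its component of degree `-1`; the other
  -- component has to be its coboundary.
  let z : CochainComplex.HomComplex.Cocycle Z L.obj 0 :=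
    CochainComplex.HomComplex.Cocycle.mk (CochainComplex.HomComplex.δ (-1) 0 α) 1 (by simp)
      (CochainComplex.HomComplex.δ_δ _ _ _ _)
  let β : Z ⟶ L.obj := CochainComplex.HomComplex.Cocycle.homOf z
  have hβ : CochainComplex.HomComplex.δ (-1) 0 α =
      CochainComplex.HomComplex.Cochain.ofHom (𝟙 Z ≫ β) := by
    rw [Category.id_comp]
    exact (CochainComplex.HomComplex.Cocycle.cochain_ofHom_homOf_eq_coe z).symm
  let g : CochainComplex.mappingCone (𝟙 Z) ⟶ L.obj := CochainComplex.mappingCone.desc _ α β hβ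
  refine ⟨⟨CochainComplex.mappingCone (𝟙 Z), a, ?_⟩, ObjectProperty.homMk g, ?_, ?_, ?_⟩
  · rw [CochainComplex.isStrictlyGE_iff]
    intro i hi
    rw [CochainComplex.mappingCone.isZero_X_iff]
    exact ⟨hE _ (by omega), hE _ (by omega)⟩
  · intro n
    rw [HomologicalComplex.exactAt_iff_isZero_homology, IsZero.iff_id_eq_zero,
      ← HomologicalComplex.homologyMap_id,
      (CochainComplex.mappingCone.homotopyToZeroOfId Z).homologyMap_eq,
      HomologicalComplex.homologyMap_zero]
  · intro n
    have : Epi (α.v (n + 1) n (by omega)) := by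
      dsimp [α]
      infer_instance
    exact epi_of_epi_fac (CochainComplex.mappingCone.inl_v_desc_f (𝟙 Z) α β hβ (n + 1) n _)
  · intro n
    exact ⟨_, _, ⟨HomologicalComplex.homotopyCofiber.XIsoBiprod (𝟙 Z) n (n + 1) rfl⟩⟩

lemma exists_kernel {M K : CochainComplex.Plus C} (q : M ⟶ K) [∀ n, Epi (q.hom.f n)] :
    ∃ (N : CochainComplex.Plus C) (i : N ⟶ M) (w : i ≫ q = 0),
      ((ShortComplex.mk i q w).map (CochainComplex.Plus.ι C)).ShortExact := by
  have hmono (n : ℤ) : Mono ((kernel.ι q.hom).f n) :=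
    inferInstanceAs (Mono ((HomologicalComplex.eval C _ n).map (kernel.ι q.hom)))
  have hepi : Epi q.hom := HomologicalComplex.epi_of_epi_f _ inferInstance
  refine ⟨⟨kernel q.hom, ?_⟩, ObjectProperty.homMk (kernel.ι q.hom), ?_, ?_⟩
  · obtain ⟨a, ha⟩ := M.property
    refine ⟨a, ?_⟩
    rw [CochainComplex.isStrictlyGE_iff]
    intro i hi
    exact IsZero.of_mono ((kernel.ι q.hom).f i) (M.obj.isZero_of_isStrictlyGE a i hi)
  · ext : 1
    exact kernel.condition q.hom
  · exact { exact := ShortComplex.exact_of_f_is_kernel _ (kernelIsKernel q.hom)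
            mono_f := inferInstanceAs (Mono (kernel.ι q.hom))
            epi_g := hepi }

lemma quasiIso_g_of_acyclic {S : ShortComplex (CochainComplex C ℤ)} (hS : S.ShortExact)
    (h : S.X₁.Acyclic) : QuasiIso S.g where
  quasiIsoAt n := by
    rw [quasiIsoAt_iff_isIso_homologyMap]
    have h₀ (i : ℤ) : IsZero (S.X₁.homology i) := (h i).isZero_homology
    have : Mono (HomologicalComplex.homologyMap S.g n) :=
      (hS.homology_exact₂ n).mono_g ((h₀ n).eq_of_src _ _)
    have : Epi (HomologicalComplex.homologyMap S.g n) :=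
      (hS.homology_exact₃ n (n + 1) (by simp)).epi_f ((h₀ _).eq_of_tgt _ _)
    exact isIso_of_mono_of_epi _

/-- An additive functor sends `K ⟶ K ⊞ G` to a quasi-isomorphism if it sends `G` to an acyclic
complex. -/
lemma quasiIso_map_biprod_inl {C' : Type u₁} [Category.{v₁} C'] [Abelian C']
    (T : CochainComplex.Plus C ⥤ CochainComplex.Plus C') [T.Additive]
    (K G : CochainComplex.Plus C) [HasBinaryBiproduct K G] (hG : (T.obj G).obj.Acyclic) :
    QuasiIso (T.map (biprod.inl : K ⟶ K ⊞ G)).hom := by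
  refine ⟨fun n => ?_⟩
  rw [quasiIsoAt_iff_isIso_homologyMap]
  let H := T ⋙ CochainComplex.Plus.ι C' ⋙ HomologicalComplex.homologyFunctor C' (.up ℤ) n
  have hzero : IsZero (H.obj G) := (hG n).isZero_homology
  refine ⟨H.map biprod.fst, ?_, ?_⟩
  · change H.map biprod.inl ≫ _ = 𝟙 (H.obj K)
    rw [← H.map_comp, biprod.inl_fst, H.map_id]
  · change _ ≫ H.map biprod.inl = 𝟙 (H.obj (K ⊞ G))
    rw [← H.map_id, ← biprod.total, H.map_add, H.map_comp biprod.snd,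
      hzero.eq_of_tgt (H.map biprod.snd) 0, zero_comp, add_zero, H.map_comp]

/-- Any additive functor which preserves acyclic complexes and sends degreewise epimorphic
quasi-isomorphisms to quasi-isomorphisms preserves quasi-isomorphisms. -/
lemma map_quasiIso_of_epi {C' : Type u₁} [Category.{v₁} C'] [Abelian C']
    (T : CochainComplex.Plus C ⥤ CochainComplex.Plus C') [T.Additive]
    (h₀ : ∀ K : CochainComplex.Plus C, K.obj.Acyclic → (T.obj K).obj.Acyclic)
    (h₁ : ∀ ⦃K L : CochainComplex.Plus C⦄ (f : K ⟶ L), (∀ n, Epi (f.hom.f n)) → QuasiIso f.hom →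
      QuasiIso (T.map f).hom)
    {K L : CochainComplex.Plus C} (f : K ⟶ L) (hf : QuasiIso f.hom) : QuasiIso (T.map f).hom := by
  obtain ⟨a, ha⟩ := L.property
  -- With `G` acyclic and mapping onto `L`, `f` factors as `K ⟶ K ⊞ G ⟶ L`. The first arrow is
  -- controlled by additivity and the acyclicity of `T G`, the second is a degreewise epimorphic
  -- quasi-isomorphism.
  obtain ⟨G, g, hG, hg, -⟩ := exists_acyclic_epi L (fun n => L.obj.X n) (fun n => 𝟙 _) a
    (fun n hn => L.obj.isZero_of_isStrictlyGE a n hn)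
  have : HasBinaryBiproducts (CochainComplex.Plus C) := HasBinaryBiproducts.of_hasBinaryProducts
  let s : K ⟶ K ⊞ G := biprod.inl
  let q : K ⊞ G ⟶ L := biprod.desc f g
  have hs : s ≫ q = f := biprod.inl_desc _ _
  have hs₁ : QuasiIso s.hom := quasiIso_map_biprod_inl (𝟭 _) K G hG
  have hs₂ : QuasiIso (T.map s).hom := quasiIso_map_biprod_inl T K G (h₀ G hG)
  have hq : QuasiIso q.hom := by
    have : QuasiIso (s.hom ≫ q.hom) := by
      rw [← ObjectProperty.FullSubcategory.comp_hom, hs]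
      exact hf
    exact quasiIso_of_comp_left s.hom q.hom
  have hq' (n : ℤ) : Epi (q.hom.f n) := by
    have h : (biprod.inr : G ⟶ K ⊞ G).hom.f n ≫ q.hom.f n = g.hom.f n := by
      rw [← HomologicalComplex.comp_f, ← ObjectProperty.FullSubcategory.comp_hom,
        biprod.inr_desc]
    have := hg n
    exact epi_of_epi_fac h
  have := h₁ q hq' hq
  rw [← hs, T.map_comp, ObjectProperty.FullSubcategory.comp_hom]
  infer_instance

variable [MonoidalCategory C] [SymmetricCategory C]
  [MonoidalPreadditive C] [∀ X : C, PreservesFiniteColimits (tensorLeft X)]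

namespace tensorComplex

/-- The kernel of an epimorphic quasi-isomorphism is acyclic. Tensoring with `L` preserves both the
short exact sequence and this acyclicity, and `map_quasiIso_of_epi` removes the assumption of
epimorphy. -/
lemma quasiIso_map_id {K K' : CochainComplex.Plus C} (f : K ⟶ K') (hf : QuasiIso f.hom)
    (L : CochainComplex.Plus C) (hL : ∀ n, IsFlat (L.obj.X n)) : QuasiIso (map f (𝟙 L)).hom := by
  refine map_quasiIso_of_epi (withRight L) (fun K hK => acyclic_of_flat_right K L hK hL)
    (fun K K' f hf₁ hf₂ => ?_) f hf
  obtain ⟨N, i, w, hS⟩ := exists_kernel f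
  exact quasiIso_g_of_acyclic (shortExact_withRight _ hS L hL)
    (acyclic_of_flat_right N L (hS.acyclic_X₁ hf₂) hL)

lemma quasiIso_id_map {L L' : CochainComplex.Plus C} (g : L ⟶ L') (hg : QuasiIso g.hom)
    (K : CochainComplex.Plus C) (hK : ∀ n, IsFlat (K.obj.X n)) : QuasiIso (map (𝟙 K) g).hom := by
  have h : map (𝟙 K) g = braid K L ≫ map g (𝟙 K) ≫ braid L' K := by
    rw [braid_naturality, reassoc_of% @braid_braid]
  have := quasiIso_map_id g hg K hK
  have h₁ : IsIso (braid K L).hom :=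
    inferInstanceAs (IsIso ((CochainComplex.Plus.ι C).map (braid K L)))
  have h₂ : IsIso (braid L' K).hom :=
    inferInstanceAs (IsIso ((CochainComplex.Plus.ι C).map (braid L' K)))
  rw [h]
  simp only [ObjectProperty.FullSubcategory.comp_hom]
  infer_instance

end tensorComplex

end QuasiIso

/-! ### Flat dimension of objects -/

section TorDimension

variable {C : Type u} [Category.{v} C] [Abelian C]

/-- The sequence `0 ⟶ X ⟶ Y ⟶ Z ⟶ 0` is exact. -/
def IsSES {X Y Z : C} (i : X ⟶ Y) (p : Y ⟶ Z) : Prop :=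
  ∃ w : i ≫ p = 0, (ShortComplex.mk i p w).ShortExact

namespace IsSES

lemma of_epi {Y Z : C} (p : Y ⟶ Z) [Epi p] : IsSES (kernel.ι p) p :=
  ⟨kernel.condition p, { exact := ShortComplex.exact_of_f_is_kernel _ (kernelIsKernel p)
                         mono_f := inferInstanceAs (Mono (kernel.ι p))
                         epi_g := inferInstanceAs (Epi p) }⟩

variable {X Y Z : C} {i : X ⟶ Y} {p : Y ⟶ Z} (h : IsSES i p)
include h

lemma epi : Epi p := h.2.epi_g

/-- The base change of a short exact sequence. -/
lemma pullback {T : C} (x : T ⟶ Z) :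
    ∃ j : X ⟶ pullback p x, IsSES j (pullback.snd p x) ∧ j ≫ pullback.fst p x = i := by
  obtain ⟨w, h⟩ := h
  have := h.mono_f
  have := h.epi_g
  dsimp at *
  refine ⟨pullback.lift i 0 (by simp [w]), ⟨pullback.lift_snd _ _ _, ?_⟩, pullback.lift_fst _ _ _⟩
  have hmono : Mono (pullback.lift (f := p) (g := x) i 0 (by simp [w])) :=
    mono_of_mono_fac (h := i) (pullback.lift_fst _ _ _)
  exact { exact := ShortComplex.exact_of_f_is_kernel _ (KernelFork.IsLimit.ofι' _ _
            (fun {A} k hk => by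
              dsimp at k hk
              have hk' : (k ≫ pullback.fst p x) ≫ p = 0 := by
                rw [Category.assoc, pullback.condition, reassoc_of% hk, zero_comp]
              refine ⟨h.exact.lift _ hk', pullback.hom_ext ?_ ?_⟩
              · have := h.exact.lift_f _ hk'
                dsimp at this
                rw [Category.assoc, pullback.lift_fst, this]
              · rw [Category.assoc, pullback.lift_snd, comp_zero, hk]))
          mono_f := hmono
          epi_g := inferInstanceAs (Epi (pullback.snd p x)) }

/-- The base change of the kernel of an epimorphism. -/
lemma pullback_fst {G : C} (g : G ⟶ Y) [Epi g] : IsSES (pullback.fst g i) (g ≫ p) := by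
  obtain ⟨w, h⟩ := h
  have := h.mono_f
  have := h.epi_g
  dsimp at *
  refine ⟨by rw [pullback.condition_assoc, w, comp_zero], ?_⟩
  exact { exact := ShortComplex.exact_of_f_is_kernel _ (KernelFork.IsLimit.ofι' _ _
            (fun {A} k hk => by
              dsimp at k hk
              have hk' : (k ≫ g) ≫ p = 0 := by rwa [Category.assoc]
              have := h.exact.lift_f _ hk'
              dsimp at this
              exact ⟨pullback.lift k (h.exact.lift _ hk') this.symm, pullback.lift_fst _ _ _⟩))
          mono_f := inferInstanceAs (Mono (pullback.fst g i))
          epi_g := inferInstanceAs (Epi (g ≫ p)) }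

end IsSES

variable [MonoidalCategory C]

lemma IsFlat.of_iso {P Q : C} (e : P ≅ Q) (hP : IsFlat P) : IsFlat Q :=
  have : PreservesFiniteLimits (tensorLeft P) := hP
  preservesFiniteLimits_of_natIso ((curriedTensor C).mapIso e)

variable [MonoidalPreadditive C] [SymmetricCategory C]
  [∀ X : C, PreservesFiniteColimits (tensorLeft X)]

lemma IsFlat.of_isZero {P : C} (hP : IsZero P) : IsFlat P := by
  rw [isFlat_iff_mono]
  intro X Y f _
  have : IsZero (P ⊗ X) := (tensorRight X).map_isZero hP
  exact ⟨fun _ _ _ => this.eq_of_tgt _ _⟩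

lemma IsFlat.biprod {P Q : C} (hP : IsFlat P) (hQ : IsFlat Q) : IsFlat (P ⊞ Q) := by
  rw [isFlat_iff_mono]
  intro X Y f _
  have := hP.mono_whiskerLeft f
  have := hQ.mono_whiskerLeft f
  rw [Preadditive.mono_iff_cancel_zero]
  intro Z x hx
  have h₁ : x ≫ (biprod.fst : P ⊞ Q ⟶ P) ▷ X = 0 := by
    rw [← cancel_mono (P ◁ f), Category.assoc, ← whisker_exchange, reassoc_of% hx,
      zero_comp, zero_comp]
  have h₂ : x ≫ (biprod.snd : P ⊞ Q ⟶ Q) ▷ X = 0 := by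
    rw [← cancel_mono (Q ◁ f), Category.assoc, ← whisker_exchange, reassoc_of% hx,
      zero_comp, zero_comp]
  rw [← Category.comp_id x, ← id_whiskerRight, ← biprod.total,
    MonoidalPreadditive.add_whiskerRight, comp_whiskerRight, comp_whiskerRight,
    Preadditive.comp_add, reassoc_of% h₁, reassoc_of% h₂, zero_comp, zero_comp, add_zero]

/-- An epimorphic short exact sequence with flat quotient is universally exact. -/
lemma IsSES.mono_whiskerRight (hC : ∀ X : C, ∃ (P : C) (p : P ⟶ X), IsFlat P ∧ Epi p)
    {X R P : C} {i : X ⟶ R} {p : R ⟶ P} (h : IsSES i p) (hP : IsFlat P) (M : C) :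
    Mono (i ▷ M) := by
  obtain ⟨w, h⟩ := h
  have := h.mono_f
  have := h.epi_g
  dsimp at *
  -- The assertion is the vanishing of `Tor₁(P, M)`, read off the diagram obtained by tensoring `X ⟶
  -- R ⟶ P` with `kernel g ⟶ G ⟶ M` for a flat cover `G` of `M`.
  obtain ⟨G, g, hG, _⟩ := hC M
  obtain ⟨w', hN⟩ := IsSES.of_epi g
  have := hP.mono_whiskerLeft (kernel.ι g)
  have := hG.mono_whiskerRight i
  have hwN : i ▷ kernel g ≫ p ▷ kernel g = 0 := by
    rw [← comp_whiskerRight, w, MonoidalPreadditive.zero_whiskerRight]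
  have hw' : R ◁ kernel.ι g ≫ R ◁ g = 0 := by
    rw [← whiskerLeft_comp, w', MonoidalPreadditive.whiskerLeft_zero]
  have ex₁ : (ShortComplex.mk _ _ hwN).Exact :=
    h.exact.map_of_epi_of_preservesCokernel (tensorRight (kernel g)) inferInstance inferInstance
  have ex₂ : (ShortComplex.mk _ _ hw').Exact :=
    hN.exact.map_of_epi_of_preservesCokernel (tensorLeft R) inferInstance inferInstance
  have : Epi (X ◁ g) := inferInstanceAs (Epi ((tensorLeft X).map g))
  rw [Preadditive.mono_iff_cancel_zero]
  intro T x hx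
  -- Let `x` in `X ⊗ M` die in `R ⊗ M` and lift it to `y` in `X ⊗ G`. Its image in `R ⊗ G` comes
  -- from some `r` in `R ⊗ kernel g`. Flatness of `P` shows that `r` dies in `P ⊗ kernel g`, so it
  -- comes from some `z` in `X ⊗ kernel g`. Flatness of `G` shows that `z` maps to `y`, whence `x =
  -- 0`.
  obtain ⟨T₁, π₁, _, y, hy⟩ := surjective_up_to_refinements_of_epi (X ◁ g) x
  obtain ⟨T₂, π₂, _, r, hr⟩ := ex₂.exact_up_to_refinements (y ≫ i ▷ G) (by
    dsimp
    rw [Category.assoc, ← whisker_exchange, ← reassoc_of% hy, hx, comp_zero])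
  dsimp at r hr
  obtain ⟨T₃, π₃, _, z, hz⟩ := ex₁.exact_up_to_refinements r (by
    dsimp
    rw [← cancel_mono (P ◁ kernel.ι g), zero_comp, Category.assoc, ← whisker_exchange,
      ← reassoc_of% hr, ← comp_whiskerRight, w,
      MonoidalPreadditive.zero_whiskerRight, comp_zero, comp_zero])
  dsimp at z hz
  have hyz : π₃ ≫ π₂ ≫ y = z ≫ X ◁ kernel.ι g := by
    rw [← cancel_mono (i ▷ G), Category.assoc, Category.assoc, hr, reassoc_of% hz,
      Category.assoc, whisker_exchange]
  rw [← cancel_epi π₁, ← cancel_epi π₂, ← cancel_epi π₃, hy, reassoc_of% hyz,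
    ← whiskerLeft_comp, kernel.condition, MonoidalPreadditive.whiskerLeft_zero]
  simp

/-- For a monomorphism `M' ⟶ M` the composite `X ⊗ M' ⟶ R ⊗ M' ⟶ R ⊗ M` is mono, and it factors
through `X ⊗ M' ⟶ X ⊗ M`. -/
lemma IsSES.isFlat_left (hC : ∀ X : C, ∃ (P : C) (p : P ⟶ X), IsFlat P ∧ Epi p)
    {X R P : C} {i : X ⟶ R} {p : R ⟶ P} (h : IsSES i p) (hP : IsFlat P) (hR : IsFlat R) :
    IsFlat X := by
  rw [isFlat_iff_mono]
  intro M' M f _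
  have := h.mono_whiskerRight hC hP M'
  have := hR.mono_whiskerLeft f
  exact mono_of_mono_fac (h := i ▷ M' ≫ R ◁ f) (whisker_exchange i f)

/-- A four lemma: tensoring with a monomorphism is mono on both ends, and the sequence tensored with
the target is still left exact because `P` is flat. -/
lemma IsSES.isFlat_middle (hC : ∀ X : C, ∃ (P : C) (p : P ⟶ X), IsFlat P ∧ Epi p)
    {X R P : C} {i : X ⟶ R} {p : R ⟶ P} (h : IsSES i p) (hP : IsFlat P) (hX : IsFlat X) :
    IsFlat R := by
  rw [isFlat_iff_mono]
  intro M' M f _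
  have := h.mono_whiskerRight hC hP
  have := hX.mono_whiskerLeft f
  have := hP.mono_whiskerLeft f
  obtain ⟨w, h⟩ := h
  have := h.epi_g
  have hw (M : C) : i ▷ M ≫ p ▷ M = 0 := by
    rw [← comp_whiskerRight, w, MonoidalPreadditive.zero_whiskerRight]
  have ex : (ShortComplex.mk _ _ (hw M')).Exact :=
    h.exact.map_of_epi_of_preservesCokernel (tensorRight M') inferInstance inferInstance
  let φ : ShortComplex.mk _ _ (hw M') ⟶ ShortComplex.mk _ _ (hw M) :=
    { τ₁ := X ◁ f, τ₂ := R ◁ f, τ₃ := P ◁ f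
      comm₁₂ := whisker_exchange i f
      comm₂₃ := whisker_exchange p f }
  exact ShortComplex.mono_τ₂_of_exact_of_mono φ ex

/-- The object `X` has a flat resolution of length at most `n`. -/
def TorDimLE : ℕ → C → Prop
  | 0, X => IsFlat X
  | n + 1, X => ∃ (X' P : C) (i : X' ⟶ P) (p : P ⟶ X), IsSES i p ∧ IsFlat P ∧ TorDimLE n X'

namespace TorDimLE

/-- The first step `G ⟶ R` of a resolution is pulled back to `X`. The fibre product has the same
kernel over `X`, and it is flat, being the kernel of the epimorphism `G ⟶ P` of flat objects. -/
lemma of_left {n : ℕ} (hC : ∀ X : C, ∃ (P : C) (p : P ⟶ X), IsFlat P ∧ Epi p)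
    {X R P : C} {i : X ⟶ R} {p : R ⟶ P} (h : IsSES i p) (hP : IsFlat P) (hR : TorDimLE n R) :
    TorDimLE n X := by
  cases n with
  | zero => exact h.isFlat_left hC hP hR
  | succ n =>
    obtain ⟨S, G, s, g, hsg, hG, hS⟩ := hR
    obtain ⟨j, hj, -⟩ := hsg.pullback i
    have := hsg.epi
    exact ⟨S, _, j, _, hj, (h.pullback_fst g).isFlat_left hC hP hG, hS⟩

/-- The second clause makes the bound independent of the chosen flat cover: any one has a kernel of
dimension at most `n`. The two clauses are proved together, since each feeds the other. -/
lemma of_middle (hC : ∀ X : C, ∃ (P : C) (p : P ⟶ X), IsFlat P ∧ Epi p) (n : ℕ) :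
    (∀ {X R P : C} {i : X ⟶ R} {p : R ⟶ P}, IsSES i p → IsFlat P → TorDimLE n X →
      TorDimLE n R) ∧
    ∀ {X' P X : C} {i : X' ⟶ P} {p : P ⟶ X}, IsSES i p → IsFlat P → TorDimLE (n + 1) X →
      TorDimLE n X' := by
  -- Schanuel's argument: the fibre product of the covers `P` and `Q` of `X` is an extension of `P`
  -- by `X''` and of `Q` by `X'`. The first description bounds its dimension, and `of_left` passes
  -- the bound to `X'`.
  have key (n : ℕ) (hn : ∀ {X R P : C} {i : X ⟶ R} {p : R ⟶ P}, IsSES i p → IsFlat P →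
      TorDimLE n X → TorDimLE n R) {X' P X : C} {i : X' ⟶ P} {p : P ⟶ X} (h : IsSES i p)
      (hP : IsFlat P) (hX : TorDimLE (n + 1) X) : TorDimLE n X' := by
    obtain ⟨X'', Q, j, q, hjq, hQ, hX''⟩ := hX
    obtain ⟨a, ha, -⟩ := h.pullback q
    obtain ⟨b, hb, -⟩ := hjq.pullback p
    have e : pullback q p ≅ pullback p q := pullbackSymmetry q p
    have hR := hn hb hP hX''
    have : TorDimLE n (pullback p q) := by
      refine hn (i := b ≫ (pullbackSymmetry q p).hom) (p := pullback.fst p q) ?_ hP hX''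
      obtain ⟨w, hb⟩ := hb
      refine ⟨by simpa using w, ShortComplex.shortExact_of_iso (ShortComplex.isoMk
        (S₁ := ShortComplex.mk b (pullback.snd q p) w) (Iso.refl _)
        (pullbackSymmetry q p) (Iso.refl _) ?_ ?_) hb⟩
      · exact (Category.id_comp _).trans rfl
      · exact (pullbackSymmetry_hom_comp_fst q p).trans (Category.comp_id _).symm
    exact of_left hC ha hQ this
  induction n with
  | zero =>
    have h₀ {X R P : C} {i : X ⟶ R} {p : R ⟶ P} (h : IsSES i p) (hP : IsFlat P)
      (hX : TorDimLE 0 X) : TorDimLE 0 R := h.isFlat_middle hC hP hX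
    exact ⟨h₀, key 0 h₀⟩
  | succ n hn =>
    have h₀ {X R P : C} {i : X ⟶ R} {p : R ⟶ P} (h : IsSES i p) (hP : IsFlat P)
        (hX : TorDimLE (n + 1) X) : TorDimLE (n + 1) R := by
      -- For a flat cover `G` of `R`, the kernel of `G ⟶ R` is also the kernel of the pulled back
      -- cover of `X`, whose source is flat as the kernel of `G ⟶ P`. The second clause in the
      -- preceding degree then applies to it.
      obtain ⟨G, g, hG, _⟩ := hC R
      obtain ⟨j, hj, -⟩ := (IsSES.of_epi g).pullback i
      exact ⟨_, G, _, g, .of_epi g, hG,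
        hn.2 hj ((h.pullback_fst g).isFlat_left hC hP hG) hX⟩
    exact ⟨h₀, key _ h₀⟩

end TorDimLE

/-- The syzygies of a resolution of length `n` are its opcycles; those in degree `n + 1` vanish, and
descending induction gives the bound for `opcycles 0 ≅ X`. Writing the bound as a successor makes a
flat cover of `X` part of the data, whence `enoughFlats`. -/
lemma HasFiniteTorDimension.exists_torDimLE (h : HasFiniteTorDimension C) :
    ∃ n, ∀ X : C, TorDimLE (n + 1) X := by
  obtain ⟨n, hn⟩ := h
  refine ⟨n, fun X => ?_⟩
  obtain ⟨P, π, _, hP, hP'⟩ := hn X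
  have hex (i : ℕ) : P.ExactAt (i + 1) := by
    rw [← quasiIsoAt_iff_exactAt' π (i + 1) (ChainComplex.exactAt_succ_single_obj _ _)]
    infer_instance
  have hses (i : ℕ) : IsSES (P.fromOpcycles (i + 1) i) (P.pOpcycles i) := by
    have hmono : Mono (P.fromOpcycles (i + 1) i) := by
      rw [Preadditive.mono_iff_cancel_zero]
      intro Z k hk
      have := P.homologyIsKernel (i + 1) i (by simp)
      obtain ⟨l, hl⟩ := KernelFork.IsLimit.lift' this k hk
      rw [← hl, (hex i).isZero_homology.eq_of_tgt l 0, zero_comp]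
    have hw : P.fromOpcycles (i + 1) i ≫ P.pOpcycles i = 0 := by
      rw [← cancel_epi (P.pOpcycles (i + 1))]
      simp
    refine ⟨hw, { exact := ShortComplex.exact_of_g_is_cokernel _
                    (CokernelCofork.IsColimit.ofπ' _ _ fun {A} k hk => ?_)
                  mono_f := hmono
                  epi_g := inferInstanceAs (Epi (P.pOpcycles i)) }⟩
    dsimp at k hk
    exact ⟨P.descOpcycles k (i + 1) (by simp) (by rw [← P.p_fromOpcycles, Category.assoc, hk,
      comp_zero]), by simp⟩
  have key (k : ℕ) : ∀ i, i + k = n + 1 → TorDimLE k (P.opcycles i) := by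
    induction k with
    | zero =>
      intro i hi
      have : IsZero (P.X i) := hP' i (by omega)
      exact IsFlat.of_isZero (IsZero.of_epi (P.pOpcycles i) this)
    | succ k hk =>
      intro i hi
      exact ⟨_, _, _, _, hses i, hP i, hk (i + 1) (by omega)⟩
  obtain ⟨X', Q, i, p, hip, hQ, hX'⟩ := key (n + 1) 0 (by omega)
  let e : P.opcycles 0 ≅ X := P.isoHomologyι₀.symm ≪≫ isoOfQuasiIsoAt π 0 ≪≫
    HomologicalComplex.singleObjHomologySelfIso _ _ _
  obtain ⟨w, hip⟩ := hip
  refine ⟨X', Q, i, p ≫ e.hom, ⟨by rw [reassoc_of% w, zero_comp],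
    ShortComplex.shortExact_of_iso (ShortComplex.isoMk (S₁ := ShortComplex.mk i p w)
      (Iso.refl _) (Iso.refl _) e ?_ ?_) hip⟩, hQ, hX'⟩ <;> simp

lemma HasFiniteTorDimension.enoughFlats (h : HasFiniteTorDimension C) (X : C) :
    ∃ (P : C) (p : P ⟶ X), IsFlat P ∧ Epi p := by
  obtain ⟨n, hn⟩ := h.exists_torDimLE
  obtain ⟨X', P, i, p, hip, hP, -⟩ := hn X
  exact ⟨P, p, hP, hip.epi⟩

end TorDimension

/-! ### Flat resolutions of bounded below complexes -/

section FlatResolution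

variable {C : Type u} [Category.{v} C] [Abelian C]

lemma quasiIso_mappingCone_map {K₁ L₁ K₂ L₂ : CochainComplex C ℤ} (φ₁ : K₁ ⟶ L₁) (φ₂ : K₂ ⟶ L₂)
    (a : K₁ ⟶ K₂) (b : L₁ ⟶ L₂) (comm : φ₁ ≫ b = a ≫ φ₂) (ha : QuasiIso a) (hb : QuasiIso b) :
    QuasiIso (CochainComplex.mappingCone.map φ₁ φ₂ a b comm) := by
  let := HasDerivedCategory.standard C
  rw [← DerivedCategory.isIso_Q_map_iff_quasiIso] at ha hb ⊢
  exact Pretriangulated.isIso₃_of_isIso₁₂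
    (DerivedCategory.Q.mapTriangle.map (CochainComplex.mappingCone.triangleMap φ₁ φ₂ a b comm))
    (DerivedCategory.mappingCone_triangle_distinguished φ₁)
    (DerivedCategory.mappingCone_triangle_distinguished φ₂) ha hb

variable [MonoidalCategory C] [MonoidalPreadditive C] [SymmetricCategory C]
  [∀ X : C, PreservesFiniteColimits (tensorLeft X)]

/-- The flat covers of the terms must be chosen zero wherever `K` is zero by its bound, so that the
resulting complex is bounded below. -/
lemma exists_flat_acyclic_epi (hC : ∀ X : C, ∃ (P : C) (p : P ⟶ X), IsFlat P ∧ Epi p)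
    (K : CochainComplex.Plus C) :
    ∃ (G : CochainComplex.Plus C) (g : G ⟶ K), G.obj.Acyclic ∧ (∀ n, Epi (g.hom.f n)) ∧
      ∀ n, IsFlat (G.obj.X n) := by
  obtain ⟨a, ha⟩ := K.property
  have (n : ℤ) : ∃ (E : C) (e : E ⟶ K.obj.X n), IsFlat E ∧ Epi e ∧ (n < a → IsZero E) := by
    by_cases hn : n < a
    · have := K.obj.isZero_of_isStrictlyGE a n hn
      exact ⟨_, 𝟙 _, .of_isZero this, inferInstance, fun _ => this⟩
    · obtain ⟨E, e, hE, he⟩ := hC (K.obj.X n)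
      exact ⟨E, e, hE, he, fun h => (hn h).elim⟩
  choose E e hE he hE' using this
  obtain ⟨G, g, hG, hg, h⟩ := exists_acyclic_epi K E e a hE'
  refine ⟨G, g, hG, hg, fun n => ?_⟩
  obtain ⟨i, j, ⟨φ⟩⟩ := h n
  exact ((hE i).biprod (hE j)).of_iso φ.symm

/-- Induction on the dimension: the kernel `N` of a cover `G ⟶ K` with flat terms has dimension one
less, hence a flat resolution `P`. The cone of `P ⟶ G` is flat, and it maps quasi-isomorphically to
the cone of `N ⟶ G`, hence to `K`. Only the flatness and surjectivity of `G` matter here, not its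
acyclicity. -/
lemma exists_flat_resolution_of_torDimLE
    (hC : ∀ X : C, ∃ (P : C) (p : P ⟶ X), IsFlat P ∧ Epi p) (n : ℕ)
    (K : CochainComplex.Plus C) (hK : ∀ i, TorDimLE n (K.obj.X i)) :
    ∃ (P : CochainComplex.Plus C) (p : P ⟶ K), (∀ i, IsFlat (P.obj.X i)) ∧ QuasiIso p.hom ∧
      ∀ i, Epi (p.hom.f i) := by
  induction n generalizing K with
  | zero => exact ⟨K, 𝟙 K, hK, inferInstanceAs (QuasiIso (𝟙 K.obj)),
      fun i => inferInstanceAs (Epi (𝟙 (K.obj.X i)))⟩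
  | succ n hn =>
    obtain ⟨G, g, -, hg, hG⟩ := exists_flat_acyclic_epi hC K
    obtain ⟨N, j, w, hS⟩ := exists_kernel g
    have hN (i : ℤ) : TorDimLE n (N.obj.X i) :=
      (TorDimLE.of_middle hC n).2 (i := j.hom.f i) (p := g.hom.f i)
        ⟨_, hS.map_of_exact (HomologicalComplex.eval C _ i)⟩ (hG i) (hK i)
    obtain ⟨P, p, hP, hp, -⟩ := hn N hN
    let S := (ShortComplex.mk j g w).map (CochainComplex.Plus.ι C)
    let r := CochainComplex.mappingCone.map (p ≫ j).hom S.f p.hom (𝟙 G.obj) (Category.comp_id _)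
    let q : CochainComplex.mappingCone (p ≫ j).hom ⟶ K.obj :=
      r ≫ CochainComplex.mappingCone.descShortComplex S
    have hq : CochainComplex.mappingCone.inr (p ≫ j).hom ≫ q = g.hom := by
      have h₁ : CochainComplex.mappingCone.inr (p ≫ j).hom ≫ r =
          CochainComplex.mappingCone.inr S.f :=
        (CochainComplex.mappingCone.inr_desc ..).trans (Category.id_comp _)
      exact (Category.assoc _ _ _).symm.trans ((h₁ =≫ _).trans (CochainComplex.mappingCone.inr_descShortComplex S))
    obtain ⟨a, ha⟩ := P.property
    obtain ⟨b, hb⟩ := G.property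
    refine ⟨⟨CochainComplex.mappingCone (p ≫ j).hom, min (a - 1) b,
      CochainComplex.isStrictlyGE_mappingCone _ a b _⟩, ObjectProperty.homMk q, ?_, ?_, ?_⟩
    · intro i
      exact ((hP (i + 1)).biprod (hG i)).of_iso
        (HomologicalComplex.homotopyCofiber.XIsoBiprod (p ≫ j).hom i (i + 1) rfl).symm
    · have : QuasiIso r := quasiIso_mappingCone_map _ _ _ _ _ hp (quasiIso_of_isIso (𝟙 G.obj))
      have : QuasiIso (CochainComplex.mappingCone.descShortComplex S) :=
        CochainComplex.mappingCone.quasiIso_descShortComplex hS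
      exact inferInstanceAs (QuasiIso (r ≫ CochainComplex.mappingCone.descShortComplex S))
    · intro i
      have := hg i
      exact epi_of_epi_fac (congr_arg (fun φ => φ.f i) hq)

/-- If the Tor-dimension is finite, bounded below complexes have flat resolutions. -/
lemma HasFiniteTorDimension.exists_flat_resolution (h : HasFiniteTorDimension C)
    (K : CochainComplex.Plus C) :
    ∃ (P : CochainComplex.Plus C) (p : P ⟶ K), (∀ i, IsFlat (P.obj.X i)) ∧ QuasiIso p.hom ∧
      ∀ i, Epi (p.hom.f i) := by
  obtain ⟨n, hn⟩ := h.exists_torDimLE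
  exact exists_flat_resolution_of_torDimLE h.enoughFlats (n + 1) K fun i => hn _

end FlatResolution

/-! ### A criterion for left derived functors -/

section LeftResolutions

variable {C : Type u} [Category.{v} C]

/-- Sufficient conditions for a functor which inverts the weak equivalences `W` between the objects
satisfying `P` to have a left derived functor, in terms of a class `T` of "trivial fibrations". -/
structure IsLeftResolving (W : MorphismProperty C) (P : ObjectProperty C)
    (T : MorphismProperty C) : Prop where
  le : T ≤ W
  id (X : C) : T (𝟙 X)
  resolve ⦃X Y Y' : C⦄ (f : X ⟶ Y) (q : Y' ⟶ Y) : T q →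
    ∃ (X' : C) (p : X' ⟶ X) (g : X' ⟶ Y'), P X' ∧ T p ∧ p ≫ f = g ≫ q
  pair ⦃Q Y : C⦄ (q : Q ⟶ Y) : T q →
    ∃ (K : C) (r₁ r₂ : K ⟶ Q), W r₁ ∧
      ∀ ⦃Z : C⦄ (u v : Z ⟶ Q), u ≫ q = v ≫ q → ∃ m : Z ⟶ K, m ≫ r₁ = u ∧ m ≫ r₂ = v

namespace IsLeftResolving

variable {W : MorphismProperty C} {P : ObjectProperty C} {T : MorphismProperty C}
  (h : IsLeftResolving W P T)

include h

section

variable {E : Type u₁} [Category.{v₁} E] {F : C ⥤ E}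
  (hF : ∀ ⦃X Y : C⦄ (f : X ⟶ Y), P X → P Y → W f → IsIso (F.map f))

include hF

/-- The object `K` with `r₁`, `r₂` behaves like the fibre product of `Q` with itself over `Y`, and
`u`, `v` factor through it. It suffices that `F` identifies `r₁` and `r₂` on a resolution of `K`.
They agree on a lift of the diagonal, and `F` inverts that lift because it inverts its composite
with `r₁`. -/
lemma map_eq_map [W.HasTwoOutOfThreeProperty] {X Q Y : C} (hX : P X) (hQ : P Q) (q : Q ⟶ Y)
    (hq : T q) (u v : X ⟶ Q) (huv : u ≫ q = v ≫ q) : F.map u = F.map v := by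
  obtain ⟨K, r₁, r₂, hr, hK⟩ := h.pair q hq
  obtain ⟨Δ, hΔ₁, hΔ₂⟩ := hK (𝟙 Q) (𝟙 Q) rfl
  obtain ⟨m, hm₁, hm₂⟩ := hK u v huv
  obtain ⟨R, p, -, hR, hp, -⟩ := h.resolve (𝟙 K) (𝟙 K) (h.id K)
  obtain ⟨Q', s, t, hQ', hs, hst⟩ := h.resolve Δ p hp
  obtain ⟨X', s', t', hX', hs', hst'⟩ := h.resolve m p hp
  have := hF _ hR hQ (W.comp_mem _ _ (h.le _ hp) hr)
  have := hF s hQ' hQ (h.le _ hs)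
  have := hF s' hX' hX (h.le _ hs')
  have e₁ : F.map t ≫ F.map (p ≫ r₁) = F.map s := by
    rw [← F.map_comp, ← Category.assoc, ← hst, Category.assoc, hΔ₁, Category.comp_id]
  have e₂ : F.map t ≫ F.map (p ≫ r₂) = F.map s := by
    rw [← F.map_comp, ← Category.assoc, ← hst, Category.assoc, hΔ₂, Category.comp_id]
  have : IsIso (F.map t) := by
    have : IsIso (F.map t ≫ F.map (p ≫ r₁)) := by rw [e₁]; infer_instance
    exact IsIso.of_isIso_comp_right _ (F.map (p ≫ r₁))
  have e : F.map (p ≫ r₁) = F.map (p ≫ r₂) := by rw [← cancel_epi (F.map t), e₁, e₂]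
  rw [← cancel_epi (F.map s'), ← F.map_comp, ← F.map_comp, ← hm₁, ← hm₂, reassoc_of% hst',
    reassoc_of% hst', F.map_comp, e, ← F.map_comp]

omit hF in
/-- A chosen resolution of an object. -/
lemma exists_resolution (X : C) : ∃ (X' : C) (p : X' ⟶ X), P X' ∧ T p := by
  obtain ⟨X', p, -, hX', hp, -⟩ := h.resolve (𝟙 X) (𝟙 X) (h.id X)
  exact ⟨X', p, hX', hp⟩

/-- A morphism need not lift to given resolutions, but it lifts after refining the source, and `F`
inverts the refinement. The value is independent of the refinement by `map_eq_map`. -/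
lemma exists_map [W.HasTwoOutOfThreeProperty] {X Y X' Y' : C} (hX' : P X') (hY' : P Y')
    (p : X' ⟶ X) (q : Y' ⟶ Y) (hq : T q) (f : X ⟶ Y) :
    ∃ φ : F.obj X' ⟶ F.obj Y', ∀ ⦃Z : C⦄ (s : Z ⟶ X') (g : Z ⟶ Y'), P Z →
      s ≫ p ≫ f = g ≫ q → F.map s ≫ φ = F.map g := by
  obtain ⟨R, s, g, hR, hs, hsg⟩ := h.resolve (p ≫ f) q hq
  have := hF s hR hX' (h.le _ hs)
  refine ⟨inv (F.map s) ≫ F.map g, fun Z s' g' hZ hsg' => ?_⟩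
  obtain ⟨Z', a, b, hZ', ha, hab⟩ := h.resolve s' s hs
  have := hF a hZ' hZ (h.le _ ha)
  have e : F.map (b ≫ g) = F.map (a ≫ g') := by
    refine h.map_eq_map hF hZ' hY' q hq _ _ ?_
    rw [Category.assoc, Category.assoc, ← hsg, ← hsg', reassoc_of% hab]
  rw [← cancel_epi (F.map a), ← F.map_comp, ← e, ← F.map_comp_assoc, hab, F.map_comp_assoc,
    IsIso.hom_inv_id_assoc, F.map_comp]

/-- The left derived functor, as a functor on the original category. -/
lemma exists_leftDerived [W.HasTwoOutOfThreeProperty] :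
    ∃ (F' : C ⥤ E) (ε : F' ⟶ F), W.IsInvertedBy F' ∧ ∀ X, P X → IsIso (ε.app X) := by
  choose R p hR hp using h.exists_resolution
  choose φ hφ using fun X Y f => h.exists_map hF (hR X) (hR Y) (p X) (p Y) (hp Y) f
  have key {X Y Z : C} (s : Z ⟶ R X) (hZ : P Z) (hs : T s) : IsIso (F.map s) :=
    hF s hZ (hR X) (h.le _ hs)
  -- The value at `X` is `F` of a chosen resolution. Functoriality is checked after composition with
  -- `F` of refinements on which all the morphisms concerned lift.
  let F' : C ⥤ E :=
    { obj X := F.obj (R X)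
      map f := φ _ _ f
      map_id X := by
        have := hφ X X (𝟙 X) (𝟙 _) (𝟙 _) (hR X) (by simp)
        simpa using this
      map_comp {X Y Z} f g := by
        obtain ⟨X', s, f', hX', hs, hsf⟩ := h.resolve (p X ≫ f) (p Y) (hp Y)
        obtain ⟨Y', t, g', hY', ht, htg⟩ := h.resolve (p Y ≫ g) (p Z) (hp Z)
        obtain ⟨X'', a, b, hX'', ha, hab⟩ := h.resolve f' t ht
        have := hF s hX' (hR X) (h.le _ hs)
        have := hF a hX'' hX' (h.le _ ha)
        rw [← cancel_epi (F.map s), ← cancel_epi (F.map a), ← F.map_comp_assoc,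
          hφ X Z (f ≫ g) (a ≫ s) (b ≫ g') hX'' (by
            rw [Category.assoc, Category.assoc, ← htg, reassoc_of% hsf, reassoc_of% hab]),
          reassoc_of% (hφ X Y f s f' hX' hsf), ← F.map_comp_assoc, hab, F.map_comp_assoc,
          hφ Y Z g t g' hY' htg, F.map_comp] }
  refine ⟨F', { app X := F.map (p X), naturality := fun X Y f => ?_ }, fun X Y f hf => ?_,
    fun X hX => hF _ (hR X) hX (h.le _ (hp X))⟩
  · obtain ⟨X', s, f', hX', hs, hsf⟩ := h.resolve (p X ≫ f) (p Y) (hp Y)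
    have := hF s hX' (hR X) (h.le _ hs)
    change φ _ _ f ≫ F.map (p Y) = F.map (p X) ≫ F.map f
    rw [← cancel_epi (F.map s), reassoc_of% (hφ X Y f s f' hX' hsf), ← F.map_comp, ← F.map_comp,
      ← F.map_comp, hsf]
  -- A lift of a weak equivalence is one by two-out-of-three, and its source and target are both
  -- resolved.
  · obtain ⟨X', s, f', hX', hs, hsf⟩ := h.resolve (p X ≫ f) (p Y) (hp Y)
    have := hF s hX' (hR X) (h.le _ hs)
    have hf' : W f' := by
      refine W.of_postcomp f' (p Y) (h.le _ (hp Y)) ?_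
      rw [← hsf]
      exact W.comp_mem _ _ (h.le _ hs) (W.comp_mem _ _ (h.le _ (hp X)) hf)
    have := hF f' hX' (hR Y) hf'
    have : IsIso (F.map s ≫ φ _ _ f) := by
      rw [hφ X Y f s f' hX' hsf]
      infer_instance
    exact IsIso.of_isIso_comp_left (F.map s) (φ _ _ f)

end

variable {D : Type u₂} [Category.{v₂} D] (L : C ⥤ D) [L.IsLocalization W]
  {E : Type u₁} [Category.{v₁} E] {F : C ⥤ E}

/-- A functor on the localized category which agrees with `F` on the objects satisfying `P` is
the left derived functor of `F`. -/
lemma isLeftDerivedFunctor (F' : D ⥤ E) (α : L ⋙ F' ⟶ F) (hα : ∀ X, P X → IsIso (α.app X)) :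
    F'.IsLeftDerivedFunctor α W := by
  choose R p hR hp using h.exists_resolution
  have hL {X Y : C} (f : X ⟶ Y) (hf : T f) : IsIso (L.map f) :=
    Localization.inverts L W f (h.le _ hf)
  have hα' (X) : IsIso (α.app (R X)) := hα _ (hR X)
  have hp' (X) : IsIso (L.map (p X)) := hL _ (hp X)
  rw [Functor.isLeftDerivedFunctor_iff_isRightKanExtension]
  -- On a resolution `R X` the map `α` is invertible, which forces the value of `γ` there; it is
  -- carried to `X` along `p X`, which becomes invertible in the localization.
  have lift (G : D ⥤ E) (β : L ⋙ G ⟶ F) : ∃ γ : G ⟶ F', Functor.whiskerLeft L γ ≫ α = β := by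
    let δ : L ⋙ G ⟶ L ⋙ F' :=
      { app X := G.map (inv (L.map (p X))) ≫ β.app (R X) ≫ inv (α.app (R X)) ≫
          F'.map (L.map (p X))
        naturality X Y f := by
          obtain ⟨X', s, f', hX', hs, hsf⟩ := h.resolve (p X ≫ f) (p Y) (hp Y)
          have := hL s hs
          have := hα _ hX'
          have hβs := β.naturality s
          have hβf := β.naturality f'
          have hαs := α.naturality s
          have hαf := α.naturality f'
          have hsfL := congr_arg L.map hsf
          simp only [L.map_comp] at hsfL
          have hsG := congr_arg G.map hsfL
          have hsF := congr_arg F'.map hsfL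
          simp only [Functor.map_comp, Functor.comp_map, Functor.comp_obj] at *
          rw [← cancel_epi (G.map (L.map (p X))), ← cancel_epi (G.map (L.map s)),
            reassoc_of% hsG, ← G.map_comp_assoc (L.map (p Y)), IsIso.hom_inv_id, G.map_id,
            Category.id_comp, reassoc_of% hβf, Category.assoc, Category.assoc, Category.assoc,
            ← G.map_comp_assoc (L.map (p X)), IsIso.hom_inv_id, G.map_id, Category.id_comp,
            reassoc_of% hβs]
          have e₁ : F.map f' ≫ inv (α.app (R Y)) = inv (α.app X') ≫ F'.map (L.map f') := by
            rw [IsIso.comp_inv_eq, Category.assoc, hαf, IsIso.inv_hom_id_assoc]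
          have e₂ : F.map s ≫ inv (α.app (R X)) = inv (α.app X') ≫ F'.map (L.map s) := by
            rw [IsIso.comp_inv_eq, Category.assoc, hαs, IsIso.inv_hom_id_assoc]
          rw [reassoc_of% e₁, reassoc_of% e₂, hsF] }
    -- So far `δ` lives on the original category; precomposition with a localization functor is
    -- fully faithful, so it descends.
    obtain ⟨γ, hγ⟩ := (Localization.fullyFaithfulWhiskeringLeft L W E).map_surjective δ
    refine ⟨γ, ?_⟩
    ext X
    change γ.app (L.obj X) ≫ α.app X = β.app X
    have : γ.app (L.obj X) = δ.app X := congr_app hγ X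
    have hαp := α.naturality (p X)
    have hβp := β.naturality (p X)
    simp only [Functor.comp_map, Functor.comp_obj] at *
    rw [this]
    simp only [δ, Category.assoc]
    rw [hαp, IsIso.inv_hom_id_assoc, ← hβp, ← G.map_comp_assoc, IsIso.inv_hom_id, G.map_id,
      Category.id_comp]
  have uniq (G : D ⥤ E) (γ₁ γ₂ : G ⟶ F')
      (hγ : Functor.whiskerLeft L γ₁ ≫ α = Functor.whiskerLeft L γ₂ ≫ α) : γ₁ = γ₂ := by
    refine Localization.natTrans_ext L W fun X => ?_
    rw [← cancel_epi (G.map (L.map (p X))), γ₁.naturality, γ₂.naturality]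
    congr 1
    exact (cancel_mono (α.app (R X))).1 (congr_app hγ _)
  choose γ hγ using lift
  exact ⟨⟨IsTerminal.ofUniqueHom
    (fun G => CostructuredArrow.homMk (γ G.left G.hom) (hγ _ _))
    fun G m => CostructuredArrow.hom_ext _ _
      (uniq _ _ _ ((CostructuredArrow.w m).trans (hγ _ _).symm))⟩⟩

lemma hasLeftDerivedFunctor [W.HasTwoOutOfThreeProperty]
    (hF : ∀ ⦃X Y : C⦄ (f : X ⟶ Y), P X → P Y → W f → IsIso (F.map f)) :
    F.HasLeftDerivedFunctor W := by
  obtain ⟨F', ε, hF', hε⟩ := h.exists_leftDerived hF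
  let G : W.Localization ⥤ E := Localization.lift F' hF' W.Q
  let α : W.Q ⋙ G ⟶ F := (Localization.fac F' hF' W.Q).hom ≫ ε
  have : G.IsLeftDerivedFunctor α W := h.isLeftDerivedFunctor W.Q G α fun X hX => by
    have := hε X hX
    exact inferInstanceAs (IsIso ((Localization.fac F' hF' W.Q).hom.app X ≫ ε.app X))
  exact Functor.HasLeftDerivedFunctor.mk' G α

/-- The left derived functor of `F` agrees with `F` on the objects satisfying `P`. -/
lemma isIso_of_isLeftDerivedFunctor [W.HasTwoOutOfThreeProperty]
    (hF : ∀ ⦃X Y : C⦄ (f : X ⟶ Y), P X → P Y → W f → IsIso (F.map f))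
    (F' : D ⥤ E) (α : L ⋙ F' ⟶ F) [F'.IsLeftDerivedFunctor α W] (X : C) (hX : P X) :
    IsIso (α.app X) := by
  obtain ⟨F'', ε, hF'', hε⟩ := h.exists_leftDerived hF
  let G : D ⥤ E := Localization.lift F'' hF'' L
  let β : L ⋙ G ⟶ F := (Localization.fac F'' hF'' L).hom ≫ ε
  have hβ (X) (hX : P X) : IsIso (β.app X) := by
    have := hε X hX
    exact inferInstanceAs (IsIso ((Localization.fac F'' hF'' L).hom.app X ≫ ε.app X))
  have : G.IsLeftDerivedFunctor β W := h.isLeftDerivedFunctor L G β hβ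
  -- Both `F'` and the functor `G` built from resolutions are left derived functors of `F`; the
  -- comparison between them is invertible and carries the property from `β` to `α`.
  have := (Functor.isLeftDerivedFunctor_iff_isIso_leftDerivedLift F' α W G β).1 inferInstance
  have e := Functor.leftDerived_fac_app F' α W G β X
  have := hβ X hX
  have : IsIso ((F'.leftDerivedLift α W G β).app (L.obj X) ≫ α.app X) := by
    rw [e]
    infer_instance
  exact IsIso.of_isIso_comp_left ((F'.leftDerivedLift α W G β).app (L.obj X)) (α.app X)

end IsLeftResolving

end LeftResolutions

/-! ### Resolutions in product categories -/

section ProductResolutions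

variable {C : Type u} [Category.{v} C] {D : Type u₁} [Category.{v₁} D]
  {W : MorphismProperty C} {P : ObjectProperty C} {T : MorphismProperty C}
  {W' : MorphismProperty D} {P' : ObjectProperty D} {T' : MorphismProperty D}

instance hasTwoOutOfThreeProperty_prod [W.HasTwoOutOfThreeProperty]
    [W'.HasTwoOutOfThreeProperty] : (W.prod W').HasTwoOutOfThreeProperty where
  comp_mem _ _ hf hg := ⟨W.comp_mem _ _ hf.1 hg.1, W'.comp_mem _ _ hf.2 hg.2⟩
  of_postcomp _ _ hg hfg := ⟨W.of_postcomp _ _ hg.1 hfg.1, W'.of_postcomp _ _ hg.2 hfg.2⟩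
  of_precomp _ _ hf hfg := ⟨W.of_precomp _ _ hf.1 hfg.1, W'.of_precomp _ _ hf.2 hfg.2⟩

lemma IsLeftResolving.prod (h : IsLeftResolving W P T) (h' : IsLeftResolving W' P' T') :
    IsLeftResolving (W.prod W') (fun X : C × D => P X.1 ∧ P' X.2) (T.prod T') where
  le _ _ _ hf := ⟨h.le _ hf.1, h'.le _ hf.2⟩
  id X := ⟨h.id X.1, h'.id X.2⟩
  resolve X Y Y' f q hq := by
    obtain ⟨A, p, g, hA, hp, e⟩ := h.resolve f.1 q.1 hq.1
    obtain ⟨A', p', g', hA', hp', e'⟩ := h'.resolve f.2 q.2 hq.2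
    exact ⟨(A, A'), Prod.mkHom p p', Prod.mkHom g g', ⟨hA, hA'⟩, ⟨hp, hp'⟩, Prod.ext e e'⟩
  pair Q Y q hq := by
    obtain ⟨K, r₁, r₂, hr, hK⟩ := h.pair q.1 hq.1
    obtain ⟨K', r₁', r₂', hr', hK'⟩ := h'.pair q.2 hq.2
    refine ⟨(K, K'), Prod.mkHom r₁ r₁', Prod.mkHom r₂ r₂', ⟨hr, hr'⟩, fun Z u v huv => ?_⟩
    obtain ⟨m, hm₁, hm₂⟩ := hK u.1 v.1 (congr_arg Prod.fst huv)
    obtain ⟨m', hm₁', hm₂'⟩ := hK' u.2 v.2 (congr_arg Prod.snd huv)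
    exact ⟨Prod.mkHom m m', Prod.ext hm₁ hm₁', Prod.ext hm₂ hm₂'⟩

end ProductResolutions

/-! ### Flat complexes as resolving objects -/

section FlatComplexes

variable (C : Type u) [Category.{v} C] [Abelian C]

/-- The epimorphic quasi-isomorphisms of bounded below complexes. -/
def trivialFibrations : MorphismProperty (CochainComplex.Plus C) :=
  fun _ _ f => QuasiIso f.hom ∧ Epi f.hom

variable {C} in
-- Base change does not alter the kernel, and acyclicity of the kernel is what makes an epimorphism
-- of complexes a quasi-isomorphism.
lemma trivialFibrations_pullback_snd {X Y Z : CochainComplex.Plus C} (q : X ⟶ Z) (f : Y ⟶ Z)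
    (hq : trivialFibrations C q) : trivialFibrations C (pullback.snd q f) := by
  obtain ⟨_, _⟩ := hq
  have sq := (IsPullback.of_hasPullback q f).map (CochainComplex.Plus.ι C)
  have e : (pullback.snd q f).hom = sq.isoPullback.hom ≫ pullback.snd q.hom f.hom :=
    sq.isoPullback_hom_snd.symm
  obtain ⟨w, hS⟩ := IsSES.of_epi q.hom
  obtain ⟨j, ⟨w', hS'⟩, -⟩ := (IsSES.of_epi q.hom).pullback f.hom
  have : QuasiIso (pullback.snd q.hom f.hom) := by
    have : QuasiIso (ShortComplex.mk _ _ w).g := ‹_›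
    exact quasiIso_g_of_acyclic hS' (hS.acyclic_X₁ this)
  have : Epi (pullback.snd q.hom f.hom) := hS'.epi_g
  rw [trivialFibrations, e]
  exact ⟨inferInstance, inferInstance⟩

variable [MonoidalCategory C]

/-- The bounded below complexes of flat objects. -/
def flatComplexes : ObjectProperty (CochainComplex.Plus C) := fun K => ∀ n, IsFlat (K.obj.X n)

variable {C}
variable [MonoidalPreadditive C] [SymmetricCategory C]
  [∀ X : C, PreservesFiniteColimits (tensorLeft X)]

/-- Squares are filled by pulling `q` back along `f` and resolving the fibre product by flat
objects. The pair is the fibre product of `Q` with itself over `Y`, whose projections are base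
changes of `q`. -/
lemma HasFiniteTorDimension.isLeftResolving (h : HasFiniteTorDimension C) :
    IsLeftResolving (CochainComplex.Plus.quasiIso C) (flatComplexes C) (trivialFibrations C) where
  le _ _ _ hf := hf.1
  id X := ⟨quasiIso_of_isIso (𝟙 X.obj), inferInstanceAs (Epi (𝟙 X.obj))⟩
  resolve X Y Y' f q hq := by
    obtain ⟨P, p, hP, hp, hp'⟩ := h.exists_flat_resolution (pullback q f)
    obtain ⟨_, _⟩ := trivialFibrations_pullback_snd q f hq
    have : Epi p.hom := HomologicalComplex.epi_of_epi_f _ hp'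
    exact ⟨P, p ≫ pullback.snd q f, p ≫ pullback.fst q f, hP,
      ⟨inferInstanceAs (QuasiIso (p.hom ≫ (pullback.snd q f).hom)),
        inferInstanceAs (Epi (p.hom ≫ (pullback.snd q f).hom))⟩, by
      rw [Category.assoc, Category.assoc, pullback.condition]⟩
  pair Q Y q hq := ⟨pullback q q, pullback.snd q q, pullback.fst q q,
    (trivialFibrations_pullback_snd q q hq).1, fun Z u v huv =>
      ⟨pullback.lift v u huv.symm, pullback.lift_snd _ _ _, pullback.lift_fst _ _ _⟩⟩

lemma HasFiniteTorDimension.isLeftResolving_prod (h : HasFiniteTorDimension C) :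
    IsLeftResolving ((CochainComplex.Plus.quasiIso C).prod (CochainComplex.Plus.quasiIso C))
      (fun K => flatComplexes C K.1 ∧ flatComplexes C K.2)
      ((trivialFibrations C).prod (trivialFibrations C)) :=
  h.isLeftResolving.prod h.isLeftResolving

end FlatComplexes

/-! ### Existence of the derived tensor product -/

section DerivedTensor

variable {C : Type u} [Category.{v} C] [Abelian C] [HasDerivedCategory.{w} C]

lemma isIso_Q_map {K L : CochainComplex.Plus C} (f : K ⟶ L) (hf : QuasiIso f.hom) :
    IsIso (DerivedCategory.Plus.Q.map f) :=
  Localization.inverts DerivedCategory.Plus.Q (CochainComplex.Plus.quasiIso C) f hf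

variable [MonoidalCategory C]
  [MonoidalPreadditive C] [SymmetricCategory C]
  [∀ X : C, PreservesFiniteColimits (tensorLeft X)]

lemma tensorComplex.map_comp {K K' K'' L L' L'' : CochainComplex.Plus C} (f : K ⟶ K')
    (f' : K' ⟶ K'') (g : L ⟶ L') (g' : L' ⟶ L'') :
    map (f ≫ f') (g ≫ g') = map f g ≫ map f' g' :=
  (tensorComplexFunctor C).map_comp (Prod.mkHom f g) (Prod.mkHom f' g')

/-- One variable changes at a time, so that in each step the fixed complex is flat. -/
lemma isIso_Q_map_tensorComplex {K K' : CochainComplex.Plus C × CochainComplex.Plus C}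
    (f : K ⟶ K') (hK : flatComplexes C K.1 ∧ flatComplexes C K.2)
    (hK' : flatComplexes C K'.1 ∧ flatComplexes C K'.2)
    (hf : ((CochainComplex.Plus.quasiIso C).prod (CochainComplex.Plus.quasiIso C)) f) :
    IsIso ((tensorComplexFunctor C ⋙ DerivedCategory.Plus.Q).map f) := by
  have e : (tensorComplexFunctor C).map f =
      tensorComplex.map f.1 (𝟙 K.2) ≫ tensorComplex.map (𝟙 K'.1) f.2 := by
    rw [← tensorComplex.map_comp, Category.comp_id, Category.id_comp]
    rfl
  refine isIso_Q_map _ ?_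
  rw [e]
  exact (CochainComplex.Plus.quasiIso C).comp_mem _ _
    (tensorComplex.quasiIso_map_id f.1 hf.1 K.2 hK.2)
    (tensorComplex.quasiIso_id_map f.2 hf.2 K'.1 hK'.1)

lemma HasFiniteTorDimension.hasDerivedTensor (h : HasFiniteTorDimension C) :
    HasDerivedTensor C :=
  h.isLeftResolving_prod.hasLeftDerivedFunctor fun _ _ f hX hY hf =>
    isIso_Q_map_tensorComplex f hX hY hf

variable [HasDerivedTensor C]

instance : (derivedTensor C).IsLeftDerivedFunctor (derivedTensorCounit C)
    ((CochainComplex.Plus.quasiIso C).prod (CochainComplex.Plus.quasiIso C)) :=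
  inferInstanceAs (((tensorComplexFunctor C ⋙ DerivedCategory.Plus.Q).totalLeftDerived
    (DerivedCategory.Plus.Q.prod DerivedCategory.Plus.Q)
    ((CochainComplex.Plus.quasiIso C).prod (CochainComplex.Plus.quasiIso C))).IsLeftDerivedFunctor
    ((tensorComplexFunctor C ⋙ DerivedCategory.Plus.Q).totalLeftDerivedCounit
    (DerivedCategory.Plus.Q.prod DerivedCategory.Plus.Q)
    ((CochainComplex.Plus.quasiIso C).prod (CochainComplex.Plus.quasiIso C)))
    ((CochainComplex.Plus.quasiIso C).prod (CochainComplex.Plus.quasiIso C)))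

lemma derivedTensorCounit_naturality {K K' L L' : CochainComplex.Plus C} (f : K ⟶ K')
    (g : L ⟶ L') :
    (derivedTensor C).map (Prod.mkHom (DerivedCategory.Plus.Q.map f)
        (DerivedCategory.Plus.Q.map g)) ≫ (derivedTensorCounit C).app (K', L') =
      (derivedTensorCounit C).app (K, L) ≫
        DerivedCategory.Plus.Q.map (tensorComplex.map f g) :=
  (derivedTensorCounit C).naturality (Prod.mkHom f g)

lemma HasFiniteTorDimension.isIso_derivedTensorCounit (h : HasFiniteTorDimension C)
    (K L : CochainComplex.Plus C) (hK : flatComplexes C K) (hL : flatComplexes C L) :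
    IsIso ((derivedTensorCounit C).app (K, L)) :=
  h.isLeftResolving_prod.isIso_of_isLeftDerivedFunctor _
    (fun _ _ f hX hY hf => isIso_Q_map_tensorComplex f hX hY hf) (derivedTensor C)
    (derivedTensorCounit C) (K, L) ⟨hK, hL⟩

/-- Flat resolutions `P`, `Q` of both variables compute `K ⊗ᴸ L`. To reach `K ⊗ L` the path goes
through `K ⊗ Q` if `K` is flat and through `P ⊗ L` if `L` is flat; in either case the fixed factor
of each step is flat. -/
lemma HasFiniteTorDimension.isComputedByFlat (h : HasFiniteTorDimension C) :
    IsComputedByFlat C := by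
  intro K L hKL
  obtain ⟨P, p, hP, hp, -⟩ := h.exists_flat_resolution K
  obtain ⟨Q, q, hQ, hq, -⟩ := h.exists_flat_resolution L
  have hPQ := h.isIso_derivedTensorCounit P Q hP hQ
  have := isIso_Q_map p hp
  have := isIso_Q_map q hq
  have hpq : IsIso (DerivedCategory.Plus.Q.map (tensorComplex.map p q)) := by
    refine isIso_Q_map _ ?_
    rcases hKL with hK | hL
    · rw [← Category.comp_id p, ← Category.id_comp q, tensorComplex.map_comp]
      exact (CochainComplex.Plus.quasiIso C).comp_mem _ _
        (tensorComplex.quasiIso_map_id p hp Q hQ) (tensorComplex.quasiIso_id_map q hq K hK)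
    · rw [← Category.id_comp p, ← Category.comp_id q, tensorComplex.map_comp]
      exact (CochainComplex.Plus.quasiIso C).comp_mem _ _
        (tensorComplex.quasiIso_id_map q hq P hP) (tensorComplex.quasiIso_map_id p hp L hL)
  have hiso : IsIso (Prod.mkHom (DerivedCategory.Plus.Q.map p) (DerivedCategory.Plus.Q.map q)) := by
    rw [isIso_prod_iff]
    exact ⟨inferInstance, inferInstance⟩
  have : IsIso ((derivedTensor C).map (Prod.mkHom (DerivedCategory.Plus.Q.map p)
      (DerivedCategory.Plus.Q.map q)) ≫ (derivedTensorCounit C).app (K, L)) := by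
    rw [derivedTensorCounit_naturality]
    exact IsIso.comp_isIso' hPQ hpq
  exact IsIso.of_isIso_comp_left ((derivedTensor C).map (Prod.mkHom (DerivedCategory.Plus.Q.map p)
      (DerivedCategory.Plus.Q.map q))) _

end DerivedTensor

open DerivedCategory.Plus (Q homologyFunctor)

/-! ### Tensor products of cokernels -/

section RightExactness

variable {C : Type u} [Category.{v} C] [Abelian C] [MonoidalCategory C] [MonoidalPreadditive C]
  [∀ X : C, PreservesFiniteColimits (tensorLeft X)]
  [∀ X : C, PreservesFiniteColimits (tensorRight X)]

lemma epi_tensorHom {X X' Y Y' : C} (f : X ⟶ X') (g : Y ⟶ Y') [Epi f] [Epi g] :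
    Epi (f ⊗ₘ g) := by
  have : Epi (f ▷ Y) := inferInstanceAs (Epi ((tensorRight Y).map f))
  have : Epi (X' ◁ g) := inferInstanceAs (Epi ((tensorLeft X').map g))
  rw [MonoidalCategory.tensorHom_def]
  infer_instance

/-- Morphisms from a tensor product of cokernels. -/
lemma exists_tensor_desc {S T : ShortComplex C} (hS : S.Exact) (hT : T.Exact) [Epi S.g] [Epi T.g]
    {Z : C} (φ : S.X₂ ⊗ T.X₂ ⟶ Z) (h₁ : S.f ▷ T.X₂ ≫ φ = 0) (h₂ : S.X₂ ◁ T.f ≫ φ = 0) :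
    ∃ ψ : S.X₃ ⊗ T.X₃ ⟶ Z, (S.g ⊗ₘ T.g) ≫ ψ = φ := by
  have ex₁ : (S.map (tensorRight T.X₂)).Exact :=
    hS.map_of_epi_of_preservesCokernel _ inferInstance inferInstance
  have ex₂ : (T.map (tensorLeft S.X₃)).Exact :=
    hT.map_of_epi_of_preservesCokernel _ inferInstance inferInstance
  have : Epi (S.map (tensorRight T.X₂)).g := inferInstanceAs (Epi ((tensorRight T.X₂).map S.g))
  have : Epi (T.map (tensorLeft S.X₃)).g := inferInstanceAs (Epi ((tensorLeft S.X₃).map T.g))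
  have : Epi (S.g ▷ T.X₁) := inferInstanceAs (Epi ((tensorRight T.X₁).map S.g))
  obtain ⟨φ', e₁⟩ : ∃ φ' : S.X₃ ⊗ T.X₂ ⟶ Z, S.g ▷ T.X₂ ≫ φ' = φ :=
    ⟨ex₁.desc φ h₁, ex₁.g_desc φ h₁⟩
  have hφ : S.X₃ ◁ T.f ≫ φ' = 0 := by
    rw [← cancel_epi (S.g ▷ T.X₁), ← whisker_exchange_assoc, e₁, h₂, comp_zero]
  obtain ⟨ψ, e₂⟩ : ∃ ψ : S.X₃ ⊗ T.X₃ ⟶ Z, S.X₃ ◁ T.g ≫ ψ = φ' :=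
    ⟨ex₂.desc φ' hφ, ex₂.g_desc φ' hφ⟩
  exact ⟨ψ, by rw [MonoidalCategory.tensorHom_def, Category.assoc, e₂, e₁]⟩

end RightExactness

/-! ### The exterior product on cohomology -/

section ExteriorProduct

variable {C : Type u} [Category.{v} C] [Abelian C] [HasDerivedCategory.{w} C]

/-- The comparison of the homology of a complex and of its image in the derived category. -/
def homologyIso (K : CochainComplex.Plus C) (n : ℤ) :
    K.obj.homology n ≅ (homologyFunctor C n).obj (Q.obj K) :=
  (DerivedCategory.homologyFunctorFactors C n).symm.app K.obj

lemma homologyIso_hom_naturality {K L : CochainComplex.Plus C} (f : K ⟶ L) (n : ℤ) :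
    HomologicalComplex.homologyMap f.hom n ≫ (homologyIso L n).hom =
      (homologyIso K n).hom ≫ (homologyFunctor C n).map (Q.map f) :=
  (DerivedCategory.homologyFunctorFactors C n).inv.naturality f.hom

lemma cyclesToHomology_eq (K : CochainComplex.Plus C) (n : ℤ) :
    cyclesToHomology K n = K.obj.homologyπ n ≫ (homologyIso K n).hom := rfl

instance (K : CochainComplex.Plus C) (n : ℤ) : Epi (cyclesToHomology K n) := by
  rw [cyclesToHomology_eq]
  infer_instance

lemma cyclesToHomology_naturality {K L : CochainComplex.Plus C} (f : K ⟶ L) (n : ℤ) :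
    HomologicalComplex.cyclesMap f.hom n ≫ cyclesToHomology L n =
      cyclesToHomology K n ≫ (homologyFunctor C n).map (Q.map f) := by
  rw [cyclesToHomology_eq, cyclesToHomology_eq, Category.assoc, ← homologyIso_hom_naturality,
    ← HomologicalComplex.homologyπ_naturality_assoc]

lemma toCycles_cyclesToHomology (K : CochainComplex.Plus C) (m n : ℤ) :
    K.obj.toCycles m n ≫ cyclesToHomology K n = 0 := by
  rw [cyclesToHomology_eq, HomologicalComplex.toCycles_comp_homologyπ_assoc, zero_comp]

lemma exact_toCycles_cyclesToHomology (K : CochainComplex.Plus C) (m n : ℤ) (h : m + 1 = n) :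
    (ShortComplex.mk _ _ (toCycles_cyclesToHomology K m n)).Exact := by
  have ex : (ShortComplex.mk _ _ (K.obj.toCycles_comp_homologyπ m n)).Exact :=
    ShortComplex.exact_of_g_is_cokernel _ (K.obj.homologyIsCokernel m n (by simp [← h]))
  exact ShortComplex.exact_of_iso (ShortComplex.isoMk
    (S₁ := ShortComplex.mk _ _ (K.obj.toCycles_comp_homologyπ m n)) (Iso.refl _) (Iso.refl _)
    (homologyIso K n) ((Category.id_comp _).trans (Category.comp_id _).symm)
    (Category.id_comp _)) ex

variable [MonoidalCategory C] [MonoidalPreadditive C]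

lemma cyclesTensor_i (K L : CochainComplex.Plus C) (p q n : ℤ) (h : p + q = n) :
    cyclesTensor K L p q n h ≫ (tensorComplex K L).obj.iCycles n =
      (K.obj.iCycles p ⊗ₘ L.obj.iCycles q) ≫ tensorComplex.inc K L p q n h :=
  HomologicalComplex.liftCycles_i _ _ _ _ _

lemma cyclesTensor_naturality {K K' L L' : CochainComplex.Plus C} (f : K ⟶ K') (g : L ⟶ L')
    (p q n : ℤ) (h : p + q = n) :
    (HomologicalComplex.cyclesMap f.hom p ⊗ₘ HomologicalComplex.cyclesMap g.hom q) ≫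
        cyclesTensor K' L' p q n h =
      cyclesTensor K L p q n h ≫
        HomologicalComplex.cyclesMap (tensorComplex.map f g).hom n := by
  rw [← cancel_mono ((tensorComplex K' L').obj.iCycles n), Category.assoc, Category.assoc,
    cyclesTensor_i, HomologicalComplex.cyclesMap_i, reassoc_of% (cyclesTensor_i K L p q n h),
    tensorComplex.inc_map, ← Category.assoc, ← Category.assoc,
    MonoidalCategory.tensorHom_comp_tensorHom, MonoidalCategory.tensorHom_comp_tensorHom,
    HomologicalComplex.cyclesMap_i, HomologicalComplex.cyclesMap_i]

/-- The relation `d (x ⊗ y) = d x ⊗ y` for a cycle `y`. With its counterpart in the other variable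
it makes the product of cycles descend to cohomology. -/
lemma toCycles_cyclesTensor (K L : CochainComplex.Plus C) (m p q n : ℤ) (hm : m + 1 = p)
    (h : p + q = n) :
    K.obj.toCycles m p ▷ L.obj.cycles q ≫ cyclesTensor K L p q n h =
      K.obj.X m ◁ L.obj.iCycles q ≫ tensorComplex.inc K L m q (m + q) rfl ≫
        (tensorComplex K L).obj.toCycles (m + q) n := by
  subst hm
  have e : L.obj.iCycles q ≫ L.obj.d q (q + 1) = 0 := by simp
  rw [← cancel_mono ((tensorComplex K L).obj.iCycles n), Category.assoc, Category.assoc,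
    Category.assoc, cyclesTensor_i, HomologicalComplex.toCycles_i,
    tensorComplex.inc_d K L m q (m + q) rfl (m + 1) (q + 1) n rfl rfl (by omega),
    Preadditive.comp_add, Linear.comp_units_smul, ← whiskerLeft_comp_assoc, e,
    MonoidalPreadditive.whiskerLeft_zero, zero_comp, smul_zero, add_zero,
    whisker_exchange_assoc, MonoidalCategory.tensorHom_def, Category.assoc,
    ← comp_whiskerRight_assoc, HomologicalComplex.toCycles_i]

/-- For a cycle `x` of degree `p` one has `d (x ⊗ y) = (-1)^p • x ⊗ d y`, and the sign squares to
one. -/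
lemma cyclesTensor_toCycles (K L : CochainComplex.Plus C) (p m q n : ℤ) (hm : m + 1 = q)
    (h : p + q = n) :
    K.obj.cycles p ◁ L.obj.toCycles m q ≫ cyclesTensor K L p q n h =
      p.negOnePow • (K.obj.iCycles p ▷ L.obj.X m ≫ tensorComplex.inc K L p m (p + m) rfl ≫
        (tensorComplex K L).obj.toCycles (p + m) n) := by
  subst hm
  have e : K.obj.iCycles p ≫ K.obj.d p (p + 1) = 0 := by simp
  rw [← cancel_mono ((tensorComplex K L).obj.iCycles n), Category.assoc, Linear.units_smul_comp,
    Category.assoc,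
    Category.assoc, cyclesTensor_i, HomologicalComplex.toCycles_i,
    tensorComplex.inc_d K L p m (p + m) rfl (p + 1) (m + 1) n rfl rfl (by omega),
    Preadditive.comp_add, Linear.comp_units_smul, ← comp_whiskerRight_assoc, e,
    MonoidalPreadditive.zero_whiskerRight, zero_comp, zero_add, smul_smul,
    Int.units_mul_self, one_smul, ← whisker_exchange_assoc, MonoidalCategory.tensorHom_def',
    Category.assoc, ← whiskerLeft_comp_assoc, HomologicalComplex.toCycles_i]

variable [SymmetricCategory C] [∀ X : C, PreservesFiniteColimits (tensorLeft X)]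

instance epi_cyclesToHomology_tensor (K L : CochainComplex.Plus C) (p q : ℤ) :
    Epi (cyclesToHomology K p ⊗ₘ cyclesToHomology L q) := epi_tensorHom _ _

/-- The exterior product `Hᵖ(K) ⊗ H^q(L) ⟶ H^{p+q}(K ⊗ L)` for complexes. -/
lemma exists_homologyTensor (K L : CochainComplex.Plus C) (p q n : ℤ) (h : p + q = n) :
    ∃ ψ : (homologyFunctor C p).obj (Q.obj K) ⊗ (homologyFunctor C q).obj (Q.obj L) ⟶
        (homologyFunctor C n).obj (Q.obj (tensorComplex K L)),
      (cyclesToHomology K p ⊗ₘ cyclesToHomology L q) ≫ ψ =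
        cyclesTensor K L p q n h ≫ cyclesToHomology (tensorComplex K L) n := by
  have : Epi (ShortComplex.mk _ _ (toCycles_cyclesToHomology K (p - 1) p)).g :=
    inferInstanceAs (Epi (cyclesToHomology K p))
  have : Epi (ShortComplex.mk _ _ (toCycles_cyclesToHomology L (q - 1) q)).g :=
    inferInstanceAs (Epi (cyclesToHomology L q))
  refine exists_tensor_desc (exact_toCycles_cyclesToHomology K (p - 1) p (by omega))
    (exact_toCycles_cyclesToHomology L (q - 1) q (by omega)) _ ?_ ?_
  · dsimp
    rw [← Category.assoc, toCycles_cyclesTensor K L (p - 1) p q n (by omega) h,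
      Category.assoc, Category.assoc, toCycles_cyclesToHomology, comp_zero, comp_zero]
  · dsimp
    rw [← Category.assoc, cyclesTensor_toCycles K L p (q - 1) q n (by omega) h,
      Linear.units_smul_comp, Category.assoc, Category.assoc, toCycles_cyclesToHomology,
      comp_zero, comp_zero, smul_zero]

/-- The exterior product `Hᵖ(K) ⊗ H^q(L) ⟶ H^{p+q}(K ⊗ L)` for complexes. -/
def homologyTensorHom (K L : CochainComplex.Plus C) (p q n : ℤ) (h : p + q = n) :
    (homologyFunctor C p).obj (Q.obj K) ⊗ (homologyFunctor C q).obj (Q.obj L) ⟶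
      (homologyFunctor C n).obj (Q.obj (tensorComplex K L)) :=
  (exists_homologyTensor K L p q n h).choose

lemma cyclesToHomology_homologyTensorHom (K L : CochainComplex.Plus C) (p q n : ℤ)
    (h : p + q = n) :
    (cyclesToHomology K p ⊗ₘ cyclesToHomology L q) ≫ homologyTensorHom K L p q n h =
      cyclesTensor K L p q n h ≫ cyclesToHomology (tensorComplex K L) n :=
  (exists_homologyTensor K L p q n h).choose_spec

lemma homologyTensorHom_naturality {K K' L L' : CochainComplex.Plus C} (f : K ⟶ K') (g : L ⟶ L')
    (p q n : ℤ) (h : p + q = n) :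
    ((homologyFunctor C p).map (Q.map f) ⊗ₘ (homologyFunctor C q).map (Q.map g)) ≫
        homologyTensorHom K' L' p q n h =
      homologyTensorHom K L p q n h ≫
        (homologyFunctor C n).map (Q.map (tensorComplex.map f g)) := by
  rw [← cancel_epi (cyclesToHomology K p ⊗ₘ cyclesToHomology L q), ← Category.assoc,
    MonoidalCategory.tensorHom_comp_tensorHom, ← cyclesToHomology_naturality,
    ← cyclesToHomology_naturality, ← MonoidalCategory.tensorHom_comp_tensorHom, Category.assoc,
    cyclesToHomology_homologyTensorHom, reassoc_of% (cyclesTensor_naturality f g p q n h),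
    cyclesToHomology_naturality, reassoc_of% (cyclesToHomology_homologyTensorHom K L p q n h)]

variable (C) in
/-- The exterior product `Hᵖ(K) ⊗ H^q(L) ⟶ H^{p+q}(K ⊗ L)` for complexes, as a natural
transformation. -/
def homologyTensor (p q n : ℤ) (h : p + q = n) :
    (Q (C := C)).prod (Q (C := C)) ⋙ (homologyFunctor C p).prod (homologyFunctor C q) ⋙ tensor C ⟶
      (tensorComplexFunctor C ⋙ Q) ⋙ homologyFunctor C n where
  app K := homologyTensorHom K.1 K.2 p q n h
  naturality _ _ f := homologyTensorHom_naturality f.1 f.2 p q n h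

variable [HasDerivedTensor C]

section

variable {E : Type u₁} [Category.{v₁} E] (N : DerivedCategory.Plus C ⥤ E)

/-- The canonical morphism `N (K ⊗ᴸ L) ⟶ N (K ⊗ L)`, for a functor `N`. -/
abbrev derivedTensorCounitComp :
    (Q (C := C)).prod (Q (C := C)) ⋙ derivedTensor C ⋙ N ⟶ (tensorComplexFunctor C ⋙ Q) ⋙ N :=
  Functor.whiskerRight (derivedTensorCounit C) N

/-- The universal property of `⊗ᴸ` survives composition with any functor `N`, because the counit is
invertible on pairs of flat complexes and stays so under `N`. Both `Hⁿ` and `Rh` are used in the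
role of `N`. -/
instance [hC : Fact (HasFiniteTorDimension C)] :
    (derivedTensor C ⋙ N).IsLeftDerivedFunctor (derivedTensorCounitComp N)
      ((CochainComplex.Plus.quasiIso C).prod (CochainComplex.Plus.quasiIso C)) :=
  hC.out.isLeftResolving_prod.isLeftDerivedFunctor _ _ _ fun K hK => by
    have := hC.out.isIso_derivedTensorCounit K.1 K.2 hK.1 hK.2
    exact inferInstanceAs (IsIso (N.map ((derivedTensorCounit C).app (K.1, K.2))))

end

variable [hC : Fact (HasFiniteTorDimension C)]

variable (C) in
/-- The canonical exterior product on the derived category. -/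
def homologyPairing : HomologyPairing (C := C) := fun p q n h =>
  (derivedTensor C ⋙ homologyFunctor C n).leftDerivedLift
    (derivedTensorCounitComp (homologyFunctor C n))
    ((CochainComplex.Plus.quasiIso C).prod (CochainComplex.Plus.quasiIso C)) _
    (homologyTensor C p q n h)

lemma homologyPairing_isCanonical : (homologyPairing C).IsCanonical := fun p q n h K L => by
  rw [← cyclesToHomology_homologyTensorHom]
  congr 1
  exact (derivedTensor C ⋙ homologyFunctor C n).leftDerived_fac_app
    (derivedTensorCounitComp (homologyFunctor C n))
    ((CochainComplex.Plus.quasiIso C).prod (CochainComplex.Plus.quasiIso C)) _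
    (homologyTensor C p q n h) (K, L)

/-- Canonicity fixes the values on products of classes of cycles, and these determine a map because
the tensor product of two epimorphisms is an epimorphism. The universal property then removes the
counit. -/
lemma HomologyPairing.IsCanonical.eq {α α' : HomologyPairing (C := C)} (hα : α.IsCanonical)
    (hα' : α'.IsCanonical) : α = α' := by
  ext1 p; ext1 q; ext1 n; ext1 h
  refine (derivedTensor C ⋙ homologyFunctor C n).leftDerived_ext
    (derivedTensorCounitComp (homologyFunctor C n))
    ((CochainComplex.Plus.quasiIso C).prod (CochainComplex.Plus.quasiIso C)) _ _ _ ?_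
  ext K
  exact (cancel_epi (cyclesToHomology K.1 p ⊗ₘ cyclesToHomology K.2 q)).1
    ((hα p q n h K.1 K.2).trans (hα' p q n h K.1 K.2).symm)

end ExteriorProduct

open DerivedCategory.Plus (Q Qh homologyFunctor)

/-! ### Right derived functors on complexes -/

section RightDerivedFunctor

variable {A : Type u₁} [Category.{v₁} A] [Abelian A] [HasDerivedCategory.{w₁} A]
  [EnoughInjectives A]
  {B : Type u₂} [Category.{v₂} B] [Abelian B] [HasDerivedCategory.{w₂} B]
  (f : A ⥤ B) [f.Additive]

/-- The canonical morphism `f K ⟶ Rf K` for complexes `K`, as a natural transformation. -/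
def derivedUnitNatTrans : f.mapCochainComplexPlus ⋙ Q ⟶ Q ⋙ f.rightDerivedFunctorPlus where
  app K := derivedUnit f K
  naturality _ _ φ :=
    f.rightDerivedFunctorPlusUnit.naturality ((HomotopyCategory.Plus.quotient A).map φ)

lemma derivedUnit_naturality {K L : CochainComplex.Plus A} (φ : K ⟶ L) :
    Q.map (f.mapCochainComplexPlus.map φ) ≫ derivedUnit f L =
      derivedUnit f K ≫ f.rightDerivedFunctorPlus.map (Q.map φ) :=
  (derivedUnitNatTrans f).naturality φ

instance isIso_derivedUnit (K : CochainComplex.Plus A) [∀ n, Injective (K.obj.X n)] :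
    IsIso (derivedUnit f K) :=
  inferInstanceAs (IsIso (f.rightDerivedFunctorPlusUnit.app
    ((HomotopyCategory.Plus.quotient A).obj K)))

/-- A quasi-isomorphism between bounded below complexes of injectives is a homotopy equivalence, so
every additive functor preserves it. -/
lemma localizerMorphism_derives {E : Type u} [Category.{v} E] (N : DerivedCategory.Plus B ⥤ E) :
    (CochainComplex.Plus.localizerMorphism A).Derives
      ((f.mapCochainComplexPlus ⋙ Q) ⋙ N) := by
  intro K L φ hφ
  have : IsIso ((HomotopyCategory.Plus.quotient _).map φ) :=
    (HomotopyCategory.Plus.isIso_quotient_map_iff φ).2 hφ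
  exact inferInstanceAs (IsIso (((InjectiveObject.ι A).mapHomotopyCategoryPlus ⋙
    f.mapHomotopyCategoryPlus ⋙ Qh ⋙ N).map ((HomotopyCategory.Plus.quotient _).map φ)))

/-- Deriving an adjunction requires the universal property not only for `Rf` but also for its
composite with the functor induced by the left adjoint. -/
instance isRightDerivedFunctor_comp {E : Type u} [Category.{v} E]
    (N : DerivedCategory.Plus B ⥤ E) :
    (f.rightDerivedFunctorPlus ⋙ N).IsRightDerivedFunctor
      (Functor.whiskerRight (derivedUnitNatTrans f) N ≫ (Functor.associator _ _ _).hom)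
      (CochainComplex.Plus.quasiIso A) := by
  refine (localizerMorphism_derives f N).isRightDerivedFunctor_of_isIso _ fun K => ?_
  let K' : CochainComplex.Plus A := (InjectiveObject.ι A).mapCochainComplexPlus.obj K
  have (n : ℤ) : Injective (K'.obj.X n) := (K.obj.X n).property
  have : IsIso (N.map (derivedUnit f K')) := inferInstance
  exact IsIso.comp_isIso' this (inferInstanceAs (IsIso (𝟙 _)))

instance : f.rightDerivedFunctorPlus.IsRightDerivedFunctor (derivedUnitNatTrans f)
    (CochainComplex.Plus.quasiIso A) := by
  refine (localizerMorphism_derives f (𝟭 _)).isRightDerivedFunctor_of_isIso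
    (F := (f.mapCochainComplexPlus ⋙ Q) ⋙ 𝟭 _) _ fun K => ?_
  let K' : CochainComplex.Plus A := (InjectiveObject.ι A).mapCochainComplexPlus.obj K
  have (n : ℤ) : Injective (K'.obj.X n) := (K.obj.X n).property
  exact inferInstanceAs (IsIso (derivedUnit f K'))

end RightDerivedFunctor

/-! ### The derived adjunction -/

section DerivedAdjunction

variable {A : Type u₁} [Category.{v₁} A] [Abelian A] 
  {B : Type u₂} [Category.{v₂} B] [Abelian B] 

section

variable {f : A ⥤ B} {f' : B ⥤ A} (adj : f' ⊣ f) [f.Additive] [f'.Additive]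

/-- The adjunction between bounded below complexes induced by an adjunction. -/
def adjunctionPlus : f'.mapCochainComplexPlus ⊣ f.mapCochainComplexPlus where
  unit :=
    { app K := ObjectProperty.homMk
        { f n := adj.unit.app (K.obj.X n)
          comm' _ _ _ := (adj.unit.naturality _).symm }
      naturality K L φ := by
        ext n
        exact adj.unit.naturality (φ.hom.f n) }
  counit :=
    { app K := ObjectProperty.homMk
        { f n := adj.counit.app (K.obj.X n)
          comm' _ _ _ := (adj.counit.naturality _).symm }
      naturality K L φ := by
        ext n
        exact adj.counit.naturality (φ.hom.f n) }
  left_triangle_components K := by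
    ext n
    exact adj.left_triangle_components (K.obj.X n)
  right_triangle_components K := by
    ext n
    exact adj.right_triangle_components (K.obj.X n)

end

variable [HasDerivedCategory.{w₁} A] [HasDerivedCategory.{w₂} B]

section

variable (F : B ⥤ A) [F.Additive] [PreservesFiniteLimits F] [PreservesFiniteColimits F]

lemma isInvertedBy_mapCochainComplexPlus :
    (CochainComplex.Plus.quasiIso B).IsInvertedBy (F.mapCochainComplexPlus ⋙ Q) := by
  intro K L φ hφ
  have : QuasiIso φ.hom := hφ
  exact isIso_Q_map _ (inferInstanceAs (QuasiIso ((F.mapHomologicalComplex _).map φ.hom)))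

/-- The functor on bounded below derived categories induced by an exact functor. -/
def exactDerived : DerivedCategory.Plus B ⥤ DerivedCategory.Plus A :=
  Localization.lift (F.mapCochainComplexPlus ⋙ Q) (isInvertedBy_mapCochainComplexPlus F) Q

/-- The functor induced by an exact functor is computed termwise on complexes. -/
def exactDerivedIso : Q ⋙ exactDerived F ≅ F.mapCochainComplexPlus ⋙ Q :=
  Localization.fac _ _ _

instance : (exactDerived F).IsLeftDerivedFunctor (exactDerivedIso F).hom
    (CochainComplex.Plus.quasiIso B) :=
  Functor.isLeftDerivedFunctor_of_inverts _ _ _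

instance {E : Type u} [Category.{v} E] (N : DerivedCategory.Plus A ⥤ E) :
    (exactDerived F ⋙ N).IsLeftDerivedFunctor ((Functor.associator _ _ _).inv ≫
      Functor.whiskerRight (exactDerivedIso F).hom N) (CochainComplex.Plus.quasiIso B) :=
  Functor.isLeftDerivedFunctor_of_inverts _ _
    ((Functor.associator _ _ _).symm ≪≫ Functor.isoWhiskerRight (exactDerivedIso F) N)

end

variable [EnoughInjectives A] {f : A ⥤ B} {f' : B ⥤ A} (adj : f' ⊣ f) [f.Additive] [f'.Additive]
  [PreservesFiniteLimits f'] [PreservesFiniteColimits f']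

/-- The adjunction between the functor induced by an exact functor and the right derived functor of
its right adjoint. -/
def derivedAdjunction : exactDerived f' ⊣ f.rightDerivedFunctorPlus :=
  (adjunctionPlus adj).derived (CochainComplex.Plus.quasiIso B) (CochainComplex.Plus.quasiIso A)
    (exactDerivedIso f').hom (derivedUnitNatTrans f)

lemma derivedAdjunction_unit_app (K : CochainComplex.Plus B) :
    (derivedAdjunction adj).unit.app (Q.obj K) ≫
        f.rightDerivedFunctorPlus.map ((exactDerivedIso f').hom.app K) =
      Q.map ((adjunctionPlus adj).unit.app K) ≫
        derivedUnit f (f'.mapCochainComplexPlus.obj K) :=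
  (adjunctionPlus adj).derivedη_fac_app (CochainComplex.Plus.quasiIso B)
    (exactDerivedIso f').hom (derivedUnitNatTrans f) K

lemma derivedAdjunction_counit_app (K : CochainComplex.Plus A) :
    (exactDerived f').map (derivedUnit f K) ≫ (derivedAdjunction adj).counit.app (Q.obj K) =
      (exactDerivedIso f').hom.app (f.mapCochainComplexPlus.obj K) ≫
        Q.map ((adjunctionPlus adj).counit.app K) :=
  (adjunctionPlus adj).derivedε_fac_app (CochainComplex.Plus.quasiIso A)
    (exactDerivedIso f').hom (derivedUnitNatTrans f) K

end DerivedAdjunction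

open DerivedCategory.Plus (Q Qh homologyFunctor)

/-! ### Derived tensor products of objects and morphisms -/

section Notation

variable {C : Type u} [Category.{v} C] [Abelian C] [HasDerivedCategory.{w} C]
  [MonoidalCategory C] [MonoidalPreadditive C] [HasDerivedTensor C]

/-- The derived tensor product of two objects. -/
abbrev derivedTensorObj (X Y : DerivedCategory.Plus C) : DerivedCategory.Plus C :=
  (derivedTensor C).obj (X, Y)

/-- The derived tensor product of two morphisms. -/
def derivedTensorMap {X X' Y Y' : DerivedCategory.Plus C} (a : X ⟶ X') (b : Y ⟶ Y') :
    derivedTensorObj X Y ⟶ derivedTensorObj X' Y' :=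
  (derivedTensor C).map (Prod.mkHom a b)

lemma derivedTensorMap_id (X Y : DerivedCategory.Plus C) :
    derivedTensorMap (𝟙 X) (𝟙 Y) = 𝟙 _ :=
  (derivedTensor C).map_id (X, Y)

lemma derivedTensorMap_comp {X X' X'' Y Y' Y'' : DerivedCategory.Plus C} (a : X ⟶ X')
    (a' : X' ⟶ X'') (b : Y ⟶ Y') (b' : Y' ⟶ Y'') :
    derivedTensorMap a b ≫ derivedTensorMap a' b' = derivedTensorMap (a ≫ a') (b ≫ b') :=
  ((derivedTensor C).map_comp (Prod.mkHom a b) (Prod.mkHom a' b')).symm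

instance {X X' Y Y' : DerivedCategory.Plus C} (a : X ⟶ X') (b : Y ⟶ Y') [IsIso a] [IsIso b] :
    IsIso (derivedTensorMap a b) :=
  ⟨derivedTensorMap (inv a) (inv b), by simp [derivedTensorMap_comp, derivedTensorMap_id],
    by simp [derivedTensorMap_comp, derivedTensorMap_id]⟩

/-- The canonical morphism `K ⊗ᴸ L ⟶ K ⊗ L` for bounded below complexes `K`, `L`. -/
def toTensor (K L : CochainComplex.Plus C) :
    derivedTensorObj (Q.obj K) (Q.obj L) ⟶ Q.obj (tensorComplex K L) :=
  (derivedTensorCounit C).app (K, L)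

lemma toTensor_naturality {K K' L L' : CochainComplex.Plus C} (f : K ⟶ K') (g : L ⟶ L') :
    derivedTensorMap (Q.map f) (Q.map g) ≫ toTensor K' L' =
      toTensor K L ≫ Q.map (tensorComplex.map f g) :=
  (derivedTensorCounit C).naturality (Prod.mkHom f g)

end Notation

/-! ### Cup-pairings on complexes -/

section CupComplex

variable {A : Type u₁} [Category.{v₁} A] [Abelian A] [MonoidalCategory A] [MonoidalPreadditive A]
  {B : Type u₂} [Category.{v₂} B] [Abelian B] [MonoidalCategory B] [MonoidalPreadditive B]
  {f g h : A ⥤ B} [f.Additive] [g.Additive] [h.Additive] (π : CupPairing f g h)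

lemma inc_cupComplex (K L : CochainComplex.Plus A) (p q n : ℤ) (hpq : p + q = n) :
    tensorComplex.inc (f.mapCochainComplexPlus.obj K) (g.mapCochainComplexPlus.obj L) p q n hpq ≫
        (cupComplex π K L).hom.f n =
      π.hom (K.obj.X p) (L.obj.X q) ≫ h.map (tensorComplex.inc K L p q n hpq) :=
  tensorComplex.inc_desc (K := f.mapCochainComplexPlus.obj K)
    (L := g.mapCochainComplexPlus.obj L)
    (fun p q hpq => π.hom (K.obj.X p) (L.obj.X q) ≫ h.map (tensorComplex.inc K L p q n hpq)) p q hpq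

lemma CupPairing.hom_naturality {X X' Y Y' : A} (a : X ⟶ X') (b : Y ⟶ Y') :
    (f.map a ⊗ₘ g.map b) ≫ π.hom X' Y' = π.hom X Y ≫ h.map (a ⊗ₘ b) :=
  π.naturality (Prod.mkHom a b)

lemma cupComplex_naturality {K K' L L' : CochainComplex.Plus A} (a : K ⟶ K') (b : L ⟶ L') :
    tensorComplex.map (f.mapCochainComplexPlus.map a) (g.mapCochainComplexPlus.map b) ≫
        cupComplex π K' L' =
      cupComplex π K L ≫ h.mapCochainComplexPlus.map (tensorComplex.map a b) := by
  ext n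
  refine tensorComplex.hom_ext fun p q hpq => ?_
  have h₁ : (f.map (a.hom.f p) ⊗ₘ g.map (b.hom.f q)) ≫ π.hom (K'.obj.X p) (L'.obj.X q) ≫
        h.map (tensorComplex.inc K' L' p q n hpq) =
      π.hom (K.obj.X p) (L.obj.X q) ≫ h.map (tensorComplex.inc K L p q n hpq) ≫
        h.map ((tensorComplex.map a b).hom.f n) := by
    rw [reassoc_of% (π.hom_naturality (a.hom.f p) (b.hom.f q)), ← h.map_comp, ← h.map_comp,
      tensorComplex.inc_map]
  refine (((reassoc_of% (tensorComplex.inc_map (f.mapCochainComplexPlus.map a)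
    (g.mapCochainComplexPlus.map b) p q n hpq)) _).trans
      (congr_arg (_ ≫ ·) (inc_cupComplex π K' L' p q n hpq))).trans (h₁.trans ?_)
  exact (Category.assoc _ _ _).symm.trans
    ((inc_cupComplex π K L p q n hpq).symm =≫ _ |>.trans (Category.assoc _ _ _))

end CupComplex

/-! ### Units and counits on complexes and on derived categories -/

section DerivedAdjunction

variable {A : Type u₁} [Category.{v₁} A] [Abelian A] [HasDerivedCategory.{w₁} A]
  {B : Type u₂} [Category.{v₂} B] [Abelian B] [HasDerivedCategory.{w₂} B]

section

variable (F : B ⥤ A) [F.Additive] [PreservesFiniteLimits F] [PreservesFiniteColimits F]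

/-- The functor induced by an exact functor is computed termwise on complexes. -/
def exactDerivedApp (K : CochainComplex.Plus B) :
    (exactDerived F).obj (Q.obj K) ⟶ Q.obj (F.mapCochainComplexPlus.obj K) :=
  (exactDerivedIso F).hom.app K

instance (K : CochainComplex.Plus B) : IsIso (exactDerivedApp F K) :=
  inferInstanceAs (IsIso ((exactDerivedIso F).hom.app K))

lemma exactDerivedApp_naturality {K L : CochainComplex.Plus B} (φ : K ⟶ L) :
    (exactDerived F).map (Q.map φ) ≫ exactDerivedApp F L =
      exactDerivedApp F K ≫ Q.map (F.mapCochainComplexPlus.map φ) :=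
  (exactDerivedIso F).hom.naturality φ

end

variable {f : A ⥤ B} {f' : B ⥤ A} (adj : f' ⊣ f) [f.Additive] [f'.Additive]

/-- The unit of the adjunction on bounded below complexes. -/
def unitPlus (K : CochainComplex.Plus B) :
    K ⟶ f.mapCochainComplexPlus.obj (f'.mapCochainComplexPlus.obj K) :=
  (adjunctionPlus adj).unit.app K

/-- The counit of the adjunction on bounded below complexes. -/
def counitPlus (K : CochainComplex.Plus A) :
    f'.mapCochainComplexPlus.obj (f.mapCochainComplexPlus.obj K) ⟶ K :=
  (adjunctionPlus adj).counit.app K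

lemma unitPlus_naturality {K L : CochainComplex.Plus B} (φ : K ⟶ L) :
    φ ≫ unitPlus adj L =
      unitPlus adj K ≫ f.mapCochainComplexPlus.map (f'.mapCochainComplexPlus.map φ) :=
  (adjunctionPlus adj).unit.naturality φ

lemma unitPlus_counitPlus (K : CochainComplex.Plus A) :
    unitPlus adj (f.mapCochainComplexPlus.obj K) ≫
      f.mapCochainComplexPlus.map (counitPlus adj K) = 𝟙 _ :=
  (adjunctionPlus adj).right_triangle_components K

variable [EnoughInjectives A] [PreservesFiniteLimits f'] [PreservesFiniteColimits f']

/-- The unit of the derived adjunction. -/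
def unitDerived (X : DerivedCategory.Plus B) :
    X ⟶ f.rightDerivedFunctorPlus.obj ((exactDerived f').obj X) :=
  (derivedAdjunction adj).unit.app X

/-- The counit of the derived adjunction. -/
def counitDerived (X : DerivedCategory.Plus A) :
    (exactDerived f').obj (f.rightDerivedFunctorPlus.obj X) ⟶ X :=
  (derivedAdjunction adj).counit.app X

lemma unitDerived_naturality {X Y : DerivedCategory.Plus B} (φ : X ⟶ Y) :
    φ ≫ unitDerived adj Y =
      unitDerived adj X ≫ f.rightDerivedFunctorPlus.map ((exactDerived f').map φ) :=
  (derivedAdjunction adj).unit.naturality φ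

lemma counitDerived_naturality {X Y : DerivedCategory.Plus A} (φ : X ⟶ Y) :
    (exactDerived f').map (f.rightDerivedFunctorPlus.map φ) ≫ counitDerived adj Y =
      counitDerived adj X ≫ φ :=
  (derivedAdjunction adj).counit.naturality φ

lemma unitDerived_counitDerived (X : DerivedCategory.Plus A) :
    unitDerived adj (f.rightDerivedFunctorPlus.obj X) ≫
      f.rightDerivedFunctorPlus.map (counitDerived adj X) = 𝟙 _ :=
  (derivedAdjunction adj).right_triangle_components X

lemma unitDerived_Q (K : CochainComplex.Plus B) :
    unitDerived adj (Q.obj K) ≫ f.rightDerivedFunctorPlus.map (exactDerivedApp f' K) =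
      Q.map (unitPlus adj K) ≫ derivedUnit f (f'.mapCochainComplexPlus.obj K) :=
  derivedAdjunction_unit_app adj K

lemma counitDerived_Q (K : CochainComplex.Plus A) :
    (exactDerived f').map (derivedUnit f K) ≫ counitDerived adj (Q.obj K) =
      exactDerivedApp f' (f.mapCochainComplexPlus.obj K) ≫ Q.map (counitPlus adj K) :=
  derivedAdjunction_counit_app adj K

end DerivedAdjunction

/-! ### The derived cup product -/

section DerivedCup

variable {A : Type u₁} [Category.{v₁} A] [Abelian A] [MonoidalCategory A] [MonoidalPreadditive A]
  [SymmetricCategory A] [∀ X : A, PreservesFiniteColimits (tensorLeft X)]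
  [HasDerivedCategory.{w₁} A] [EnoughInjectives A] [HasDerivedTensor A]
  {B : Type u₂} [Category.{v₂} B] [Abelian B] [MonoidalCategory B] [MonoidalPreadditive B]
  [SymmetricCategory B] [∀ X : B, PreservesFiniteColimits (tensorLeft X)]
  [HasDerivedCategory.{w₂} B]
  {f g h : A ⥤ B} [f.Additive] [g.Additive] [h.Additive]
  {f' g' : B ⥤ A} (adjf : f' ⊣ f) (adjg : g' ⊣ g)
  [f'.Additive] [PreservesFiniteLimits f'] [PreservesFiniteColimits f']
  [g'.Additive] [PreservesFiniteLimits g'] [PreservesFiniteColimits g']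

section

variable (f' g') {E : Type u} [Category.{v} E] (N : DerivedCategory.Plus A ⥤ E)

/-- The functor `(K, L) ↦ f' K ⊗ g' L` on bounded below complexes. -/
abbrev tensorPullback : CochainComplex.Plus B × CochainComplex.Plus B ⥤ CochainComplex.Plus A :=
  f'.mapCochainComplexPlus.prod g'.mapCochainComplexPlus ⋙ tensorComplexFunctor A

/-- The functor `(X, Y) ↦ f' X ⊗ᴸ g' Y` on bounded below derived categories. -/
abbrev derivedTensorPullback :
    DerivedCategory.Plus B × DerivedCategory.Plus B ⥤ DerivedCategory.Plus A :=
  (exactDerived f').prod (exactDerived g') ⋙ derivedTensor A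

/-- The canonical morphism `f' K ⊗ᴸ g' L ⟶ f' K ⊗ g' L`. -/
def tensorPullbackCounitApp (K L : CochainComplex.Plus B) :
    derivedTensorObj ((exactDerived f').obj (Q.obj K)) ((exactDerived g').obj (Q.obj L)) ⟶
      Q.obj (tensorComplex (f'.mapCochainComplexPlus.obj K) (g'.mapCochainComplexPlus.obj L)) :=
  derivedTensorMap (exactDerivedApp f' K) (exactDerivedApp g' L) ≫ toTensor _ _

lemma tensorPullbackCounitApp_naturality {K K' L L' : CochainComplex.Plus B} (a : K ⟶ K')
    (b : L ⟶ L') :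
    derivedTensorMap ((exactDerived f').map (Q.map a)) ((exactDerived g').map (Q.map b)) ≫
        tensorPullbackCounitApp f' g' K' L' =
      tensorPullbackCounitApp f' g' K L ≫ Q.map (tensorComplex.map
        (f'.mapCochainComplexPlus.map a) (g'.mapCochainComplexPlus.map b)) := by
  unfold tensorPullbackCounitApp
  rw [Category.assoc, ← toTensor_naturality, ← Category.assoc, ← Category.assoc,
    derivedTensorMap_comp, derivedTensorMap_comp, exactDerivedApp_naturality,
    exactDerivedApp_naturality]

/-- The canonical morphism `N (f' K ⊗ᴸ g' L) ⟶ N (f' K ⊗ g' L)`, as a natural transformation. -/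
def tensorPullbackCounit :
    (Q (C := B)).prod (Q (C := B)) ⋙ derivedTensorPullback f' g' ⋙ N ⟶
      tensorPullback f' g' ⋙ Q ⋙ N where
  app K := N.map (tensorPullbackCounitApp f' g' K.1 K.2)
  naturality _ _ φ := (N.map_comp _ _).symm.trans ((congr_arg N.map
    (tensorPullbackCounitApp_naturality f' g' φ.1 φ.2)).trans (N.map_comp _ _))

variable [hB : Fact (HasFiniteTorDimension B)] [hA : Fact (HasFiniteTorDimension A)]

/-- This is where preservation of flat objects enters: for flat `K` and `L` the complexes `f' K` and
`g' L` are flat, so their derived and ordinary tensor products agree. -/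
lemma isLeftDerivedFunctor_tensorPullback (hf' : ∀ P, IsFlat P → IsFlat (f'.obj P))
    (hg' : ∀ P, IsFlat P → IsFlat (g'.obj P)) :
    (derivedTensorPullback f' g' ⋙ N).IsLeftDerivedFunctor (tensorPullbackCounit f' g' N)
      ((CochainComplex.Plus.quasiIso B).prod (CochainComplex.Plus.quasiIso B)) :=
  hB.out.isLeftResolving_prod.isLeftDerivedFunctor _ _ _ fun K hK => by
    have : IsIso (toTensor (f'.mapCochainComplexPlus.obj K.1)
        (g'.mapCochainComplexPlus.obj K.2)) :=
      hA.out.isIso_derivedTensorCounit (f'.mapCochainComplexPlus.obj K.1)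
        (g'.mapCochainComplexPlus.obj K.2) (fun n => hf' _ (hK.1 n)) (fun n => hg' _ (hK.2 n))
    have : IsIso (tensorPullbackCounitApp f' g' K.1 K.2) := by
      unfold tensorPullbackCounitApp
      infer_instance
    exact inferInstanceAs (IsIso (N.map (tensorPullbackCounitApp f' g' K.1 K.2)))

end

/-- The compatibility of the counits of the derived adjunctions with `K ⊗ᴸ L ⟶ K ⊗ L`. -/
lemma tensor_counitDerived_toTensor (K L : CochainComplex.Plus A) :
    derivedTensorMap ((exactDerived f').map (derivedUnit f K))
        ((exactDerived g').map (derivedUnit g L)) ≫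
      derivedTensorMap (counitDerived adjf (Q.obj K)) (counitDerived adjg (Q.obj L)) ≫
        toTensor K L =
      tensorPullbackCounitApp f' g' (f.mapCochainComplexPlus.obj K)
          (g.mapCochainComplexPlus.obj L) ≫
        Q.map (tensorComplex.map (counitPlus adjf K) (counitPlus adjg L)) := by
  unfold tensorPullbackCounitApp
  rw [Category.assoc, ← toTensor_naturality, ← Category.assoc, ← Category.assoc,
    derivedTensorMap_comp, derivedTensorMap_comp, counitDerived_Q, counitDerived_Q]

variable [hB : Fact (HasFiniteTorDimension B)] [hA : Fact (HasFiniteTorDimension A)]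

section

variable {E : Type u} [Category.{v} E]
  {S : DerivedCategory.Plus B × DerivedCategory.Plus B ⥤ E} {N : DerivedCategory.Plus A ⥤ E}

/-- The restriction along the derived adjunctions of a natural transformation from
`S (Rf X, Rg Y)` to `N (X ⊗ᴸ Y)`. -/
def adjointTransform
    (Θ : f.rightDerivedFunctorPlus.prod g.rightDerivedFunctorPlus ⋙ S ⟶ derivedTensor A ⋙ N) :
    S ⟶ derivedTensorPullback f' g' ⋙ N where
  app X := S.map (Prod.mkHom (unitDerived adjf X.1) (unitDerived adjg X.2)) ≫
    Θ.app ((exactDerived f').obj X.1, (exactDerived g').obj X.2)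
  naturality X Y φ := by
    have h : φ ≫ Prod.mkHom (unitDerived adjf Y.1) (unitDerived adjg Y.2) =
        Prod.mkHom (unitDerived adjf X.1) (unitDerived adjg X.2) ≫
          Prod.mkHom (f.rightDerivedFunctorPlus.map ((exactDerived f').map φ.1))
            (g.rightDerivedFunctorPlus.map ((exactDerived g').map φ.2)) :=
      Prod.ext (unitDerived_naturality adjf φ.1) (unitDerived_naturality adjg φ.2)
    have h' := congr_arg S.map h
    rw [S.map_comp, S.map_comp] at h'
    rw [reassoc_of% h', Category.assoc]
    exact congr_arg (_ ≫ ·) (Θ.naturality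
      (Prod.mkHom ((exactDerived f').map φ.1) ((exactDerived g').map φ.2)))

/-- On a complex the derived unit is the unit of complexes followed by `f ⟶ Rf`. Hence the adjoint
transform, followed by the counit, sees `Θ` only through its composites with `derivedUnit` and
`toTensor`, which is the form of the hypothesis of `hom_ext_of_derivedUnit`. -/
lemma adjointTransform_Q
    (Θ : f.rightDerivedFunctorPlus.prod g.rightDerivedFunctorPlus ⋙ S ⟶ derivedTensor A ⋙ N)
    (K L : CochainComplex.Plus B) :
    (adjointTransform adjf adjg Θ).app (Q.obj K, Q.obj L) ≫
        N.map (tensorPullbackCounitApp f' g' K L) =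
      S.map (Prod.mkHom (Q.map (unitPlus adjf K)) (Q.map (unitPlus adjg L))) ≫
        S.map (Prod.mkHom (derivedUnit f (f'.mapCochainComplexPlus.obj K))
          (derivedUnit g (g'.mapCochainComplexPlus.obj L))) ≫
        Θ.app (Q.obj (f'.mapCochainComplexPlus.obj K), Q.obj (g'.mapCochainComplexPlus.obj L)) ≫
        N.map (toTensor (f'.mapCochainComplexPlus.obj K) (g'.mapCochainComplexPlus.obj L)) := by
  have nat := Θ.naturality (Prod.mkHom (exactDerivedApp f' K) (exactDerivedApp g' L))
  have h : Prod.mkHom (unitDerived adjf (Q.obj K)) (unitDerived adjg (Q.obj L)) ≫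
      Prod.mkHom (f.rightDerivedFunctorPlus.map (exactDerivedApp f' K))
        (g.rightDerivedFunctorPlus.map (exactDerivedApp g' L)) =
      Prod.mkHom (Q.map (unitPlus adjf K)) (Q.map (unitPlus adjg L)) ≫
        Prod.mkHom (derivedUnit f (f'.mapCochainComplexPlus.obj K))
          (derivedUnit g (g'.mapCochainComplexPlus.obj L)) :=
    Prod.ext (unitDerived_Q adjf K) (unitDerived_Q adjg L)
  have h' := congr_arg S.map h
  rw [S.map_comp, S.map_comp] at h'
  rw [← reassoc_of% h']
  refine (Category.assoc _ _ _).trans (congr_arg (_ ≫ ·) ?_)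
  refine (congr_arg (_ ≫ ·) (N.map_comp _ _)).trans ?_
  exact (Category.assoc _ _ _).symm.trans ((nat.symm =≫ _).trans (Category.assoc _ _ _))

/-- By the triangle identities `Θ` is recovered from its adjoint transform. -/
lemma adjointTransform_counitDerived
    (Θ : f.rightDerivedFunctorPlus.prod g.rightDerivedFunctorPlus ⋙ S ⟶ derivedTensor A ⋙ N)
    (X Y : DerivedCategory.Plus A) :
    (adjointTransform adjf adjg Θ).app
        (f.rightDerivedFunctorPlus.obj X, g.rightDerivedFunctorPlus.obj Y) ≫
      N.map (derivedTensorMap (counitDerived adjf X) (counitDerived adjg Y)) = Θ.app (X, Y) := by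
  have nat := Θ.naturality (Prod.mkHom (counitDerived adjf X) (counitDerived adjg Y))
  have h : Prod.mkHom (unitDerived adjf (f.rightDerivedFunctorPlus.obj X))
      (unitDerived adjg (g.rightDerivedFunctorPlus.obj Y)) ≫
      Prod.mkHom (f.rightDerivedFunctorPlus.map (counitDerived adjf X))
        (g.rightDerivedFunctorPlus.map (counitDerived adjg Y)) = 𝟙 (_, _) :=
    Prod.ext (unitDerived_counitDerived adjf X) (unitDerived_counitDerived adjg Y)
  have h' := congr_arg S.map h
  rw [S.map_comp, S.map_id] at h'
  refine (Category.assoc _ _ _).trans ((congr_arg (_ ≫ ·) nat.symm).trans ?_)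
  exact (Category.assoc _ _ _).symm.trans ((h' =≫ _).trans (Category.id_comp _))

/-- Natural transformations on `(X, Y) ↦ S (Rf X, Rg Y)` with values in `N (X ⊗ᴸ Y)` are
determined by their restrictions to complexes. -/
lemma hom_ext_of_derivedUnit (adjf : f' ⊣ f) (adjg : g' ⊣ g)
    (hf' : ∀ P, IsFlat P → IsFlat (f'.obj P)) (hg' : ∀ P, IsFlat P → IsFlat (g'.obj P))
    {Θ₁ Θ₂ : f.rightDerivedFunctorPlus.prod g.rightDerivedFunctorPlus ⋙ S ⟶ derivedTensor A ⋙ N}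
    (hΘ : ∀ K L : CochainComplex.Plus A,
      S.map (Prod.mkHom (derivedUnit f K) (derivedUnit g L)) ≫ Θ₁.app (Q.obj K, Q.obj L) ≫
          N.map (toTensor K L) =
        S.map (Prod.mkHom (derivedUnit f K) (derivedUnit g L)) ≫ Θ₂.app (Q.obj K, Q.obj L) ≫
          N.map (toTensor K L)) : Θ₁ = Θ₂ := by
  -- After transport along the adjunctions the target is a left derived functor, so equality may be
  -- tested on complexes.
  have hT : adjointTransform adjf adjg Θ₁ = adjointTransform adjf adjg Θ₂ := by
    have := isLeftDerivedFunctor_tensorPullback f' g' N hf' hg'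
    refine (derivedTensorPullback f' g' ⋙ N).leftDerived_ext (tensorPullbackCounit f' g' N)
      ((CochainComplex.Plus.quasiIso B).prod (CochainComplex.Plus.quasiIso B)) _ _ _ ?_
    ext K
    exact (adjointTransform_Q adjf adjg Θ₁ K.1 K.2).trans ((congr_arg _ (hΘ _ _)).trans
      (adjointTransform_Q adjf adjg Θ₂ K.1 K.2).symm)
  ext X
  exact (adjointTransform_counitDerived adjf adjg Θ₁ X.1 X.2).symm.trans
    ((congr_app hT _ =≫ _).trans (adjointTransform_counitDerived adjf adjg Θ₂ X.1 X.2))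

end

variable [HasDerivedTensor B] (π : CupPairing f g h)

/-- The morphism of complexes `K ⊗ L ⟶ h (f' K ⊗ g' L)` adjoint to a cup-pairing. -/
def cupPullback (K L : CochainComplex.Plus B) :
    tensorComplex K L ⟶ h.mapCochainComplexPlus.obj (tensorComplex
      (f'.mapCochainComplexPlus.obj K) (g'.mapCochainComplexPlus.obj L)) :=
  tensorComplex.map (unitPlus adjf K) (unitPlus adjg L) ≫ cupComplex π _ _

lemma cupPullback_naturality {K K' L L' : CochainComplex.Plus B} (a : K ⟶ K') (b : L ⟶ L') :
    tensorComplex.map a b ≫ cupPullback adjf adjg π K' L' =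
      cupPullback adjf adjg π K L ≫ h.mapCochainComplexPlus.map (tensorComplex.map
        (f'.mapCochainComplexPlus.map a) (g'.mapCochainComplexPlus.map b)) := by
  unfold cupPullback
  rw [Category.assoc, ← cupComplex_naturality, ← Category.assoc, ← Category.assoc,
    ← tensorComplex.map_comp, ← tensorComplex.map_comp, unitPlus_naturality, unitPlus_naturality]

/-- The triangle identities at the level of complexes: passing to the adjoint and back returns the
original pairing. -/
lemma cupPullback_counitPlus (K L : CochainComplex.Plus A) :
    cupPullback adjf adjg π (f.mapCochainComplexPlus.obj K) (g.mapCochainComplexPlus.obj L) ≫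
      h.mapCochainComplexPlus.map (tensorComplex.map (counitPlus adjf K) (counitPlus adjg L)) =
        cupComplex π K L := by
  unfold cupPullback
  rw [Category.assoc, ← cupComplex_naturality, ← Category.assoc, ← tensorComplex.map_comp,
    unitPlus_counitPlus, unitPlus_counitPlus]
  exact (((tensorComplexFunctor B).map_id _) =≫ _).trans (Category.id_comp _)

/-- The morphism `X ⊗ᴸ Y ⟶ Rh (f' X ⊗ᴸ g' Y)` adjoint to a cup-pairing. -/
lemma exists_derivedCupPullback (hf' : ∀ P, IsFlat P → IsFlat (f'.obj P))
    (hg' : ∀ P, IsFlat P → IsFlat (g'.obj P)) :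
    ∃ Ψ : derivedTensor B ⟶ derivedTensorPullback f' g' ⋙ h.rightDerivedFunctorPlus,
      ∀ K L : CochainComplex.Plus B, Ψ.app (Q.obj K, Q.obj L) ≫
        h.rightDerivedFunctorPlus.map (tensorPullbackCounitApp f' g' K L) =
      toTensor K L ≫ Q.map (cupPullback adjf adjg π K L) ≫ derivedUnit h _ := by
  have := isLeftDerivedFunctor_tensorPullback f' g' h.rightDerivedFunctorPlus hf' hg'
  let β : (Q (C := B)).prod (Q (C := B)) ⋙ derivedTensor B ⟶
      tensorPullback f' g' ⋙ Q ⋙ h.rightDerivedFunctorPlus :=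
    { app K := toTensor K.1 K.2 ≫ Q.map (cupPullback adjf adjg π K.1 K.2) ≫ derivedUnit h _
      naturality K L φ := by
        have h₁ := toTensor_naturality φ.1 φ.2
        have h₂ := congr_arg Q.map (cupPullback_naturality adjf adjg π φ.1 φ.2)
        have h₃ := derivedUnit_naturality h (tensorComplex.map
          (f'.mapCochainComplexPlus.map φ.1) (g'.mapCochainComplexPlus.map φ.2))
        rw [Q.map_comp, Q.map_comp] at h₂
        have h₄ := (reassoc_of% h₂) (derivedUnit h (tensorComplex
          (f'.mapCochainComplexPlus.obj L.1) (g'.mapCochainComplexPlus.obj L.2)))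
        rw [h₃] at h₄
        exact ((reassoc_of% h₁) _).trans ((congr_arg (_ ≫ ·) (h₄.trans
          (Category.assoc _ _ _).symm)).trans (Category.assoc _ _ _).symm) }
  exact ⟨(derivedTensorPullback f' g' ⋙ h.rightDerivedFunctorPlus).leftDerivedLift
    (tensorPullbackCounit f' g' h.rightDerivedFunctorPlus)
    ((CochainComplex.Plus.quasiIso B).prod (CochainComplex.Plus.quasiIso B)) _ β,
    fun K L => Functor.leftDerived_fac_app _ (tensorPullbackCounit f' g' h.rightDerivedFunctorPlus)
      ((CochainComplex.Plus.quasiIso B).prod (CochainComplex.Plus.quasiIso B)) _ β (K, L)⟩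

/-- The existence of the derived cup product. -/
lemma exists_derivedCupPairing (adjf : f' ⊣ f) (adjg : g' ⊣ g)
    (hf' : ∀ P, IsFlat P → IsFlat (f'.obj P)) (hg' : ∀ P, IsFlat P → IsFlat (g'.obj P)) :
    ∃ Φ : DerivedCupPairing f g h, Φ.Extends π := by
  obtain ⟨Ψ, hΨ⟩ := exists_derivedCupPullback adjf adjg π hf' hg'
  have nat {X X' Y Y' : DerivedCategory.Plus B} (a : X ⟶ X') (b : Y ⟶ Y') :
      derivedTensorMap a b ≫ Ψ.app (X', Y') =
        Ψ.app (X, Y) ≫ h.rightDerivedFunctorPlus.map (derivedTensorMap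
          ((exactDerived f').map a) ((exactDerived g').map b)) :=
    Ψ.naturality (Prod.mkHom a b)
  -- The pairing is adjoint to `Ψ`: evaluate `Ψ` at `(Rf X, Rg Y)` and apply the counits `f' Rf X ⟶
  -- X` and `g' Rg Y ⟶ Y` inside `Rh`.
  let Φ : DerivedCupPairing f g h :=
    { app X := Ψ.app (f.rightDerivedFunctorPlus.obj X.1, g.rightDerivedFunctorPlus.obj X.2) ≫
        h.rightDerivedFunctorPlus.map
          (derivedTensorMap (counitDerived adjf X.1) (counitDerived adjg X.2))
      naturality X Y φ := by
        refine ((reassoc_of% (nat (f.rightDerivedFunctorPlus.map φ.1)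
          (g.rightDerivedFunctorPlus.map φ.2))) _).trans ?_
        refine (congr_arg (_ ≫ ·) ?_).trans (Category.assoc _ _ _).symm
        rw [← Functor.map_comp, derivedTensorMap_comp, counitDerived_naturality,
          counitDerived_naturality, ← derivedTensorMap_comp, Functor.map_comp]
        rfl }
  refine ⟨Φ, fun K L => ?_⟩
  calc
    _ = derivedTensorMap (derivedUnit f K) (derivedUnit g L) ≫
        Ψ.app (f.rightDerivedFunctorPlus.obj (Q.obj K), g.rightDerivedFunctorPlus.obj (Q.obj L)) ≫
          h.rightDerivedFunctorPlus.map (derivedTensorMap (counitDerived adjf (Q.obj K))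
            (counitDerived adjg (Q.obj L)) ≫ toTensor K L) := by
      rw [Functor.map_comp]
      exact congr_arg (_ ≫ ·) (Category.assoc _ _ _)
    _ = Ψ.app (Q.obj (f.mapCochainComplexPlus.obj K), Q.obj (g.mapCochainComplexPlus.obj L)) ≫
          h.rightDerivedFunctorPlus.map (tensorPullbackCounitApp f' g'
            (f.mapCochainComplexPlus.obj K) (g.mapCochainComplexPlus.obj L)) ≫
          h.rightDerivedFunctorPlus.map (Q.map
            (tensorComplex.map (counitPlus adjf K) (counitPlus adjg L))) := by
      refine ((reassoc_of% (nat (derivedUnit f K) (derivedUnit g L))) _).trans ?_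
      rw [← Functor.map_comp, ← Functor.map_comp, tensor_counitDerived_toTensor]
    _ = toTensor _ _ ≫ Q.map (cupComplex π K L) ≫ derivedUnit h (tensorComplex K L) := by
      rw [← cupPullback_counitPlus adjf adjg π K L, Q.map_comp, Category.assoc,
        derivedUnit_naturality]
      refine ((reassoc_of% (hΨ (f.mapCochainComplexPlus.obj K)
        (g.mapCochainComplexPlus.obj L))) _).trans ?_
      rfl

end DerivedCup

open DerivedCategory.Plus (Q Qh homologyFunctor)

/-! ### Shifts of bounded below complexes -/

section ShiftPlus

/-- The shifts on bounded below categories are induced from the unbounded ones. This formula moves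
identities between shift isomorphisms to the ambient category, where they are known. -/
lemma lift_commShiftIso_hom_app {C D : Type*} [Category* C] [Category* D] [HasShift C ℤ]
    [HasShift D ℤ] (P : ObjectProperty D) [P.IsStableUnderShift ℤ] (F : C ⥤ D) [F.CommShift ℤ]
    (hF : ∀ X, P (F.obj X)) (X : C) (n : ℤ) :
    P.ι.map (((P.lift F hF).commShiftIso n).hom.app X) ≫
        (P.ι.commShiftIso n).hom.app ((P.lift F hF).obj X) =
      (F.commShiftIso n).hom.app X := by
  have h := NatTrans.shift_app_comm (P.liftCompιIso F hF).hom n X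
  rw [Functor.commShiftIso_comp_hom_app] at h
  have h₁ : (shiftFunctor D n).map ((P.liftCompιIso F hF).hom.app X) = 𝟙 _ :=
    (shiftFunctor D n).map_id _
  rw [h₁] at h
  exact (Category.comp_id _).symm.trans (h.trans (Category.id_comp _))

variable {C : Type u} [Category.{v} C] [Abelian C]

/-- The shift of a bounded below complex. -/
def shiftPlus (K : CochainComplex.Plus C) : CochainComplex.Plus C :=
  ⟨K.obj⟦(1 : ℤ)⟧, by
    obtain ⟨n, hn⟩ := K.property
    exact ⟨n - 1, K.obj.isStrictlyGE_shift n 1 (n - 1) (by lia)⟩⟩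

/-- The shift of a morphism of bounded below complexes. -/
def shiftPlusMap {K L : CochainComplex.Plus C} (φ : K ⟶ L) : shiftPlus K ⟶ shiftPlus L :=
  ObjectProperty.homMk (φ.hom⟦(1 : ℤ)⟧')

/-- The shift of bounded below complexes commutes with the passage to the homotopy category. -/
def quotientShift (K : CochainComplex.Plus C) :
    (HomotopyCategory.Plus.quotient C).obj (shiftPlus K) ≅
      ((HomotopyCategory.Plus.quotient C).obj K)⟦(1 : ℤ)⟧ :=
  (HomotopyCategory.Plus.fullyFaithfulι C).preimageIso
    (((HomotopyCategory.quotient C (.up ℤ)).commShiftIso (1 : ℤ)).app K.obj ≪≫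
      (((HomotopyCategory.Plus.ι C).commShiftIso (1 : ℤ)).app
        ((HomotopyCategory.Plus.quotient C).obj K)).symm)

lemma ι_quotientShift (K : CochainComplex.Plus C) :
    (HomotopyCategory.Plus.ι C).map (quotientShift K).hom ≫
        ((HomotopyCategory.Plus.ι C).commShiftIso (1 : ℤ)).hom.app
          ((HomotopyCategory.Plus.quotient C).obj K) =
      ((HomotopyCategory.quotient C (.up ℤ)).commShiftIso (1 : ℤ)).hom.app K.obj := by
  have : (HomotopyCategory.Plus.ι C).map (quotientShift K).hom = 
      ((HomotopyCategory.quotient C (.up ℤ)).commShiftIso (1 : ℤ)).hom.app K.obj ≫ 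
      ((HomotopyCategory.Plus.ι C).commShiftIso (1 : ℤ)).inv.app
        ((HomotopyCategory.Plus.quotient C).obj K) := 
    (HomotopyCategory.Plus.fullyFaithfulι C).map_preimage _
  have h := Iso.inv_hom_id_app ((HomotopyCategory.Plus.ι C).commShiftIso (1 : ℤ))
    ((HomotopyCategory.Plus.quotient C).obj K)
  refine (this =≫ _).trans ((Category.assoc _ _ _).trans ?_)
  exact (congr_arg (_ ≫ ·) h).trans (Category.comp_id _)

lemma quotientShift_naturality {K L : CochainComplex.Plus C} (φ : K ⟶ L) :
    (HomotopyCategory.Plus.quotient C).map (shiftPlusMap φ) ≫ (quotientShift L).hom =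
      (quotientShift K).hom ≫ ((HomotopyCategory.Plus.quotient C).map φ)⟦(1 : ℤ)⟧' := by
  apply (HomotopyCategory.Plus.fullyFaithfulι C).map_injective
  rw [← cancel_mono (((HomotopyCategory.Plus.ι C).commShiftIso (1 : ℤ)).hom.app _)]
  rw [Functor.map_comp, Functor.map_comp, Category.assoc, Category.assoc, ι_quotientShift,
    Functor.commShiftIso_hom_naturality, reassoc_of% (ι_quotientShift K)]
  exact ((HomotopyCategory.quotient C (.up ℤ)).commShiftIso (1 : ℤ)).hom.naturality φ.hom

section

variable {D : Type u₁} [Category.{v₁} D] [Abelian D] (f : C ⥤ D) [f.Additive]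

/-- An additive functor commutes with the shift of bounded below complexes. -/
def mapShiftPlus (K : CochainComplex.Plus C) :
    f.mapCochainComplexPlus.obj (shiftPlus K) ⟶ shiftPlus (f.mapCochainComplexPlus.obj K) :=
  ObjectProperty.homMk (((f.mapHomologicalComplex (.up ℤ)).commShiftIso (1 : ℤ)).hom.app K.obj)

instance (K : CochainComplex.Plus C) : IsIso (mapShiftPlus f K) := by
  have : IsIso ((CochainComplex.Plus.ι D).map (mapShiftPlus f K)) := inferInstanceAs
    (IsIso (((f.mapHomologicalComplex (.up ℤ)).commShiftIso (1 : ℤ)).hom.app K.obj))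
  exact isIso_of_reflects_iso _ (CochainComplex.Plus.ι D)

/-- Commuting `f` with the shift termwise on complexes, or by the shift structure on homotopy
categories, gives the same result; this is tested in the unbounded homotopy category. -/
lemma mapShiftPlus_quotientShift (K : CochainComplex.Plus C) :
    (HomotopyCategory.Plus.quotient D).map (mapShiftPlus f K) ≫
        (quotientShift (f.mapCochainComplexPlus.obj K)).hom =
      f.mapHomotopyCategoryPlus.map (quotientShift K).hom ≫
        (f.mapHomotopyCategoryPlus.commShiftIso (1 : ℤ)).hom.app
          ((HomotopyCategory.Plus.quotient C).obj K) := by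
  apply (HomotopyCategory.Plus.fullyFaithfulι D).map_injective
  rw [← cancel_mono (((HomotopyCategory.Plus.ι D).commShiftIso (1 : ℤ)).hom.app _)]
  have h₁ := ι_quotientShift (f.mapCochainComplexPlus.obj K)
  have h₂ := lift_commShiftIso_hom_app (HomotopyCategory.plus D)
    (HomotopyCategory.Plus.ι C ⋙ f.mapHomotopyCategory (ComplexShape.up ℤ))
    (fun X => (f.mapHomotopyCategoryPlus.obj X).property)
    ((HomotopyCategory.Plus.quotient C).obj K) 1
  rw [Functor.commShiftIso_comp_hom_app] at h₂
  have h₃ := NatTrans.shift_app_comm (f.mapHomotopyCategoryFactors (ComplexShape.up ℤ)).hom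
    (1 : ℤ) K.obj
  rw [Functor.commShiftIso_comp_hom_app, Functor.commShiftIso_comp_hom_app] at h₃
  have h₄ := congr_arg (f.mapHomotopyCategory (ComplexShape.up ℤ)).map (ι_quotientShift K)
  rw [Functor.map_comp] at h₄
  have h₅ : (shiftFunctor (HomotopyCategory D (.up ℤ)) (1 : ℤ)).map
    ((f.mapHomotopyCategoryFactors (ComplexShape.up ℤ)).hom.app K.obj) = 𝟙 _ :=
    (shiftFunctor _ _).map_id _
  rw [h₅] at h₃
  refine ((HomotopyCategory.Plus.ι D).map_comp _ _ =≫ _).trans ((Category.assoc _ _ _).trans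
    ((congr_arg (_ ≫ ·) h₁).trans (Eq.symm ?_)))
  refine ((HomotopyCategory.Plus.ι D).map_comp _ _ =≫ _).trans ((Category.assoc _ _ _).trans
    ((congr_arg (_ ≫ ·) h₂).trans ?_))
  refine (Category.assoc _ _ _).symm.trans ((h₄ =≫ _).trans ?_)
  exact (Category.comp_id _).symm.trans (h₃.trans (Category.id_comp _))

end

end ShiftPlus

/-! ### Right derived functors and the shift -/

section DerivedShift

/-- The universal property of `Rf` only produces maps out of `Rf X`, so `derivedShift` is defined by
the detour through `X⟦1⟧⟦-1⟧`. The detour cancels: on units it amounts to the commutation of `F`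
with the shift. -/
lemma comp_shift_eq_of_commShift {H D E : Type*} [Category* H] [Category* D] [Category* E]
    [HasShift H ℤ] [HasShift D ℤ] [HasShift E ℤ] (F : H ⥤ D) (G : H ⥤ E) (R : E ⥤ D)
    [F.CommShift ℤ] [G.CommShift ℤ] (u : F ⟶ G ⋙ R) (X : H) :
    (shiftFunctorCompIsoId D (-1 : ℤ) 1 (by simp)).inv.app (F.obj (X⟦(1 : ℤ)⟧)) ≫
        ((F.commShiftIso (-1 : ℤ)).inv.app (X⟦(1 : ℤ)⟧) ≫ u.app (X⟦(1 : ℤ)⟧⟦(-1 : ℤ)⟧) ≫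
          R.map ((G.commShiftIso (-1 : ℤ)).hom.app (X⟦(1 : ℤ)⟧)))⟦(1 : ℤ)⟧' ≫
        (R.map (((G.commShiftIso (1 : ℤ)).hom.app X)⟦(-1 : ℤ)⟧'))⟦(1 : ℤ)⟧' ≫
        (R.map ((shiftFunctorCompIsoId E (1 : ℤ) (-1) (by simp)).hom.app (G.obj X)))⟦(1 : ℤ)⟧' =
      (F.commShiftIso (1 : ℤ)).hom.app X ≫ (u.app X)⟦(1 : ℤ)⟧' := by
  have hG := G.map_shiftFunctorCompIsoId_hom_app X (1 : ℤ) (-1) (by simp)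
  have hF := F.map_shiftFunctorCompIsoId_hom_app X (1 : ℤ) (-1) (by simp)
  have hu := u.naturality ((shiftFunctorCompIsoId H (1 : ℤ) (-1) (by simp)).hom.app X)
  have hc := (shiftFunctorCompIsoId D (-1 : ℤ) 1 (by simp)).inv.naturality
    ((F.commShiftIso (1 : ℤ)).hom.app X)
  dsimp at hu hc
  rw [← Functor.map_comp, ← Functor.map_comp, Category.assoc, Category.assoc, ← R.map_comp,
    ← R.map_comp, ← hG, ← hu, hF]
  simp only [Functor.map_comp, Iso.inv_hom_id_app_assoc, Category.assoc]
  rw [← reassoc_of% hc, shift_shiftFunctorCompIsoId_hom_app, Iso.inv_hom_id_app_assoc]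

variable {C : Type u} [Category.{v} C] [Abelian C] [HasDerivedCategory.{w} C]

/-- The shift of bounded below complexes commutes with the localization functor. -/
def QShift (K : CochainComplex.Plus C) : Q.obj (shiftPlus K) ≅ (Q.obj K)⟦(1 : ℤ)⟧ :=
  Qh.mapIso (quotientShift K) ≪≫
    (Qh.commShiftIso (1 : ℤ)).app ((HomotopyCategory.Plus.quotient C).obj K)

lemma QShift_hom (K : CochainComplex.Plus C) :
    (QShift K).hom = Qh.map (quotientShift K).hom ≫
      (Qh.commShiftIso (1 : ℤ)).hom.app ((HomotopyCategory.Plus.quotient C).obj K) := rfl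

lemma QShift_naturality {K L : CochainComplex.Plus C} (φ : K ⟶ L) :
    Q.map (shiftPlusMap φ) ≫ (QShift L).hom = (QShift K).hom ≫ (Q.map φ)⟦(1 : ℤ)⟧' := by
  have h := congr_arg Qh.map (quotientShift_naturality φ)
  rw [Functor.map_comp, Functor.map_comp] at h
  rw [QShift_hom, QShift_hom]
  refine ((reassoc_of% h) _).trans ?_
  refine Eq.trans ?_ (Category.assoc _ _ _).symm
  exact congr_arg (_ ≫ ·) (Functor.commShiftIso_hom_naturality Qh
    ((HomotopyCategory.Plus.quotient C).map φ) (1 : ℤ))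

/-- The comparison with the shift on the unbounded derived category. -/
lemma ι_QShift (K : CochainComplex.Plus C) :
    DerivedCategory.Plus.ι.map (QShift K).hom ≫
        (DerivedCategory.Plus.ι.commShiftIso (1 : ℤ)).hom.app (Q.obj K) =
      (DerivedCategory.Q.commShiftIso (1 : ℤ)).hom.app K.obj := by
  have h₁ := lift_commShiftIso_hom_app DerivedCategory.TStructure.t.plus
    (HomotopyCategory.Plus.ι C ⋙ DerivedCategory.Qh)
    (fun X => (Qh.obj X).property) ((HomotopyCategory.Plus.quotient C).obj K) 1
  rw [Functor.commShiftIso_comp_hom_app] at h₁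
  have h₂ := congr_arg DerivedCategory.Qh.map (ι_quotientShift K)
  rw [Functor.map_comp] at h₂
  have h₃ := NatTrans.shift_app_comm (DerivedCategory.quotientCompQhIso C).hom (1 : ℤ) K.obj
  rw [Functor.commShiftIso_comp_hom_app] at h₃
  have h₅ : (shiftFunctor (DerivedCategory C) (1 : ℤ)).map
    ((DerivedCategory.quotientCompQhIso C).hom.app K.obj) = 𝟙 _ :=
    (shiftFunctor _ _).map_id _
  rw [h₅] at h₃
  refine (DerivedCategory.Plus.ι.map_comp _ _ =≫ _).trans ((Category.assoc _ _ _).trans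
    ((congr_arg (_ ≫ ·) h₁).trans ?_))
  refine (Category.assoc _ _ _).symm.trans ((h₂ =≫ _).trans ?_)
  exact (Category.comp_id _).symm.trans (h₃.trans (Category.id_comp _))

variable {D : Type u₁} [Category.{v₁} D] [Abelian D] [HasDerivedCategory.{w₁} D]
  [EnoughInjectives C] (f : C ⥤ D) [f.Additive]

lemma derivedShift_naturality {X Y : DerivedCategory.Plus C} (φ : X ⟶ Y) :
    f.rightDerivedFunctorPlus.map (φ⟦(1 : ℤ)⟧') ≫ derivedShift f Y =
      derivedShift f X ≫ (f.rightDerivedFunctorPlus.map φ)⟦(1 : ℤ)⟧' := by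
  have h₁ := (f.rightDerivedFunctorPlus.rightDerivedDesc f.rightDerivedFunctorPlusUnit
      (HomotopyCategory.Plus.quasiIso C) _ (shiftUnit f)).naturality (φ⟦(1 : ℤ)⟧')
  have h₂ := congr_arg (fun x => (f.rightDerivedFunctorPlus.map x)⟦(1 : ℤ)⟧')
    ((shiftFunctorCompIsoId (DerivedCategory.Plus C) (1 : ℤ) (-1) (by simp)).hom.naturality φ)
  simp only [Functor.map_comp] at h₂
  unfold derivedShift
  refine (Category.assoc _ _ _).symm.trans ((h₁ =≫ _).trans ((Category.assoc _ _ _).trans ?_))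
  exact (congr_arg (_ ≫ ·) h₂).trans (Category.assoc _ _ _).symm

/-- The characterisation by which `derivedShift` is handled from here on: along the units it is the
identification of `f (X⟦1⟧)` with `(f X)⟦1⟧`. -/
lemma rightDerivedFunctorPlusUnit_derivedShift (X : HomotopyCategory.Plus C) :
    f.rightDerivedFunctorPlusUnit.app (X⟦(1 : ℤ)⟧) ≫
        f.rightDerivedFunctorPlus.map ((Qh.commShiftIso (1 : ℤ)).hom.app X) ≫
        derivedShift f (Qh.obj X) =
      ((f.mapHomotopyCategoryPlus ⋙ Qh).commShiftIso (1 : ℤ)).hom.app X ≫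
        (f.rightDerivedFunctorPlusUnit.app X)⟦(1 : ℤ)⟧' := by
  have h₁ := (f.rightDerivedFunctorPlus.rightDerivedDesc f.rightDerivedFunctorPlusUnit
      (HomotopyCategory.Plus.quasiIso C) _ (shiftUnit f)).naturality
        ((Qh.commShiftIso (1 : ℤ)).hom.app X)
  have h₂ := f.rightDerivedFunctorPlus.rightDerived_fac_app f.rightDerivedFunctorPlusUnit
      (HomotopyCategory.Plus.quasiIso C) _ (shiftUnit f) (X⟦(1 : ℤ)⟧)
  unfold derivedShift
  refine (congr_arg (_ ≫ ·) ((reassoc_of% h₁) _)).trans ?_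
  refine ((reassoc_of% h₂) _).trans ?_
  refine (Category.assoc _ _ _).trans ?_
  exact comp_shift_eq_of_commShift (f.mapHomotopyCategoryPlus ⋙ Qh) Qh
    f.rightDerivedFunctorPlus f.rightDerivedFunctorPlusUnit X

lemma derivedUnit_derivedShift (K : CochainComplex.Plus C) :
    derivedUnit f (shiftPlus K) ≫ f.rightDerivedFunctorPlus.map (QShift K).hom ≫
        derivedShift f (Q.obj K) =
      Q.map (mapShiftPlus f K) ≫ (QShift (f.mapCochainComplexPlus.obj K)).hom ≫
        (derivedUnit f K)⟦(1 : ℤ)⟧' := by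
  have h₁ := rightDerivedFunctorPlusUnit_derivedShift f ((HomotopyCategory.Plus.quotient C).obj K)
  have h₂ := f.rightDerivedFunctorPlusUnit.naturality (quotientShift K).hom
  have h₃ := (Qh.map_comp _ _).symm.trans
    ((congr_arg Qh.map (mapShiftPlus_quotientShift f K)).trans (Qh.map_comp _ _))
  rw [Functor.commShiftIso_comp_hom_app] at h₁
  have h₄ := f.rightDerivedFunctorPlus.map_comp (Qh.map (quotientShift K).hom)
    ((Qh.commShiftIso (1 : ℤ)).hom.app ((HomotopyCategory.Plus.quotient C).obj K))
  refine (congr_arg (_ ≫ ·) ((h₄ =≫ _).trans (Category.assoc _ _ _))).trans ?_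
  refine (((reassoc_of% h₂) _).symm).trans ?_
  refine (congr_arg (_ ≫ ·) (h₁.trans (Category.assoc _ _ _))).trans ?_
  refine ((reassoc_of% h₃) _).symm.trans ?_
  exact congr_arg (_ ≫ ·) (Category.assoc _ _ _).symm

lemma exists_injective_iso (X : DerivedCategory.Plus C) :
    ∃ K : CochainComplex.Plus C, (∀ n, Injective (K.obj.X n)) ∧ Nonempty (Q.obj K ≅ X) := by
  obtain ⟨n, hn⟩ : ∃ n : ℤ, X.IsGE n := by
    obtain ⟨n, hn⟩ := X.property
    exact ⟨n, (DerivedCategory.Plus.isGE_ι_obj_iff X n).1 hn⟩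
  obtain ⟨L, -, e⟩ := DerivedCategory.Plus.exists_injective_nonempty_iso X n
  exact ⟨_, fun i => (L.obj.X i).property, e⟩

/-- Every object is represented by a complex of injectives, whose shift again consists of
injectives; there all units in `derivedUnit_derivedShift` are invertible. -/
instance (X : DerivedCategory.Plus C) : IsIso (derivedShift f X) := by
  obtain ⟨K, hK, ⟨e⟩⟩ := exists_injective_iso X
  have h₁ := derivedUnit_derivedShift f K
  have : ∀ n, Injective ((shiftPlus K).obj.X n) := fun n => hK (n + 1)
  have h₂ : IsIso (derivedUnit f (shiftPlus K) ≫ f.rightDerivedFunctorPlus.map (QShift K).hom ≫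
      derivedShift f (Q.obj K)) := by
    rw [h₁]
    infer_instance
  have h₃ : IsIso (f.rightDerivedFunctorPlus.map (QShift K).hom ≫ derivedShift f (Q.obj K)) :=
    IsIso.of_isIso_comp_left (derivedUnit f (shiftPlus K)) _
  have h₄ : IsIso (derivedShift f (Q.obj K)) :=
    IsIso.of_isIso_comp_left (f.rightDerivedFunctorPlus.map (QShift K).hom) _
  have h₅ : IsIso (f.rightDerivedFunctorPlus.map (e.hom⟦(1 : ℤ)⟧') ≫ derivedShift f X) := by
    rw [derivedShift_naturality]
    infer_instance
  exact IsIso.of_isIso_comp_left (f.rightDerivedFunctorPlus.map (e.hom⟦(1 : ℤ)⟧')) _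

end DerivedShift

open DerivedCategory.Plus (Q Qh homologyFunctor)

/-! ### Cycles of shifted complexes -/

section ShiftCycles

variable {C : Type u} [Category.{v} C] [Abelian C]

/-- The inclusion of the cycles of the shift of a complex. -/
def shiftICycles (K : CochainComplex.Plus C) (n : ℤ) :
    (shiftPlus K).obj.cycles n ⟶ K.obj.X (n + 1) :=
  (shiftPlus K).obj.iCycles n

lemma shiftPlus_d (K : CochainComplex.Plus C) (n : ℤ) :
    (shiftPlus K).obj.d n (n + 1) = -K.obj.d (n + 1) (n + 1 + 1) := by
  simp [shiftPlus]

lemma shiftICycles_d (K : CochainComplex.Plus C) (n : ℤ) :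
    shiftICycles K n ≫ K.obj.d (n + 1) (n + 1 + 1) = 0 := by
  have e : (shiftPlus K).obj.iCycles n ≫ (shiftPlus K).obj.d n (n + 1) = 0 :=
    HomologicalComplex.iCycles_d _ _ _
  rw [← neg_eq_zero, ← Preadditive.comp_neg]
  exact (congr_arg (shiftICycles K n ≫ ·) (shiftPlus_d K n)).symm.trans e

/-- The identification of cycles of the shift of a complex. -/
def shiftCycles (K : CochainComplex.Plus C) (n₀ n₁ : ℤ) (h : 1 + n₀ = n₁) :
    (shiftPlus K).obj.cycles n₀ ⟶ K.obj.cycles n₁ :=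
  K.obj.liftCycles (shiftICycles K n₀ ≫
    (K.obj.shiftFunctorObjXIso 1 n₀ n₁ (by omega)).hom) (n₁ + 1) (by simp) (by
      obtain rfl : n₁ = n₀ + 1 := by omega
      have e : (K.obj.shiftFunctorObjXIso 1 n₀ (n₀ + 1) (by omega)).hom =
        𝟙 (K.obj.X (n₀ + 1)) := rfl
      exact ((congr_arg (_ ≫ ·) e).trans (Category.comp_id _) =≫ _).trans (shiftICycles_d K n₀))

lemma shiftCycles_i (K : CochainComplex.Plus C) (n : ℤ) :
    shiftCycles K n (n + 1) (add_comm _ _) ≫ K.obj.iCycles (n + 1) = shiftICycles K n := by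
  have e : (K.obj.shiftFunctorObjXIso 1 n (n + 1) (by omega)).hom = 𝟙 (K.obj.X (n + 1)) := rfl
  exact (HomologicalComplex.liftCycles_i _ _ _ _ _).trans
    ((congr_arg (_ ≫ ·) e).trans (Category.comp_id _))

end ShiftCycles

/-! ### Cohomology of shifts and connecting morphisms -/

section HomologyShift

variable {C : Type u} [Category.{v} C] [Abelian C] [HasDerivedCategory.{w} C]

/-- The morphism `Hⁿ X ⟶ Hⁿ⁺¹ Y` induced by a morphism `X ⟶ Y⟦1⟧`. -/
def homologyShiftMap {X Y : DerivedCategory.Plus C} (φ : X ⟶ Y⟦(1 : ℤ)⟧) (n₀ n₁ : ℤ)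
    (h : 1 + n₀ = n₁) : (homologyFunctor C n₀).obj X ⟶ (homologyFunctor C n₁).obj Y :=
  (DerivedCategory.homologyFunctor C 0).shiftMap (DerivedCategory.Plus.ι.map φ ≫
    (DerivedCategory.Plus.ι.commShiftIso (1 : ℤ)).hom.app Y) n₀ n₁ h

lemma homologyShiftMap_comp_left {X X' Y : DerivedCategory.Plus C} (a : X ⟶ X')
    (φ : X' ⟶ Y⟦(1 : ℤ)⟧) (n₀ n₁ : ℤ) (h : 1 + n₀ = n₁) :
    homologyShiftMap (a ≫ φ) n₀ n₁ h =
      (homologyFunctor C n₀).map a ≫ homologyShiftMap φ n₀ n₁ h := by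
  unfold homologyShiftMap
  rw [Functor.map_comp, Category.assoc, Functor.shiftMap_comp']
  rfl

lemma homologyShiftMap_comp_right {X Y Y' : DerivedCategory.Plus C} (φ : X ⟶ Y⟦(1 : ℤ)⟧)
    (b : Y ⟶ Y') (n₀ n₁ : ℤ) (h : 1 + n₀ = n₁) :
    homologyShiftMap (φ ≫ b⟦(1 : ℤ)⟧') n₀ n₁ h =
      homologyShiftMap φ n₀ n₁ h ≫ (homologyFunctor C n₁).map b := by
  unfold homologyShiftMap
  rw [Functor.map_comp, Category.assoc, Functor.commShiftIso_hom_naturality, ← Category.assoc,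
    Functor.shiftMap_comp]
  rfl

/-- The identification of the cohomology of the shift of a complex. -/
def homologyShiftIso (K : CochainComplex C ℤ) (n₀ n₁ : ℤ) (h : 1 + n₀ = n₁) :
    (K⟦(1 : ℤ)⟧).homology n₀ ≅ K.homology n₁ :=
  ((HomologicalComplex.homologyFunctor C (.up ℤ) 0).shiftIso 1 n₀ n₁ h).app K

lemma homologyπ_homologyShiftIso (K : CochainComplex C ℤ) (n₀ n₁ : ℤ) (h : 1 + n₀ = n₁)
    (z : (K⟦(1 : ℤ)⟧).cycles n₀ ⟶ K.cycles n₁)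
    (hz : z ≫ K.iCycles n₁ =
      (K⟦(1 : ℤ)⟧).iCycles n₀ ≫ (K.shiftFunctorObjXIso 1 n₀ n₁ (by omega)).hom) :
    (K⟦(1 : ℤ)⟧).homologyπ n₀ ≫ (homologyShiftIso K n₀ n₁ h).hom = z ≫ K.homologyπ n₁ := by
  have h₁ := CochainComplex.liftCycles_shift_homologyπ K ((K⟦(1 : ℤ)⟧).iCycles n₀)
    (n := 1) (n₀ + 1) (by simp) (HomologicalComplex.iCycles_d _ _ _) n₁ h (n₁ + 1) (by simp)
  have h₂ : (K⟦(1 : ℤ)⟧).liftCycles ((K⟦(1 : ℤ)⟧).iCycles n₀) (n₀ + 1) (by simp)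
      (HomologicalComplex.iCycles_d _ _ _) = 𝟙 _ := by
    rw [← cancel_mono ((K⟦(1 : ℤ)⟧).iCycles n₀), HomologicalComplex.liftCycles_i,
      Category.id_comp]
  rw [h₂, Category.id_comp] at h₁
  rw [← Iso.eq_comp_inv, Category.assoc]
  refine h₁.trans (congr_arg (· ≫ _) ?_)
  rw [← cancel_mono (K.iCycles n₁), HomologicalComplex.liftCycles_i, hz]

lemma homologyShiftMap_QShift (K : CochainComplex.Plus C) (n₀ n₁ : ℤ)
    (h : 1 + n₀ = n₁) :
    (homologyIso (shiftPlus K) n₀).hom ≫ homologyShiftMap (QShift K).hom n₀ n₁ h =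
      (homologyShiftIso K.obj n₀ n₁ h).hom ≫ (homologyIso K n₁).hom := by
  have h₂ := DerivedCategory.shiftMap_homologyFunctor_map_Q (𝟙 (K.obj⟦(1 : ℤ)⟧)) n₀ n₁ h
  have h₃ : ShiftedHom.map (𝟙 (K.obj⟦(1 : ℤ)⟧)) (DerivedCategory.Q (C := C)) =
      (DerivedCategory.Q.commShiftIso (1 : ℤ)).hom.app K.obj := by
    simp [ShiftedHom.map]
  have h₄ : (HomologicalComplex.homologyFunctor C (.up ℤ) 0).shiftMap (𝟙 (K.obj⟦(1 : ℤ)⟧))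
      n₀ n₁ h = ((HomologicalComplex.homologyFunctor C (.up ℤ) 0).shiftIso 1 n₀ n₁ h).hom.app
        K.obj := by
    simp [Functor.shiftMap]
  unfold homologyShiftMap
  rw [ι_QShift]
  rw [h₃, h₄] at h₂
  refine (congr_arg (_ ≫ ·) h₂).trans ?_
  have h₅ := Iso.inv_hom_id_app (DerivedCategory.homologyFunctorFactors C n₀) (K.obj⟦(1 : ℤ)⟧)
  exact (Category.assoc _ _ _).symm.trans ((h₅ =≫ _).trans (Category.id_comp _))

lemma cyclesToHomology_homologyShiftMap (K : CochainComplex.Plus C) (n₀ n₁ : ℤ)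
    (h : 1 + n₀ = n₁) :
    cyclesToHomology (shiftPlus K) n₀ ≫ homologyShiftMap (QShift K).hom n₀ n₁ h =
      shiftCycles K n₀ n₁ h ≫ cyclesToHomology K n₁ := by
  rw [cyclesToHomology_eq, cyclesToHomology_eq, Category.assoc, homologyShiftMap_QShift]
  have h₁ := homologyπ_homologyShiftIso K.obj n₀ n₁ h (shiftCycles K n₀ n₁ h)
    (HomologicalComplex.liftCycles_i _ _ _ _ _)
  exact (Category.assoc _ _ _).symm.trans ((h₁ =≫ _).trans (Category.assoc _ _ _))

/-- The mapping cone of the first morphism of a short exact sequence, as a bounded below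
complex. -/
def sesCone (S : ShortComplex C) : CochainComplex.Plus C :=
  ⟨CochainComplex.mappingCone
    (S.map (HomologicalComplex.single C (ComplexShape.up ℤ) 0)).f, -1, by
      have h (X : C) : CochainComplex.IsStrictlyGE
          ((HomologicalComplex.single C (ComplexShape.up ℤ) 0).obj X) 0 := by
        rw [CochainComplex.isStrictlyGE_iff]
        exact fun i hi => HomologicalComplex.isZero_single_obj_X _ _ _ _ (by omega)
      have := h S.X₁
      have := h S.X₂
      exact CochainComplex.isStrictlyGE_mappingCone
        ((HomologicalComplex.single C (ComplexShape.up ℤ) 0).map S.f) 0 0 (-1)⟩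

/-- The morphism from the mapping cone to the third term of a short exact sequence. -/
def sesConeDesc (S : ShortComplex C) : sesCone S ⟶ (single C).obj S.X₃ :=
  ObjectProperty.homMk (CochainComplex.mappingCone.descShortComplex _)

/-- The morphism from the mapping cone to the shift of the first term of a short exact sequence. -/
def sesConeδ (S : ShortComplex C) : sesCone S ⟶ shiftPlus ((single C).obj S.X₁) :=
  ObjectProperty.homMk (CochainComplex.mappingCone.triangle
    (S.map (HomologicalComplex.single C (ComplexShape.up ℤ) 0)).f).mor₃

lemma isIso_Q_map_sesConeDesc {S : ShortComplex C} (hS : S.ShortExact) :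
    IsIso (Q.map (sesConeDesc S)) :=
  isIso_Q_map _ (CochainComplex.mappingCone.quasiIso_descShortComplex
    (hS.map_of_exact (HomologicalComplex.single C (ComplexShape.up ℤ) 0)))

lemma ι_derivedδ {S : ShortComplex C} (hS : S.ShortExact) :
    DerivedCategory.Plus.ι.map (derivedδ hS) ≫
        (DerivedCategory.Plus.ι.commShiftIso (1 : ℤ)).hom.app (Q.obj ((single C).obj S.X₁)) =
      DerivedCategory.triangleOfSESδ
        (hS.map_of_exact (HomologicalComplex.single C (ComplexShape.up ℤ) 0)) := by
  have h := Iso.inv_hom_id_app (DerivedCategory.Plus.ι.commShiftIso (1 : ℤ))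
    (Q.obj ((single C).obj S.X₁))
  exact (Category.assoc _ _ _).trans ((congr_arg (_ ≫ ·) h).trans (Category.comp_id _))

/-- The connecting morphism is the roof `X₃ ← cone ⟶ X₁⟦1⟧`. As the first arrow is a
quasi-isomorphism, identities about it become identities between morphisms of complexes. -/
lemma sesConeDesc_derivedδ {S : ShortComplex C} (hS : S.ShortExact) :
    Q.map (sesConeDesc S) ≫ derivedδ hS =
      Q.map (sesConeδ S) ≫ (QShift ((single C).obj S.X₁)).hom := by
  apply DerivedCategory.Plus.ι.map_injective
  rw [← cancel_mono ((DerivedCategory.Plus.ι.commShiftIso (1 : ℤ)).hom.app _), Functor.map_comp,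
    Functor.map_comp, Category.assoc, Category.assoc, ι_QShift]
  have h := DerivedCategory.descShortComplex_triangleOfSESδ
    (hS.map_of_exact (HomologicalComplex.single C (ComplexShape.up ℤ) 0))
  exact (congr_arg (_ ≫ ·) (ι_derivedδ hS)).trans h

end HomologyShift

open DerivedCategory.Plus (Q Qh homologyFunctor)

/-! ### Shifting the first factor of a tensor product -/

section TensorShift

variable {C : Type u} [Category.{v} C] [Abelian C] [MonoidalCategory C] [MonoidalPreadditive C]

/-- This explains why `tensorShift` needs no sign: the differential of `K⟦1⟧` is `-d`, and lowering
the degree of the first factor by one changes the sign of the second term of the differential, so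
both terms change sign together. -/
lemma neg_add_negOnePow_smul {X : Type*} [AddCommGroup X] (x y : X) (p : ℤ) :
    -x + p.negOnePow • y = -(x + (p + 1).negOnePow • y) := by
  rw [Int.negOnePow_succ, neg_add, Units.neg_smul, neg_neg]

/-- The morphism `K⟦1⟧ ⊗ L ⟶ (K ⊗ L)⟦1⟧` which is the identity on summands. -/
def tensorShift (K L : CochainComplex.Plus C) :
    tensorComplex (shiftPlus K) L ⟶ shiftPlus (tensorComplex K L) :=
  ObjectProperty.homMk
    { f n := tensorComplex.desc fun p q h =>
        tensorComplex.inc K L (p + 1) q (n + 1) (by omega)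
      comm' n n' hn := by
        refine tensorComplex.hom_ext fun p q h => ?_
        obtain rfl : n + 1 = n' := hn
        have h₁ := tensorComplex.inc_desc (K := shiftPlus K) (L := L) (n := n)
          (fun p q h => tensorComplex.inc K L (p + 1) q (n + 1) (by omega)) p q h
        have h₂ := tensorComplex.inc_d (shiftPlus K) L p q n h (p + 1) (q + 1) (n + 1) rfl rfl rfl
        have h₃ := tensorComplex.inc_d K L (p + 1) q (n + 1) (by omega) (p + 1 + 1) (q + 1)
          (n + 1 + 1) rfl rfl rfl
        have h₄ := tensorComplex.inc_desc (K := shiftPlus K) (L := L) (n := n + 1)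
          (fun p q h => tensorComplex.inc K L (p + 1) q (n + 1 + 1) (by omega)) (p + 1) q (by omega)
        have h₅ := tensorComplex.inc_desc (K := shiftPlus K) (L := L) (n := n + 1)
          (fun p q h => tensorComplex.inc K L (p + 1) q (n + 1 + 1) (by omega)) p (q + 1) (by omega)
        have h₆ : ((shiftPlus K).obj.d p (p + 1) ▷ L.obj.X q) ≫
            tensorComplex.inc K L (p + 1 + 1) q (n + 1 + 1) (by omega) =
            -(K.obj.d (p + 1) (p + 1 + 1) ▷ L.obj.X q ≫
              tensorComplex.inc K L (p + 1 + 1) q (n + 1 + 1) (by omega)) := by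
          rw [← Preadditive.neg_comp]
          refine congr_arg (· ≫ _) ?_
          exact (congr_arg (· ▷ L.obj.X q) (shiftPlus_d K p)).trans
            ((tensorRight (L.obj.X q)).map_neg)
        refine (Category.assoc _ _ _).symm.trans ((h₁ =≫ _).trans ?_)
        refine (congr_arg (_ ≫ ·) (shiftPlus_d (tensorComplex K L) n)).trans ?_
        refine (Preadditive.comp_neg _ _).trans ((congr_arg Neg.neg h₃).trans ?_)
        refine Eq.symm ((Category.assoc _ _ _).symm.trans ((h₂ =≫ _).trans
          ((Preadditive.add_comp _ _ _ _ _ _).trans ?_)))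
        refine (congr_arg₂ (· + ·) ((Category.assoc _ _ _).trans ((congr_arg (_ ≫ ·) h₄).trans h₆))
          ((Linear.units_smul_comp _ _ _).trans (congr_arg (p.negOnePow • ·)
            ((Category.assoc _ _ _).trans (congr_arg (_ ≫ ·) h₅))))).trans ?_
        exact neg_add_negOnePow_smul _ _ p }

lemma inc_tensorShift (K L : CochainComplex.Plus C) (p q n : ℤ) (h : p + q = n) :
    tensorComplex.inc (shiftPlus K) L p q n h ≫ (tensorShift K L).hom.f n =
      tensorComplex.inc K L (p + 1) q (n + 1) (by omega) :=
  tensorComplex.inc_desc (K := shiftPlus K) (L := L) (n := n)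
    (fun p q h => tensorComplex.inc K L (p + 1) q (n + 1) (by omega)) p q h

lemma tensorShift_naturality {K K' L L' : CochainComplex.Plus C} (a : K ⟶ K') (b : L ⟶ L') :
    tensorComplex.map (shiftPlusMap a) b ≫ tensorShift K' L' =
      tensorShift K L ≫ shiftPlusMap (tensorComplex.map a b) := by
  ext n
  refine tensorComplex.hom_ext fun p q h => ?_
  have h₁ := tensorComplex.inc_map (shiftPlusMap a) b p q n h
  have h₂ := tensorComplex.inc_map a b (p + 1) q (n + 1) (by omega)
  refine ((reassoc_of% h₁) _).trans ((congr_arg (_ ≫ ·) (inc_tensorShift K' L' p q n h)).trans ?_)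
  exact h₂.symm.trans (((inc_tensorShift K L p q n h) =≫ _).symm.trans (Category.assoc _ _ _))

variable [HasDerivedCategory.{w} C]

lemma cyclesTensor_tensorShift (K L : CochainComplex.Plus C) (p p' q n n' : ℤ) (h : p + q = n)
    (hp : 1 + p = p') (hn : 1 + n = n') :
    cyclesTensor (shiftPlus K) L p q n h ≫
        HomologicalComplex.cyclesMap (tensorShift K L).hom n ≫
        shiftCycles (tensorComplex K L) n n' hn =
      shiftCycles K p p' hp ▷ L.obj.cycles q ≫ cyclesTensor K L p' q n' (by omega) := by
  obtain rfl : p' = p + 1 := by omega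
  obtain rfl : n' = n + 1 := by omega
  rw [← cancel_mono ((tensorComplex K L).obj.iCycles (n + 1)), Category.assoc, Category.assoc,
    Category.assoc, cyclesTensor_i, shiftCycles_i]
  have h₁ : HomologicalComplex.cyclesMap (tensorShift K L).hom n ≫
      shiftICycles (tensorComplex K L) n =
      (tensorComplex (shiftPlus K) L).obj.iCycles n ≫ (tensorShift K L).hom.f n :=
    HomologicalComplex.cyclesMap_i _ _
  rw [h₁]
  refine (Category.assoc _ _ _).symm.trans (((cyclesTensor_i (shiftPlus K) L p q n h) =≫ _).trans
    ((Category.assoc _ _ _).trans ((congr_arg (_ ≫ ·) (inc_tensorShift K L p q n h)).trans ?_)))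
  rw [← Category.assoc]
  refine congr_arg (· ≫ tensorComplex.inc K L (p + 1) q (n + 1) (by omega)) ?_
  have h₂ : shiftCycles K p (p + 1) hp ▷ L.obj.cycles q ≫
      (K.obj.iCycles (p + 1) ⊗ₘ L.obj.iCycles q) =
      (shiftICycles K p ⊗ₘ L.obj.iCycles q) := by
    rw [MonoidalCategory.tensorHom_def, ← comp_whiskerRight_assoc, shiftCycles_i,
      ← MonoidalCategory.tensorHom_def]
  exact h₂.symm

variable [HasDerivedTensor C]

section

variable [SymmetricCategory C] [∀ X : C, PreservesFiniteColimits (tensorLeft X)]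
  [hC : Fact (HasFiniteTorDimension C)] {E : Type u₁} [Category.{v₁} E]
  {G : DerivedCategory.Plus C × DerivedCategory.Plus C ⥤ E} {N : DerivedCategory.Plus C ⥤ E}

/-- Natural transformations with values in a functor of the derived tensor product are determined
by their values on complexes. -/
lemma derivedTensor_hom_ext {γ₁ γ₂ : G ⟶ derivedTensor C ⋙ N}
    (h : ∀ K L : CochainComplex.Plus C,
      γ₁.app (Q.obj K, Q.obj L) ≫ N.map (toTensor K L) =
        γ₂.app (Q.obj K, Q.obj L) ≫ N.map (toTensor K L)) : γ₁ = γ₂ := by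
  refine (derivedTensor C ⋙ N).leftDerived_ext (derivedTensorCounitComp N)
    ((CochainComplex.Plus.quasiIso C).prod (CochainComplex.Plus.quasiIso C)) _ _ _ ?_
  ext K
  exact h K.1 K.2

/-- Constructor for natural transformations with values in a functor of the derived tensor
product. -/
lemma exists_derivedTensor_lift
    (b : ∀ K L : CochainComplex.Plus C, G.obj (Q.obj K, Q.obj L) ⟶ N.obj (Q.obj (tensorComplex K L)))
    (hb : ∀ {K K' L L' : CochainComplex.Plus C} (k : K ⟶ K') (l : L ⟶ L'),
      G.map (Prod.mkHom (Q.map k) (Q.map l)) ≫ b K' L' =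
        b K L ≫ N.map (Q.map (tensorComplex.map k l))) :
    ∃ γ : G ⟶ derivedTensor C ⋙ N, ∀ K L : CochainComplex.Plus C,
      γ.app (Q.obj K, Q.obj L) ≫ N.map (toTensor K L) = b K L := by
  let β : (Q (C := C)).prod (Q (C := C)) ⋙ G ⟶ tensorComplexFunctor C ⋙ Q ⋙ N :=
    { app K := b K.1 K.2
      naturality _ _ φ := hb φ.1 φ.2 }
  exact ⟨(derivedTensor C ⋙ N).leftDerivedLift (derivedTensorCounitComp N)
    ((CochainComplex.Plus.quasiIso C).prod (CochainComplex.Plus.quasiIso C)) _ β,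
    fun K L => (derivedTensor C ⋙ N).leftDerived_fac_app (derivedTensorCounitComp N)
      ((CochainComplex.Plus.quasiIso C).prod (CochainComplex.Plus.quasiIso C)) _ β (K, L)⟩

variable (C) in
lemma exists_derivedTensorShift :
    ∃ σ : (shiftFunctor (DerivedCategory.Plus C) (1 : ℤ)).prod (𝟭 (DerivedCategory.Plus C)) ⋙
        derivedTensor C ⟶ derivedTensor C ⋙ shiftFunctor (DerivedCategory.Plus C) (1 : ℤ),
      ∀ K L : CochainComplex.Plus C,
        σ.app (Q.obj K, Q.obj L) ≫ (toTensor K L)⟦(1 : ℤ)⟧' =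
          derivedTensorMap (QShift K).inv (𝟙 (Q.obj L)) ≫ toTensor (shiftPlus K) L ≫
            Q.map (tensorShift K L) ≫ (QShift (tensorComplex K L)).hom := by
  refine exists_derivedTensor_lift (N := shiftFunctor (DerivedCategory.Plus C) (1 : ℤ)) _ ?_
  intro K K' L L' k l
  have h₁ : derivedTensorMap ((Q.map k)⟦(1 : ℤ)⟧') (Q.map l) ≫
      derivedTensorMap (QShift K').inv (𝟙 (Q.obj L')) =
      derivedTensorMap (QShift K).inv (𝟙 (Q.obj L)) ≫
        derivedTensorMap (Q.map (shiftPlusMap k)) (Q.map l) := by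
    rw [derivedTensorMap_comp, derivedTensorMap_comp, Category.comp_id, Category.id_comp]
    congr 1
    rw [Iso.comp_inv_eq, Category.assoc, QShift_naturality, Iso.inv_hom_id_assoc]
  refine ((reassoc_of% h₁) _).trans ?_
  rw [reassoc_of% (toTensor_naturality (shiftPlusMap k) l), ← Q.map_comp_assoc,
    tensorShift_naturality, Q.map_comp_assoc, QShift_naturality]
  simp only [Category.assoc]

/-- The morphism `X⟦1⟧ ⊗ᴸ Y ⟶ (X ⊗ᴸ Y)⟦1⟧`. -/
def derivedTensorShift (X Y : DerivedCategory.Plus C) :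
    derivedTensorObj (X⟦(1 : ℤ)⟧) Y ⟶ (derivedTensorObj X Y)⟦(1 : ℤ)⟧ :=
  (exists_derivedTensorShift C).choose.app (X, Y)

lemma derivedTensorShift_naturality {X X' Y Y' : DerivedCategory.Plus C} (a : X ⟶ X')
    (b : Y ⟶ Y') :
    derivedTensorMap (a⟦(1 : ℤ)⟧') b ≫ derivedTensorShift X' Y' =
      derivedTensorShift X Y ≫ (derivedTensorMap a b)⟦(1 : ℤ)⟧' :=
  (exists_derivedTensorShift C).choose.naturality (Prod.mkHom a b)

lemma derivedTensorShift_toTensor (K L : CochainComplex.Plus C) :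
    derivedTensorMap (QShift K).hom (𝟙 (Q.obj L)) ≫ derivedTensorShift (Q.obj K) (Q.obj L) ≫
        (toTensor K L)⟦(1 : ℤ)⟧' =
      toTensor (shiftPlus K) L ≫ Q.map (tensorShift K L) ≫ (QShift (tensorComplex K L)).hom := by
  have h := (exists_derivedTensorShift C).choose_spec K L
  refine (congr_arg (_ ≫ ·) h).trans ?_
  rw [← Category.assoc, derivedTensorMap_comp, Iso.hom_inv_id, Category.comp_id,
    derivedTensorMap_id, Category.id_comp]

end

end TensorShift

open DerivedCategory.Plus (Q Qh homologyFunctor)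

/-! ### The exterior product and shifts -/

section PairingShift

variable {C : Type u} [Category.{v} C] [Abelian C] [MonoidalCategory C] [MonoidalPreadditive C]
  [HasDerivedCategory.{w} C] [HasDerivedTensor C]

/-- The components of a homology pairing. -/
def HomologyPairing.hom (α : HomologyPairing (C := C)) (p q n : ℤ) (h : p + q = n)
    (X Y : DerivedCategory.Plus C) :
    (homologyFunctor C p).obj X ⊗ (homologyFunctor C q).obj Y ⟶
      (homologyFunctor C n).obj (derivedTensorObj X Y) :=
  (α p q n h).app (X, Y)

lemma HomologyPairing.hom_naturality (α : HomologyPairing (C := C)) (p q n : ℤ) (h : p + q = n)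
    {X X' Y Y' : DerivedCategory.Plus C} (a : X ⟶ X') (b : Y ⟶ Y') :
    ((homologyFunctor C p).map a ⊗ₘ (homologyFunctor C q).map b) ≫ α.hom p q n h X' Y' =
      α.hom p q n h X Y ≫ (homologyFunctor C n).map (derivedTensorMap a b) :=
  (α p q n h).naturality (Prod.mkHom a b)

lemma HomologyPairing.IsCanonical.cyclesToHomology_hom {α : HomologyPairing (C := C)}
    (hα : α.IsCanonical) (K L : CochainComplex.Plus C) (p q n : ℤ) (h : p + q = n) :
    (cyclesToHomology K p ⊗ₘ cyclesToHomology L q) ≫ α.hom p q n h (Q.obj K) (Q.obj L) ≫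
        (homologyFunctor C n).map (toTensor K L) =
      cyclesTensor K L p q n h ≫ cyclesToHomology (tensorComplex K L) n :=
  hα p q n h K L

variable [SymmetricCategory C] [∀ X : C, PreservesFiniteColimits (tensorLeft X)]
  [hC : Fact (HasFiniteTorDimension C)]

lemma homologyFunctor_map_homologyShiftMap_id {X Y : DerivedCategory.Plus C} (a : X ⟶ Y)
    (n₀ n₁ : ℤ) (h : 1 + n₀ = n₁) :
    (homologyFunctor C n₀).map (a⟦(1 : ℤ)⟧') ≫ homologyShiftMap (𝟙 (Y⟦(1 : ℤ)⟧)) n₀ n₁ h =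
      homologyShiftMap (𝟙 (X⟦(1 : ℤ)⟧)) n₀ n₁ h ≫ (homologyFunctor C n₁).map a := by
  rw [← homologyShiftMap_comp_left, ← homologyShiftMap_comp_right, Category.comp_id,
    Category.id_comp]

/-- The exterior product commutes with shifts, for complexes. -/
lemma HomologyPairing.IsCanonical.hom_homologyShiftMap_Q {α : HomologyPairing (C := C)}
    (hα : α.IsCanonical) (K L : CochainComplex.Plus C) (p p' q n n' : ℤ) (h : p + q = n)
    (h' : p' + q = n') (hp : 1 + p = p') (hn : 1 + n = n') :
    (α.hom p q n h ((Q.obj K)⟦(1 : ℤ)⟧) (Q.obj L) ≫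
        homologyShiftMap (derivedTensorShift (Q.obj K) (Q.obj L)) n n' hn) ≫
        (homologyFunctor C n').map (toTensor K L) =
      (homologyShiftMap (𝟙 ((Q.obj K)⟦(1 : ℤ)⟧)) p p' hp ▷ (homologyFunctor C q).obj (Q.obj L) ≫
        α.hom p' q n' h' (Q.obj K) (Q.obj L)) ≫ (homologyFunctor C n').map (toTensor K L) := by
  have hQ : Epi ((homologyFunctor C p).map (QShift K).hom) := inferInstance
  have : Epi (((cyclesToHomology (shiftPlus K) p ≫ (homologyFunctor C p).map (QShift K).hom)) ⊗ₘ
    cyclesToHomology L q) := epi_tensorHom _ _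
  rw [← cancel_epi (((cyclesToHomology (shiftPlus K) p ≫
    (homologyFunctor C p).map (QShift K).hom)) ⊗ₘ cyclesToHomology L q)]
  have h₁ : ((cyclesToHomology (shiftPlus K) p ≫ (homologyFunctor C p).map (QShift K).hom) ⊗ₘ
      cyclesToHomology L q) ≫ α.hom p q n h ((Q.obj K)⟦(1 : ℤ)⟧) (Q.obj L) =
      (cyclesToHomology (shiftPlus K) p ⊗ₘ cyclesToHomology L q) ≫
        α.hom p q n h (Q.obj (shiftPlus K)) (Q.obj L) ≫
          (homologyFunctor C n).map (derivedTensorMap (QShift K).hom (𝟙 (Q.obj L))) := by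
    rw [← HomologyPairing.hom_naturality, ← Category.assoc,
      MonoidalCategory.tensorHom_comp_tensorHom, CategoryTheory.Functor.map_id, Category.comp_id]
  have h₂ : (cyclesToHomology (shiftPlus K) p ≫ (homologyFunctor C p).map (QShift K).hom) ≫
      homologyShiftMap (𝟙 ((Q.obj K)⟦(1 : ℤ)⟧)) p p' hp =
      shiftCycles K p p' hp ≫ cyclesToHomology K p' := by
    rw [Category.assoc, ← homologyShiftMap_comp_left, Category.comp_id,
      cyclesToHomology_homologyShiftMap]
  have h₃ : (homologyFunctor C n).map (derivedTensorMap (QShift K).hom (𝟙 (Q.obj L))) ≫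
      homologyShiftMap (derivedTensorShift (Q.obj K) (Q.obj L)) n n' hn ≫
        (homologyFunctor C n').map (toTensor K L) =
      (homologyFunctor C n).map (toTensor (shiftPlus K) L) ≫
        (homologyFunctor C n).map (Q.map (tensorShift K L)) ≫
          homologyShiftMap (QShift (tensorComplex K L)).hom n n' hn := by
    rw [← homologyShiftMap_comp_right, ← homologyShiftMap_comp_left,
      ← homologyShiftMap_comp_left, ← homologyShiftMap_comp_left, derivedTensorShift_toTensor]
  have h₄ : (((cyclesToHomology (shiftPlus K) p ≫ (homologyFunctor C p).map (QShift K).hom)) ⊗ₘ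
      cyclesToHomology L q) ≫ (homologyShiftMap (𝟙 ((Q.obj K)⟦(1 : ℤ)⟧)) p p' hp ▷
        (homologyFunctor C q).obj (Q.obj L)) =
      shiftCycles K p p' hp ▷ L.obj.cycles q ≫
        (cyclesToHomology K p' ⊗ₘ cyclesToHomology L q) := by
    rw [MonoidalCategory.tensorHom_comp_whiskerRight, h₂,
      MonoidalCategory.whiskerRight_comp_tensorHom]
  rw [Category.assoc, Category.assoc, reassoc_of% h₁, h₃, reassoc_of% h₄,
    hα.cyclesToHomology_hom,
    reassoc_of% (hα.cyclesToHomology_hom (shiftPlus K) L p q n h),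
    ← reassoc_of% (cyclesToHomology_naturality (tensorShift K L) n),
    cyclesToHomology_homologyShiftMap,
    ← reassoc_of% (cyclesTensor_tensorShift K L p p' q n n' h hp hn)]

/-- The exterior product commutes with shifts. -/
lemma HomologyPairing.IsCanonical.hom_homologyShiftMap_id {α : HomologyPairing (C := C)}
    (hα : α.IsCanonical) (X Y : DerivedCategory.Plus C) (p p' q n n' : ℤ) (h : p + q = n)
    (h' : p' + q = n') (hp : 1 + p = p') (hn : 1 + n = n') :
    α.hom p q n h (X⟦(1 : ℤ)⟧) Y ≫ homologyShiftMap (derivedTensorShift X Y) n n' hn =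
      homologyShiftMap (𝟙 (X⟦(1 : ℤ)⟧)) p p' hp ▷ (homologyFunctor C q).obj Y ≫
        α.hom p' q n' h' X Y := by
  -- Both sides are natural in `X` and `Y` with values in the cohomology of `X ⊗ᴸ Y`, so
  -- `derivedTensor_hom_ext` reduces the identity to complexes.
  let G : DerivedCategory.Plus C × DerivedCategory.Plus C ⥤ C :=
    (shiftFunctor (DerivedCategory.Plus C) (1 : ℤ) ⋙ homologyFunctor C p).prod
      (homologyFunctor C q) ⋙ tensor C
  let γ₁ : G ⟶ derivedTensor C ⋙ homologyFunctor C n' :=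
    { app X := α.hom p q n h (X.1⟦(1 : ℤ)⟧) X.2 ≫
        homologyShiftMap (derivedTensorShift X.1 X.2) n n' hn
      naturality X Y φ := by
        refine ((reassoc_of% (α.hom_naturality p q n h (φ.1⟦(1 : ℤ)⟧') φ.2)) _).trans ?_
        rw [← homologyShiftMap_comp_left, derivedTensorShift_naturality,
          homologyShiftMap_comp_right]
        exact (Category.assoc _ _ _).symm }
  let γ₂ : G ⟶ derivedTensor C ⋙ homologyFunctor C n' :=
    { app X := homologyShiftMap (𝟙 (X.1⟦(1 : ℤ)⟧)) p p' hp ▷ (homologyFunctor C q).obj X.2 ≫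
        α.hom p' q n' h' X.1 X.2
      naturality X Y φ := by
        have h₁ : ((homologyFunctor C p).map (φ.1⟦(1 : ℤ)⟧') ⊗ₘ (homologyFunctor C q).map φ.2) ≫
            homologyShiftMap (𝟙 (Y.1⟦(1 : ℤ)⟧)) p p' hp ▷ (homologyFunctor C q).obj Y.2 =
            homologyShiftMap (𝟙 (X.1⟦(1 : ℤ)⟧)) p p' hp ▷ (homologyFunctor C q).obj X.2 ≫
              ((homologyFunctor C p').map φ.1 ⊗ₘ (homologyFunctor C q).map φ.2) := by
          rw [MonoidalCategory.tensorHom_comp_whiskerRight,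
            homologyFunctor_map_homologyShiftMap_id,
            MonoidalCategory.whiskerRight_comp_tensorHom]
        refine ((reassoc_of% h₁) _).trans ?_
        rw [α.hom_naturality]
        exact (Category.assoc _ _ _).symm }
  have hγ : γ₁ = γ₂ := derivedTensor_hom_ext fun K L =>
    hα.hom_homologyShiftMap_Q K L p p' q n n' h h' hp hn
  exact NatTrans.congr_app hγ (X, Y)

/-- The exterior product commutes with connecting morphisms in the first variable. -/
lemma HomologyPairing.IsCanonical.hom_homologyShiftMap {α : HomologyPairing (C := C)}
    (hα : α.IsCanonical) {X X' : DerivedCategory.Plus C} (φ : X ⟶ X'⟦(1 : ℤ)⟧)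
    (Y : DerivedCategory.Plus C) (p p' q n n' : ℤ) (h : p + q = n)
    (h' : p' + q = n') (hp : 1 + p = p') (hn : 1 + n = n') :
    α.hom p q n h X Y ≫
        homologyShiftMap (derivedTensorMap φ (𝟙 Y) ≫ derivedTensorShift X' Y) n n' hn =
      homologyShiftMap φ p p' hp ▷ (homologyFunctor C q).obj Y ≫ α.hom p' q n' h' X' Y := by
  rw [homologyShiftMap_comp_left, ← reassoc_of% (α.hom_naturality p q n h φ (𝟙 Y)),
    hα.hom_homologyShiftMap_id X' Y p p' q n n' h h' hp hn, CategoryTheory.Functor.map_id,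
    MonoidalCategory.tensorHom_id, ← comp_whiskerRight_assoc, ← homologyShiftMap_comp_left,
    Category.comp_id]

end PairingShift

open DerivedCategory.Plus (Q Qh homologyFunctor)

/-! ### Cup-pairings of shifted complexes -/

section CupComplexShift

variable {A : Type u₁} [Category.{v₁} A] [Abelian A] [MonoidalCategory A] [MonoidalPreadditive A]
  {B : Type u₂} [Category.{v₂} B] [Abelian B] [MonoidalCategory B] [MonoidalPreadditive B]
  {f g h : A ⥤ B} [f.Additive] [g.Additive] [h.Additive] (π : CupPairing f g h)

/-- On every summand both sides are `π` followed by the inclusion of that summand; no sign occurs,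
as `tensorShift` has none. -/
lemma cupComplex_tensorShift (K L : CochainComplex.Plus A) :
    tensorComplex.map (mapShiftPlus f K) (𝟙 (g.mapCochainComplexPlus.obj L)) ≫
        tensorShift (f.mapCochainComplexPlus.obj K) (g.mapCochainComplexPlus.obj L) ≫
        shiftPlusMap (cupComplex π K L) =
      cupComplex π (shiftPlus K) L ≫ h.mapCochainComplexPlus.map (tensorShift K L) ≫
        mapShiftPlus h (tensorComplex K L) := by
  ext n
  refine tensorComplex.hom_ext fun p q hpq => ?_
  have h₁ := tensorComplex.inc_map (mapShiftPlus f K) (𝟙 (g.mapCochainComplexPlus.obj L)) p q n hpq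
  have h₂ := inc_tensorShift (f.mapCochainComplexPlus.obj K) (g.mapCochainComplexPlus.obj L) p q n
    hpq
  have h₃ := inc_cupComplex π K L (p + 1) q (n + 1) (by omega)
  have h₄ := inc_cupComplex π (shiftPlus K) L p q n hpq
  have h₅ := congr_arg h.map (inc_tensorShift K L p q n hpq)
  have h₆ : ((mapShiftPlus f K).hom.f p ⊗ₘ
      (𝟙 (g.mapCochainComplexPlus.obj L) : g.mapCochainComplexPlus.obj L ⟶ _).hom.f q) =
      𝟙 (f.obj (K.obj.X (p + 1)) ⊗ g.obj (L.obj.X q)) := id_tensorHom_id _ _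
  refine ((reassoc_of% h₁) _).trans ?_
  refine (h₆ =≫ _).trans ((Category.id_comp _).trans ?_)
  refine ((reassoc_of% h₂) _).trans (h₃.trans (Eq.symm ?_))
  refine ((reassoc_of% h₄) _).trans ((Category.assoc _ _ _).trans (congr_arg (_ ≫ ·) ?_))
  refine (congr_arg (_ ≫ ·) ?_).trans ((h.map_comp _ _).symm.trans h₅)
  exact Category.comp_id _

end CupComplexShift

/-! ### The derived cup product and shifts -/

section DerivedCupShift

variable {A : Type u₁} [Category.{v₁} A] [Abelian A] [MonoidalCategory A] [MonoidalPreadditive A]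
  [HasDerivedCategory.{w₁} A] [EnoughInjectives A] [HasDerivedTensor A]
  {B : Type u₂} [Category.{v₂} B] [Abelian B] [MonoidalCategory B] [MonoidalPreadditive B]
  [HasDerivedCategory.{w₂} B] [HasDerivedTensor B]
  {f g h : A ⥤ B} [f.Additive] [g.Additive] [h.Additive]

/-- The components of a derived cup-pairing. -/
def DerivedCupPairing.hom (Φ : DerivedCupPairing f g h) (X Y : DerivedCategory.Plus A) :
    derivedTensorObj (f.rightDerivedFunctorPlus.obj X) (g.rightDerivedFunctorPlus.obj Y) ⟶
      h.rightDerivedFunctorPlus.obj (derivedTensorObj X Y) :=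
  Φ.app (X, Y)

lemma DerivedCupPairing.hom_naturality (Φ : DerivedCupPairing f g h)
    {X X' Y Y' : DerivedCategory.Plus A} (a : X ⟶ X') (b : Y ⟶ Y') :
    derivedTensorMap (f.rightDerivedFunctorPlus.map a) (g.rightDerivedFunctorPlus.map b) ≫
        Φ.hom X' Y' =
      Φ.hom X Y ≫ h.rightDerivedFunctorPlus.map (derivedTensorMap a b) :=
  Φ.naturality (Prod.mkHom a b)

variable {π : CupPairing f g h} {Φ : DerivedCupPairing f g h}

lemma DerivedCupPairing.Extends.derivedUnit_hom (hΦ : Φ.Extends π) (K L : CochainComplex.Plus A) :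
    derivedTensorMap (derivedUnit f K) (derivedUnit g L) ≫ Φ.hom (Q.obj K) (Q.obj L) ≫
        h.rightDerivedFunctorPlus.map (toTensor K L) =
      toTensor (f.mapCochainComplexPlus.obj K) (g.mapCochainComplexPlus.obj L) ≫
        Q.map (cupComplex π K L) ≫ derivedUnit h (tensorComplex K L) :=
  hΦ K L

variable [SymmetricCategory A] [∀ X : A, PreservesFiniteColimits (tensorLeft X)]
  [SymmetricCategory B] [∀ X : B, PreservesFiniteColimits (tensorLeft X)]
  [hB : Fact (HasFiniteTorDimension B)] [hA : Fact (HasFiniteTorDimension A)]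

/-- The compatibility of the derived cup product with shifts, for complexes. -/
lemma DerivedCupPairing.Extends.derivedShift_Q (hΦ : Φ.Extends π) (K L : CochainComplex.Plus A) :
    derivedTensorMap (derivedUnit f (shiftPlus K) ≫ f.rightDerivedFunctorPlus.map (QShift K).hom)
        (derivedUnit g L) ≫
      (Φ.hom ((Q.obj K)⟦(1 : ℤ)⟧) (Q.obj L) ≫
        h.rightDerivedFunctorPlus.map (derivedTensorShift (Q.obj K) (Q.obj L)) ≫
        derivedShift h (derivedTensorObj (Q.obj K) (Q.obj L))) ≫
      (h.rightDerivedFunctorPlus.map (toTensor K L))⟦(1 : ℤ)⟧' =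
    derivedTensorMap (Q.map (mapShiftPlus f K) ≫ (QShift (f.mapCochainComplexPlus.obj K)).hom)
        (𝟙 (Q.obj (g.mapCochainComplexPlus.obj L))) ≫
      derivedTensorMap ((derivedUnit f K)⟦(1 : ℤ)⟧') (derivedUnit g L) ≫
      (derivedTensorShift (f.rightDerivedFunctorPlus.obj (Q.obj K))
          (g.rightDerivedFunctorPlus.obj (Q.obj L)) ≫
        (Φ.hom (Q.obj K) (Q.obj L))⟦(1 : ℤ)⟧') ≫
      (h.rightDerivedFunctorPlus.map (toTensor K L))⟦(1 : ℤ)⟧' := by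
  -- Both sides are brought to the ordinary tensor product `f (K⟦1⟧) ⊗ g L`, where the identity is
  -- `cupComplex_tensorShift`.
  trans toTensor (f.mapCochainComplexPlus.obj (shiftPlus K)) (g.mapCochainComplexPlus.obj L) ≫
    Q.map (cupComplex π (shiftPlus K) L ≫ h.mapCochainComplexPlus.map (tensorShift K L) ≫
        mapShiftPlus h (tensorComplex K L)) ≫
      (QShift (h.mapCochainComplexPlus.obj (tensorComplex K L))).hom ≫
        (derivedUnit h (tensorComplex K L))⟦(1 : ℤ)⟧'
  · have h₁ : derivedTensorMap (derivedUnit f (shiftPlus K) ≫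
        f.rightDerivedFunctorPlus.map (QShift K).hom) (derivedUnit g L) =
        derivedTensorMap (derivedUnit f (shiftPlus K)) (derivedUnit g L) ≫
          derivedTensorMap (f.rightDerivedFunctorPlus.map (QShift K).hom)
            (g.rightDerivedFunctorPlus.map (𝟙 (Q.obj L))) := by
      rw [derivedTensorMap_comp, CategoryTheory.Functor.map_id, Category.comp_id]
    have h₂ := Φ.hom_naturality (QShift K).hom (𝟙 (Q.obj L))
    have h₃ := congr_arg h.rightDerivedFunctorPlus.map (derivedTensorShift_toTensor K L)
    simp only [Functor.map_comp] at h₃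
    rw [h₁]
    simp only [Category.assoc]
    rw [reassoc_of% h₂, ← derivedShift_naturality, reassoc_of% h₃,
      reassoc_of% (hΦ.derivedUnit_hom (shiftPlus K) L)]
    have h₄ := derivedUnit_naturality h (tensorShift K L)
    refine congr_arg (_ ≫ ·) ?_
    rw [Q.map_comp, Q.map_comp, Category.assoc, Category.assoc]
    refine congr_arg (_ ≫ ·) ?_
    refine ((reassoc_of% h₄) _).symm.trans (congr_arg (_ ≫ ·) ?_)
    exact derivedUnit_derivedShift h (tensorComplex K L)
  · rw [← cupComplex_tensorShift]
    have h₁ : derivedTensorMap (Q.map (mapShiftPlus f K) ≫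
        (QShift (f.mapCochainComplexPlus.obj K)).hom)
        (𝟙 (Q.obj (g.mapCochainComplexPlus.obj L))) =
        derivedTensorMap (Q.map (mapShiftPlus f K))
          (Q.map (𝟙 (g.mapCochainComplexPlus.obj L))) ≫
        derivedTensorMap (QShift (f.mapCochainComplexPlus.obj K)).hom
          (𝟙 (Q.obj (g.mapCochainComplexPlus.obj L))) := by
      rw [derivedTensorMap_comp, Q.map_id, Category.comp_id]
    have h₂ := derivedTensorShift_naturality (derivedUnit f K) (derivedUnit g L)
    have h₃ := congr_arg (shiftFunctor (DerivedCategory.Plus B) (1 : ℤ)).map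
      (hΦ.derivedUnit_hom K L)
    simp only [Functor.map_comp] at h₃
    have h₄ := derivedTensorShift_toTensor (f.mapCochainComplexPlus.obj K)
      (g.mapCochainComplexPlus.obj L)
    have h₅ := toTensor_naturality (mapShiftPlus f K) (𝟙 (g.mapCochainComplexPlus.obj L))
    rw [h₁]
    simp only [Category.assoc]
    rw [reassoc_of% h₂]
    refine Eq.symm ((congr_arg (_ ≫ ·) (congr_arg (_ ≫ ·) (congr_arg (_ ≫ ·) h₃))).trans ?_)
    rw [reassoc_of% h₄, reassoc_of% h₅, ← reassoc_of% (QShift_naturality (cupComplex π K L)),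
      Q.map_comp, Q.map_comp]
    simp only [Category.assoc]

variable {f' g' : B ⥤ A}
  [f'.Additive] [PreservesFiniteLimits f'] [PreservesFiniteColimits f']
  [g'.Additive] [PreservesFiniteLimits g'] [PreservesFiniteColimits g']

/-- For `hom_ext_of_derivedUnit` both sides have to start from a functor of `(Rf X, Rg Y)`, here `S
(Z, W) = Z⟦1⟧ ⊗ᴸ W`. The isomorphism `derivedShift f` is therefore moved to the other side before
the comparison and moved back at the end. -/
lemma DerivedCupPairing.Extends.hom_derivedShift (hΦ : Φ.Extends π) (adjf : f' ⊣ f)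
    (adjg : g' ⊣ g) (hf' : ∀ P, IsFlat P → IsFlat (f'.obj P))
    (hg' : ∀ P, IsFlat P → IsFlat (g'.obj P)) (X Y : DerivedCategory.Plus A) :
    Φ.hom (X⟦(1 : ℤ)⟧) Y ≫ h.rightDerivedFunctorPlus.map (derivedTensorShift X Y) ≫
        derivedShift h (derivedTensorObj X Y) =
      derivedTensorMap (derivedShift f X) (𝟙 (g.rightDerivedFunctorPlus.obj Y)) ≫
        derivedTensorShift (f.rightDerivedFunctorPlus.obj X) (g.rightDerivedFunctorPlus.obj Y) ≫
        (Φ.hom X Y)⟦(1 : ℤ)⟧' := by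
  let S : DerivedCategory.Plus B × DerivedCategory.Plus B ⥤ DerivedCategory.Plus B :=
    (shiftFunctor (DerivedCategory.Plus B) (1 : ℤ)).prod (𝟭 (DerivedCategory.Plus B)) ⋙
      derivedTensor B
  let N : DerivedCategory.Plus A ⥤ DerivedCategory.Plus B :=
    h.rightDerivedFunctorPlus ⋙ shiftFunctor (DerivedCategory.Plus B) (1 : ℤ)
  let Θ₁ : f.rightDerivedFunctorPlus.prod g.rightDerivedFunctorPlus ⋙ S ⟶
      derivedTensor A ⋙ N :=
    { app X := derivedTensorShift (f.rightDerivedFunctorPlus.obj X.1)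
          (g.rightDerivedFunctorPlus.obj X.2) ≫ (Φ.hom X.1 X.2)⟦(1 : ℤ)⟧'
      naturality X Y φ := by
        have h₁ := derivedTensorShift_naturality (f.rightDerivedFunctorPlus.map φ.1)
          (g.rightDerivedFunctorPlus.map φ.2)
        have h₂ := congr_arg (shiftFunctor (DerivedCategory.Plus B) (1 : ℤ)).map
          (Φ.hom_naturality φ.1 φ.2)
        rw [Functor.map_comp, Functor.map_comp] at h₂
        refine ((reassoc_of% h₁) _).trans ?_
        exact (congr_arg (_ ≫ ·) h₂).trans (Category.assoc _ _ _).symm }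
  let Θ₂ : f.rightDerivedFunctorPlus.prod g.rightDerivedFunctorPlus ⋙ S ⟶
      derivedTensor A ⋙ N :=
    { app X := derivedTensorMap (inv (derivedShift f X.1))
          (𝟙 (g.rightDerivedFunctorPlus.obj X.2)) ≫ Φ.hom (X.1⟦(1 : ℤ)⟧) X.2 ≫
          h.rightDerivedFunctorPlus.map (derivedTensorShift X.1 X.2) ≫
            derivedShift h (derivedTensorObj X.1 X.2)
      naturality X Y φ := by
        have h₁ : derivedTensorMap ((f.rightDerivedFunctorPlus.map φ.1)⟦(1 : ℤ)⟧')
            (g.rightDerivedFunctorPlus.map φ.2) ≫ derivedTensorMap (inv (derivedShift f Y.1))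
              (𝟙 (g.rightDerivedFunctorPlus.obj Y.2)) =
            derivedTensorMap (inv (derivedShift f X.1))
              (𝟙 (g.rightDerivedFunctorPlus.obj X.2)) ≫
              derivedTensorMap (f.rightDerivedFunctorPlus.map (φ.1⟦(1 : ℤ)⟧'))
                (g.rightDerivedFunctorPlus.map φ.2) := by
          rw [derivedTensorMap_comp, derivedTensorMap_comp, Category.comp_id, Category.id_comp]
          congr 1
          rw [IsIso.comp_inv_eq, Category.assoc, derivedShift_naturality,
            IsIso.inv_hom_id_assoc]
        have h₂ := congr_arg h.rightDerivedFunctorPlus.map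
          (derivedTensorShift_naturality φ.1 φ.2)
        rw [Functor.map_comp, Functor.map_comp] at h₂
        refine ((reassoc_of% h₁) _).trans ?_
        rw [reassoc_of% (Φ.hom_naturality (φ.1⟦(1 : ℤ)⟧') φ.2), reassoc_of% h₂,
          derivedShift_naturality]
        exact (congr_arg (_ ≫ ·) ((congr_arg (_ ≫ ·) (Category.assoc _ _ _).symm).trans
          (Category.assoc _ _ _).symm)).trans (Category.assoc _ _ _).symm }
  have hΘ : Θ₁ = Θ₂ := by
    refine hom_ext_of_derivedUnit adjf adjg hf' hg' fun K L => ?_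
    have h₁ := hΦ.derivedShift_Q K L
    have h₂ : derivedTensorMap (derivedUnit f (shiftPlus K) ≫
        f.rightDerivedFunctorPlus.map (QShift K).hom) (derivedUnit g L) =
        derivedTensorMap (Q.map (mapShiftPlus f K) ≫
          (QShift (f.mapCochainComplexPlus.obj K)).hom)
          (𝟙 (Q.obj (g.mapCochainComplexPlus.obj L))) ≫
        derivedTensorMap ((derivedUnit f K)⟦(1 : ℤ)⟧') (derivedUnit g L) ≫
        derivedTensorMap (inv (derivedShift f (Q.obj K)))
          (𝟙 (g.rightDerivedFunctorPlus.obj (Q.obj L))) := by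
      rw [derivedTensorMap_comp, derivedTensorMap_comp, Category.comp_id, Category.id_comp]
      congr 1
      rw [← Category.assoc, IsIso.eq_comp_inv, Category.assoc, derivedUnit_derivedShift,
        Category.assoc]
    rw [h₂, Category.assoc, Category.assoc] at h₁
    have h₃ := (cancel_epi (derivedTensorMap (Q.map (mapShiftPlus f K) ≫
          (QShift (f.mapCochainComplexPlus.obj K)).hom)
          (𝟙 (Q.obj (g.mapCochainComplexPlus.obj L))))).1 h₁
    refine h₃.symm.trans ?_
    exact congr_arg (_ ≫ ·) (Category.assoc _ _ _).symm
  have h₁ : Θ₁.app (X, Y) = Θ₂.app (X, Y) := congr_app hΘ _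
  have h₂ : derivedTensorMap (derivedShift f X) (𝟙 (g.rightDerivedFunctorPlus.obj Y)) ≫
      derivedTensorMap (inv (derivedShift f X)) (𝟙 (g.rightDerivedFunctorPlus.obj Y)) = 𝟙 _ := by
    rw [derivedTensorMap_comp, IsIso.hom_inv_id, Category.comp_id, derivedTensorMap_id]
  refine Eq.symm ((congr_arg (derivedTensorMap (derivedShift f X)
    (𝟙 (g.rightDerivedFunctorPlus.obj Y)) ≫ ·) h₁).trans ?_)
  exact ((reassoc_of% h₂) _)

end DerivedCupShift

/-! ### Cup products and connecting morphisms in the derived category -/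

section DerivedCupHomology

variable {A : Type u₁} [Category.{v₁} A] [Abelian A] [MonoidalCategory A] [MonoidalPreadditive A]
  [HasDerivedCategory.{w₁} A] [EnoughInjectives A] [HasDerivedTensor A]
  {B : Type u₂} [Category.{v₂} B] [Abelian B] [MonoidalCategory B] [MonoidalPreadditive B]
  [HasDerivedCategory.{w₂} B] [HasDerivedTensor B]
  {f g h : A ⥤ B} [f.Additive] [g.Additive] [h.Additive]

/-- The connecting morphism `Hⁿ(Rf X) ⟶ Hⁿ⁺¹(Rf Y)` induced by a morphism `X ⟶ Y⟦1⟧`. -/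
def connectingMap (f : A ⥤ B) [f.Additive] {X Y : DerivedCategory.Plus A} (φ : X ⟶ Y⟦(1 : ℤ)⟧)
    (n₀ n₁ : ℤ) (hn : 1 + n₀ = n₁) :
    (homologyFunctor B n₀).obj (f.rightDerivedFunctorPlus.obj X) ⟶
      (homologyFunctor B n₁).obj (f.rightDerivedFunctorPlus.obj Y) :=
  homologyShiftMap (f.rightDerivedFunctorPlus.map φ ≫ derivedShift f Y) n₀ n₁ hn

lemma connectingMap_comp_left {X X' Y : DerivedCategory.Plus A} (a : X ⟶ X')
    (φ : X' ⟶ Y⟦(1 : ℤ)⟧) (n₀ n₁ : ℤ) (hn : 1 + n₀ = n₁) :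
    connectingMap f (a ≫ φ) n₀ n₁ hn =
      (homologyFunctor B n₀).map (f.rightDerivedFunctorPlus.map a) ≫
        connectingMap f φ n₀ n₁ hn := by
  unfold connectingMap
  rw [Functor.map_comp, Category.assoc, homologyShiftMap_comp_left]

lemma connectingMap_comp_right {X Y Y' : DerivedCategory.Plus A} (φ : X ⟶ Y⟦(1 : ℤ)⟧)
    (b : Y ⟶ Y') (n₀ n₁ : ℤ) (hn : 1 + n₀ = n₁) :
    connectingMap f (φ ≫ b⟦(1 : ℤ)⟧') n₀ n₁ hn =
      connectingMap f φ n₀ n₁ hn ≫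
        (homologyFunctor B n₁).map (f.rightDerivedFunctorPlus.map b) := by
  unfold connectingMap
  rw [Functor.map_comp, Category.assoc, derivedShift_naturality, ← homologyShiftMap_comp_right,
    Category.assoc]

/-- The cup product on the cohomology of arbitrary objects of the derived category. -/
def derivedCup (α : HomologyPairing (C := B)) (Φ : DerivedCupPairing f g h) (p q n : ℤ)
    (hpq : p + q = n) (X Y : DerivedCategory.Plus A) :
    (homologyFunctor B p).obj (f.rightDerivedFunctorPlus.obj X) ⊗
        (homologyFunctor B q).obj (g.rightDerivedFunctorPlus.obj Y) ⟶
      (homologyFunctor B n).obj (h.rightDerivedFunctorPlus.obj (derivedTensorObj X Y)) :=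
  α.hom p q n hpq _ _ ≫ (homologyFunctor B n).map (Φ.hom X Y)

lemma derivedCup_naturality (α : HomologyPairing (C := B)) (Φ : DerivedCupPairing f g h)
    (p q n : ℤ) (hpq : p + q = n) {X X' Y Y' : DerivedCategory.Plus A} (a : X ⟶ X')
    (b : Y ⟶ Y') :
    ((homologyFunctor B p).map (f.rightDerivedFunctorPlus.map a) ⊗ₘ
        (homologyFunctor B q).map (g.rightDerivedFunctorPlus.map b)) ≫
        derivedCup α Φ p q n hpq X' Y' =
      derivedCup α Φ p q n hpq X Y ≫
        (homologyFunctor B n).map (h.rightDerivedFunctorPlus.map (derivedTensorMap a b)) := by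
  unfold derivedCup
  rw [reassoc_of% (α.hom_naturality p q n hpq (f.rightDerivedFunctorPlus.map a)
    (g.rightDerivedFunctorPlus.map b)), ← Functor.map_comp, Φ.hom_naturality, Functor.map_comp,
    Category.assoc]

variable [SymmetricCategory A] [∀ X : A, PreservesFiniteColimits (tensorLeft X)]
  [SymmetricCategory B] [∀ X : B, PreservesFiniteColimits (tensorLeft X)]
  [hB : Fact (HasFiniteTorDimension B)] [hA : Fact (HasFiniteTorDimension A)]
  {f' g' : B ⥤ A}
  [f'.Additive] [PreservesFiniteLimits f'] [PreservesFiniteColimits f']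
  [g'.Additive] [PreservesFiniteLimits g'] [PreservesFiniteColimits g']

/-- The cup product is compatible with connecting morphisms in the first variable. -/
lemma derivedCup_connectingMap {α : HomologyPairing (C := B)} (hα : α.IsCanonical)
    {Φ : DerivedCupPairing f g h} {π : CupPairing f g h} (hΦ : Φ.Extends π) (adjf : f' ⊣ f)
    (adjg : g' ⊣ g) (hf' : ∀ P, IsFlat P → IsFlat (f'.obj P))
    (hg' : ∀ P, IsFlat P → IsFlat (g'.obj P)) {X X' : DerivedCategory.Plus A}
    (φ : X ⟶ X'⟦(1 : ℤ)⟧) (Y : DerivedCategory.Plus A) (p p' q n n' : ℤ) (hpq : p + q = n)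
    (hpq' : p' + q = n') (hp : 1 + p = p') (hn : 1 + n = n') :
    derivedCup α Φ p q n hpq X Y ≫
        connectingMap h (derivedTensorMap φ (𝟙 Y) ≫ derivedTensorShift X' Y) n n' hn =
      connectingMap f φ p p' hp ▷ (homologyFunctor B q).obj (g.rightDerivedFunctorPlus.obj Y) ≫
        derivedCup α Φ p' q n' hpq' X' Y := by
  unfold derivedCup connectingMap
  rw [← reassoc_of% (hα.hom_homologyShiftMap (f.rightDerivedFunctorPlus.map φ ≫ derivedShift f X')
    (g.rightDerivedFunctorPlus.obj Y) p p' q n n' hpq hpq' hp hn), Category.assoc,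
    ← homologyShiftMap_comp_left, ← homologyShiftMap_comp_right]
  refine congr_arg (_ ≫ ·) (congr_arg (fun x => homologyShiftMap x n n' hn) ?_)
  have h₁ := Φ.hom_naturality φ (𝟙 Y)
  have h₂ : derivedTensorMap (f.rightDerivedFunctorPlus.map φ ≫ derivedShift f X')
      (𝟙 (g.rightDerivedFunctorPlus.obj Y)) =
      derivedTensorMap (f.rightDerivedFunctorPlus.map φ) (g.rightDerivedFunctorPlus.map (𝟙 Y)) ≫
        derivedTensorMap (derivedShift f X') (𝟙 (g.rightDerivedFunctorPlus.obj Y)) := by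
    rw [derivedTensorMap_comp, CategoryTheory.Functor.map_id, Category.comp_id]
  rw [h₂, Functor.map_comp, Category.assoc, Category.assoc, Category.assoc,
    ← hΦ.hom_derivedShift adjf adjg hf' hg', reassoc_of% h₁]

end DerivedCupHomology

open DerivedCategory.Plus (Q Qh homologyFunctor)

/-! ### Mapping cones under additive functors -/

section MapCone

variable {C : Type u} [Category.{v} C] [Abelian C] {D : Type u₁} [Category.{v₁} D] [Abelian D]
  (F : C ⥤ D) [F.Additive]

/-- An additive functor commutes with the formation of complexes concentrated in degree `0`. -/
def mapSingle (X : C) : F.mapCochainComplexPlus.obj ((single C).obj X) ⟶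
    (single D).obj (F.obj X) :=
  ObjectProperty.homMk ((HomologicalComplex.singleMapHomologicalComplex F (.up ℤ) 0).hom.app X)

lemma mapSingle_f_zero (X : C) : (mapSingle F X).hom.f 0 =
    F.map (HomologicalComplex.singleObjXSelf (.up ℤ) 0 X).hom ≫
      (HomologicalComplex.singleObjXSelf (.up ℤ) 0 (F.obj X)).inv :=
  HomologicalComplex.singleMapHomologicalComplex_hom_app_self F (.up ℤ) 0 X

variable {F} {S : ShortComplex C} {T : ShortComplex D} (φ : S.map F ⟶ T)

/-- The morphism of short complexes of complexes concentrated in degree `0` induced by a morphism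
`F S ⟶ T`. -/
def mapSingleShortComplex :
    (S.map (HomologicalComplex.single C (.up ℤ) 0)).map (F.mapHomologicalComplex (.up ℤ)) ⟶
      T.map (HomologicalComplex.single D (.up ℤ) 0) where
  τ₁ := (HomologicalComplex.singleMapHomologicalComplex F (.up ℤ) 0).hom.app S.X₁ ≫
    (HomologicalComplex.single D (.up ℤ) 0).map φ.τ₁
  τ₂ := (HomologicalComplex.singleMapHomologicalComplex F (.up ℤ) 0).hom.app S.X₂ ≫
    (HomologicalComplex.single D (.up ℤ) 0).map φ.τ₂
  τ₃ := (HomologicalComplex.singleMapHomologicalComplex F (.up ℤ) 0).hom.app S.X₃ ≫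
    (HomologicalComplex.single D (.up ℤ) 0).map φ.τ₃
  comm₁₂ := by
    have h := (HomologicalComplex.singleMapHomologicalComplex F (.up ℤ) 0).hom.naturality S.f
    have h' := congr_arg (HomologicalComplex.single D (.up ℤ) 0).map φ.comm₁₂
    rw [Functor.map_comp, Functor.map_comp] at h'
    refine (Category.assoc _ _ _).trans ((congr_arg (_ ≫ ·) h').trans ?_)
    exact (Category.assoc _ _ _).symm.trans ((h.symm =≫ _).trans (Category.assoc _ _ _))
  comm₂₃ := by
    have h := (HomologicalComplex.singleMapHomologicalComplex F (.up ℤ) 0).hom.naturality S.g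
    have h' := congr_arg (HomologicalComplex.single D (.up ℤ) 0).map φ.comm₂₃
    rw [Functor.map_comp, Functor.map_comp] at h'
    refine (Category.assoc _ _ _).trans ((congr_arg (_ ≫ ·) h').trans ?_)
    exact (Category.assoc _ _ _).symm.trans ((h.symm =≫ _).trans (Category.assoc _ _ _))

/-- The morphism of mapping cones induced by a morphism of short complexes `F S ⟶ T`. -/
def mapSesCone : F.mapCochainComplexPlus.obj (sesCone S) ⟶ sesCone T :=
  ObjectProperty.homMk
    ((CochainComplex.mappingCone.mapHomologicalComplexIso
        (S.map (HomologicalComplex.single C (.up ℤ) 0)).f F).hom ≫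
      CochainComplex.mappingCone.map _ _ (mapSingleShortComplex φ).τ₁
        (mapSingleShortComplex φ).τ₂ (mapSingleShortComplex φ).comm₁₂.symm)

/-- The cone of `S` maps to the cone of `T` for any additive `F`, without exactness of `F S`. This
is what allows the compatibility with `δ` when the tensored sequence is not exact. -/
lemma mapSesCone_sesConeDesc :
    mapSesCone φ ≫ sesConeDesc T = F.mapCochainComplexPlus.map (sesConeDesc S) ≫
      mapSingle F S.X₃ ≫ (single D).map φ.τ₃ := by
  apply (CochainComplex.Plus.ι D).map_injective
  have h₁ := CochainComplex.mappingCone.descShortComplex_naturality (mapSingleShortComplex φ)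
  have h₂ := CochainComplex.mappingCone.mapHomologicalComplexIso_hom_descShortComplex F
    (S.map (HomologicalComplex.single C (.up ℤ) 0))
  exact (Category.assoc _ _ _).trans ((congr_arg (_ ≫ ·) h₁).trans
    ((Category.assoc _ _ _).symm.trans (h₂ =≫ _)))

lemma mapSesCone_sesConeδ :
    mapSesCone φ ≫ sesConeδ T = F.mapCochainComplexPlus.map (sesConeδ S) ≫
      mapShiftPlus F _ ≫ shiftPlusMap (mapSingle F S.X₁ ≫ (single D).map φ.τ₁) := by
  apply (CochainComplex.Plus.ι D).map_injective
  have h₁ := (CochainComplex.mappingCone.triangleMap _ _ (mapSingleShortComplex φ).τ₁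
    (mapSingleShortComplex φ).τ₂ (mapSingleShortComplex φ).comm₁₂.symm).comm₃
  have h₂ := CochainComplex.mappingCone.map_δ (S.map (HomologicalComplex.single C (.up ℤ) 0)).f F
  exact (Category.assoc _ _ _).trans ((congr_arg (_ ≫ ·) h₁.symm).trans
    ((Category.assoc _ _ _).symm.trans ((h₂.symm =≫ _).trans (Category.assoc _ _ _))))

end MapCone

/-! ### Tensor products with an object in degree zero -/

section TensorSingle

variable {C : Type u} [Category.{v} C] [Abelian C] [MonoidalCategory C] [MonoidalPreadditive C]

lemma isZero_single (Y : C) (q : ℤ) (hq : q ≠ 0) : IsZero (((single C).obj Y).obj.X q) :=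
  HomologicalComplex.isZero_single_obj_X _ _ _ _ hq

lemma single_d (Y : C) (p q : ℤ) : ((single C).obj Y).obj.d p q = 0 :=
  HomologicalComplex.single_obj_d ..

/-- The degree `0` term of a complex concentrated in degree `0`. -/
def singleZero (Y : C) : ((single C).obj Y).obj.X 0 ≅ Y :=
  HomologicalComplex.singleObjXSelf (.up ℤ) 0 Y

lemma tensorComplex_single_hom_ext {K : CochainComplex.Plus C} {Y : C} {n : ℤ} {Z : C}
    {a b : (tensorComplex K ((single C).obj Y)).obj.X n ⟶ Z}
    (h : tensorComplex.inc K ((single C).obj Y) n 0 n (add_zero n) ≫ a =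
      tensorComplex.inc K ((single C).obj Y) n 0 n (add_zero n) ≫ b) : a = b := by
  refine tensorComplex.hom_ext fun p q hpq => ?_
  by_cases hq : q = 0
  · subst hq
    obtain rfl : p = n := by omega
    exact h
  · exact ((tensorLeft (K.obj.X p)).map_isZero (isZero_single Y q hq)).eq_of_src _ _

/-- The component of degree `n` of `tensorSingleRight`. -/
def tensorSingleRightX (K : CochainComplex.Plus C) (Y : C) (n : ℤ) :
    (tensorComplex K ((single C).obj Y)).obj.X n ⟶ K.obj.X n ⊗ Y :=
  tensorComplex.desc fun p q h => if hq : q = 0 then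
    (K.obj.XIsoOfEq (show p = n by omega)).hom ⊗ₘ
      (HomologicalComplex.singleObjXIsoOfEq (.up ℤ) 0 Y q hq).hom else 0

lemma inc_tensorSingleRightX (K : CochainComplex.Plus C) (Y : C) (n : ℤ) :
    tensorComplex.inc K ((single C).obj Y) n 0 n (add_zero n) ≫ tensorSingleRightX K Y n =
      K.obj.X n ◁ (singleZero Y).hom := by
  refine (tensorComplex.inc_desc _ _ _ _).trans ?_
  refine (dif_pos rfl).trans ?_
  exact id_tensorHom _ _

/-- The morphism `K ⊗ Y[0] ⟶ K ⊗ Y` from the tensor product of complexes to the termwise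
tensor product. -/
def tensorSingleRight (K : CochainComplex.Plus C) (Y : C) :
    tensorComplex K ((single C).obj Y) ⟶ (tensorRight Y).mapCochainComplexPlus.obj K :=
  ObjectProperty.homMk
    { f n := tensorSingleRightX K Y n
      comm' n n' hn := by
        obtain rfl : n + 1 = n' := hn
        refine tensorComplex_single_hom_ext ?_
        have h₁ := inc_tensorSingleRightX K Y n
        have h₂ := tensorComplex.inc_d K ((single C).obj Y) n 0 n (add_zero n) (n + 1) 1 (n + 1)
          rfl rfl rfl
        rw [single_d, MonoidalPreadditive.whiskerLeft_zero, zero_comp, smul_zero, add_zero] at h₂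
        have h₃ := inc_tensorSingleRightX K Y (n + 1)
        refine (((reassoc_of% h₁) _)).trans (Eq.symm (((reassoc_of% h₂) _).trans
          ((congr_arg (_ ≫ ·) h₃).trans ?_)))
        exact (whisker_exchange _ _).symm }

lemma inc_tensorSingleRight (K : CochainComplex.Plus C) (Y : C) (n : ℤ) :
    tensorComplex.inc K ((single C).obj Y) n 0 n (add_zero n) ≫ (tensorSingleRight K Y).hom.f n =
      K.obj.X n ◁ (singleZero Y).hom :=
  inc_tensorSingleRightX K Y n

lemma tensorSingleRight_naturality {K K' : CochainComplex.Plus C} (a : K ⟶ K') (Y : C) :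
    tensorComplex.map a (𝟙 ((single C).obj Y)) ≫ tensorSingleRight K' Y =
      tensorSingleRight K Y ≫ (tensorRight Y).mapCochainComplexPlus.map a := by
  ext n
  refine tensorComplex_single_hom_ext ?_
  have h₁ := tensorComplex.inc_map a (𝟙 ((single C).obj Y)) n 0 n (add_zero n)
  have h₂ : (a.hom.f n ⊗ₘ (𝟙 ((single C).obj Y) : (single C).obj Y ⟶ _).hom.f 0) =
    a.hom.f n ▷ ((single C).obj Y).obj.X 0 := tensorHom_id _ _
  refine ((reassoc_of% h₁) _).trans ((congr_arg (_ ≫ ·) (inc_tensorSingleRight K' Y n)).trans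
    ((h₂ =≫ _).trans (Eq.symm ?_)))
  refine ((reassoc_of% (inc_tensorSingleRight K Y n)) _).trans ?_
  exact whisker_exchange _ _

lemma tensorShift_tensorSingleRight (K : CochainComplex.Plus C) (Y : C) :
    tensorShift K ((single C).obj Y) ≫ shiftPlusMap (tensorSingleRight K Y) =
      tensorSingleRight (shiftPlus K) Y ≫ mapShiftPlus (tensorRight Y) K := by
  ext n
  refine tensorComplex_single_hom_ext ?_
  refine ((reassoc_of% (inc_tensorShift K ((single C).obj Y) n 0 n (add_zero n))) _).trans ?_
  refine (inc_tensorSingleRight K Y (n + 1)).trans (Eq.symm ?_)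
  refine ((reassoc_of% (inc_tensorSingleRight (shiftPlus K) Y n)) _).trans ?_
  exact Category.comp_id _

lemma inc_tensorSingle (X Y : C) :
    tensorComplex.inc ((single C).obj X) ((single C).obj Y) 0 0 0 (add_zero 0) ≫
        (tensorSingle X Y).hom.f 0 =
      ((singleZero X).hom ⊗ₘ (singleZero Y).hom) ≫ (singleZero (X ⊗ Y)).inv := by
  obtain ⟨hφ, e⟩ : ∃ hφ, (tensorSingle X Y).hom = HomologicalComplex.mkHomToSingle (j := 0)
    (K := (tensorComplex ((single C).obj X) ((single C).obj Y)).obj)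
    (tensorComplex.desc (K := (single C).obj X) (L := (single C).obj Y) (n := 0) fun p q hpq =>
      if h : p = 0 ∧ q = 0 then
        (HomologicalComplex.singleObjXIsoOfEq (ComplexShape.up ℤ) 0 X p h.1).hom ⊗ₘ
          (HomologicalComplex.singleObjXIsoOfEq (ComplexShape.up ℤ) 0 Y q h.2).hom
      else 0) hφ := ⟨fun i hi => by
        have hi' : i + 1 = 0 := hi
        refine tensorComplex_single_hom_ext ?_
        exact ((tensorRight _).map_isZero (isZero_single X i (by omega))).eq_of_src _ _, rfl⟩
  have e₀ := congr_arg (fun x => HomologicalComplex.Hom.f x 0) e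
  refine (congr_arg (_ ≫ ·) (e₀.trans (HomologicalComplex.mkHomToSingle_f _ hφ))).trans ?_
  refine (Category.assoc _ _ _).symm.trans (congr_arg (· ≫ _) ?_)
  refine (tensorComplex.inc_desc _ _ _ _).trans ?_
  exact dif_pos ⟨rfl, rfl⟩

lemma tensorSingleRight_single (X Y : C) :
    tensorSingleRight ((single C).obj X) Y ≫ mapSingle (tensorRight Y) X = tensorSingle X Y := by
  ext n
  by_cases hn : n = 0
  · subst hn
    refine tensorComplex_single_hom_ext ?_
    refine ((reassoc_of% (inc_tensorSingleRight ((single C).obj X) Y 0)) _).trans ?_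
    refine (congr_arg (_ ≫ ·) (mapSingle_f_zero (tensorRight Y) X)).trans ?_
    refine Eq.symm ((inc_tensorSingle X Y).trans ?_)
    exact ((MonoidalCategory.tensorHom_def' _ _) =≫ _).trans (Category.assoc _ _ _)
  · exact (isZero_single (X ⊗ Y) n hn).eq_of_tgt _ _

section

variable {S T : ShortComplex C} (Y : C) (φ : S.map (tensorRight Y) ⟶ T)

/-- The morphism from the tensor product of the mapping cone of a short exact sequence with an
object to another mapping cone. -/
def tensorSesCone : tensorComplex (sesCone S) ((single C).obj Y) ⟶ sesCone T :=
  tensorSingleRight (sesCone S) Y ≫ mapSesCone φ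

lemma tensorSesCone_sesConeDesc :
    tensorSesCone Y φ ≫ sesConeDesc T =
      tensorComplex.map (sesConeDesc S) (𝟙 ((single C).obj Y)) ≫ tensorSingle S.X₃ Y ≫
        (single C).map φ.τ₃ := by
  unfold tensorSesCone
  rw [Category.assoc, mapSesCone_sesConeDesc, ← tensorSingleRight_single, Category.assoc,
    reassoc_of% (tensorSingleRight_naturality (sesConeDesc S) Y)]

lemma tensorSesCone_sesConeδ :
    tensorSesCone Y φ ≫ sesConeδ T =
      tensorComplex.map (sesConeδ S) (𝟙 ((single C).obj Y)) ≫
        tensorShift ((single C).obj S.X₁) ((single C).obj Y) ≫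
        shiftPlusMap (tensorSingle S.X₁ Y ≫ (single C).map φ.τ₁) := by
  have h : shiftPlusMap (tensorSingle S.X₁ Y ≫ (single C).map φ.τ₁) =
      shiftPlusMap (tensorSingleRight ((single C).obj S.X₁) Y) ≫
        shiftPlusMap (mapSingle (tensorRight Y) S.X₁ ≫ (single C).map φ.τ₁) := by
    rw [← tensorSingleRight_single, Category.assoc]
    apply (CochainComplex.Plus.ι C).map_injective
    exact (shiftFunctor (CochainComplex C ℤ) (1 : ℤ)).map_comp _ _
  unfold tensorSesCone
  rw [Category.assoc, mapSesCone_sesConeδ, h,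
    reassoc_of% (tensorShift_tensorSingleRight ((single C).obj S.X₁) Y),
    reassoc_of% (tensorSingleRight_naturality (sesConeδ S) Y)]

variable [HasDerivedCategory.{w} C] [HasDerivedTensor C] [SymmetricCategory C]
  [∀ X : C, PreservesFiniteColimits (tensorLeft X)] [hC : Fact (HasFiniteTorDimension C)]

/-- The compatibility of the derived tensor product with the connecting morphisms attached to
short exact sequences. -/
lemma derivedTensorSingle_derivedδ (hS : S.ShortExact) (hT : T.ShortExact) :
    derivedTensorSingle S.X₃ Y ≫ Q.map ((single C).map φ.τ₃) ≫ derivedδ hT =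
      derivedTensorMap (derivedδ hS) (𝟙 (Q.obj ((single C).obj Y))) ≫
        derivedTensorShift (Q.obj ((single C).obj S.X₁)) (Q.obj ((single C).obj Y)) ≫
        (derivedTensorSingle S.X₁ Y ≫ Q.map ((single C).map φ.τ₁))⟦(1 : ℤ)⟧' := by
  have := isIso_Q_map_sesConeDesc hS
  have e (X : C) : derivedTensorSingle X Y =
    toTensor ((single C).obj X) ((single C).obj Y) ≫ Q.map (tensorSingle X Y) := rfl
  -- Precomposing with the cone of `S`, which is isomorphic to `S.X₃` in the derived category, turns
  -- both sides into one morphism of complexes out of the cone tensored with `Y[0]`.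
  rw [← cancel_epi (derivedTensorMap (Q.map (sesConeDesc S)) (𝟙 (Q.obj ((single C).obj Y)))), e, e]
  trans toTensor (sesCone S) ((single C).obj Y) ≫
    Q.map (tensorSesCone Y φ ≫ sesConeδ T) ≫ (QShift ((single C).obj T.X₁)).hom
  · have h₁ := toTensor_naturality (sesConeDesc S) (𝟙 ((single C).obj Y))
    rw [Q.map_id] at h₁
    have h₂ := congr_arg Q.map (tensorSesCone_sesConeDesc Y φ)
    simp only [Q.map_comp] at h₂
    rw [Category.assoc, reassoc_of% h₁, ← reassoc_of% h₂, sesConeDesc_derivedδ,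
      Q.map_comp, Category.assoc]
  · have h₁ := toTensor_naturality (sesConeδ S) (𝟙 ((single C).obj Y))
    have h₂ : derivedTensorMap (Q.map (sesConeDesc S)) (𝟙 (Q.obj ((single C).obj Y))) ≫
        derivedTensorMap (derivedδ hS) (𝟙 (Q.obj ((single C).obj Y))) =
        derivedTensorMap (Q.map (sesConeδ S)) (Q.map (𝟙 ((single C).obj Y))) ≫
          derivedTensorMap (QShift ((single C).obj S.X₁)).hom
            (𝟙 (Q.obj ((single C).obj Y))) := by
      rw [derivedTensorMap_comp, derivedTensorMap_comp, sesConeDesc_derivedδ, Q.map_id]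
    have h₃ := derivedTensorShift_toTensor ((single C).obj S.X₁) ((single C).obj Y)
    rw [tensorSesCone_sesConeδ, reassoc_of% h₂, Category.assoc, ← Q.map_comp,
      (shiftFunctor (DerivedCategory.Plus C) (1 : ℤ)).map_comp, reassoc_of% h₃, reassoc_of% h₁, ← QShift_naturality, Q.map_comp, Q.map_comp, Category.assoc,
      Category.assoc]

end

end TensorSingle

open DerivedCategory.Plus (Q Qh homologyFunctor)

/-! ### The cup product on cohomology of objects -/

section ObjectCup

variable {A : Type u₁} [Category.{v₁} A] [Abelian A] [MonoidalCategory A] [MonoidalPreadditive A]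
  [HasDerivedCategory.{w₁} A] [EnoughInjectives A] [HasDerivedTensor A]
  {B : Type u₂} [Category.{v₂} B] [Abelian B] [MonoidalCategory B] [MonoidalPreadditive B]
  [HasDerivedCategory.{w₂} B] [HasDerivedTensor B]
  {f g h : A ⥤ B} [f.Additive] [g.Additive] [h.Additive]

/-- The morphism `Hⁿ(Rf X) ⟶ Hⁿ(Rf Y)` induced by a morphism `X ⟶ Y`. -/
def directImageMap (f : A ⥤ B) [f.Additive] (n : ℤ) {X Y : DerivedCategory.Plus A} (φ : X ⟶ Y) :
    (homologyFunctor B n).obj (f.rightDerivedFunctorPlus.obj X) ⟶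
      (homologyFunctor B n).obj (f.rightDerivedFunctorPlus.obj Y) :=
  (homologyFunctor B n).map (f.rightDerivedFunctorPlus.map φ)

lemma directImageMap_comp (f : A ⥤ B) [f.Additive] (n : ℤ) {X Y Z : DerivedCategory.Plus A}
    (φ : X ⟶ Y) (ψ : Y ⟶ Z) :
    directImageMap f n (φ ≫ ψ) = directImageMap f n φ ≫ directImageMap f n ψ := by
  unfold directImageMap
  rw [Functor.map_comp, Functor.map_comp]

lemma directImageMap_connectingMap {X X' Y : DerivedCategory.Plus A} (a : X ⟶ X')
    (φ : X' ⟶ Y⟦(1 : ℤ)⟧) (n₀ n₁ : ℤ) (hn : 1 + n₀ = n₁) :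
    directImageMap f n₀ a ≫ connectingMap f φ n₀ n₁ hn = connectingMap f (a ≫ φ) n₀ n₁ hn :=
  (connectingMap_comp_left a φ n₀ n₁ hn).symm

lemma connectingMap_directImageMap {X Y Y' : DerivedCategory.Plus A}
    (φ : X ⟶ Y⟦(1 : ℤ)⟧) (b : Y ⟶ Y') (n₀ n₁ : ℤ) (hn : 1 + n₀ = n₁) :
    connectingMap f φ n₀ n₁ hn ≫ directImageMap f n₁ b =
      connectingMap f (φ ≫ b⟦(1 : ℤ)⟧') n₀ n₁ hn :=
  (connectingMap_comp_right φ b n₀ n₁ hn).symm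

/-- The cup product on the cohomology of objects. -/
def objectCup (α : HomologyPairing (C := B)) (Φ : DerivedCupPairing f g h) (p q n : ℤ)
    (hpq : p + q = n) (X Y : A) :
    (homologyFunctor B p).obj (f.rightDerivedFunctorPlus.obj (Q.obj ((single A).obj X))) ⊗
        (homologyFunctor B q).obj (g.rightDerivedFunctorPlus.obj (Q.obj ((single A).obj Y))) ⟶
      (homologyFunctor B n).obj (h.rightDerivedFunctorPlus.obj (Q.obj ((single A).obj (X ⊗ Y)))) :=
  derivedCup α Φ p q n hpq _ _ ≫ directImageMap h n (derivedTensorSingle X Y)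

lemma inducedCup_eq (α : HomologyPairing (C := B)) (Φ : DerivedCupPairing f g h) (r s : ℕ)
    (X Y : A) : inducedCup α Φ r s X Y = objectCup α Φ r s (r + s) rfl X Y := by
  exact (congr_arg (_ ≫ ·) ((homologyFunctor B _).map_comp _ _)).trans (Category.assoc _ _ _).symm

lemma derivedTensorSingle_naturality {X X' Y Y' : A} (a : X ⟶ X') (b : Y ⟶ Y') :
    derivedTensorMap (Q.map ((single A).map a)) (Q.map ((single A).map b)) ≫
        derivedTensorSingle X' Y' =
      derivedTensorSingle X Y ≫ Q.map ((single A).map (a ⊗ₘ b)) := by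
  have e (X Y : A) : derivedTensorSingle X Y =
    toTensor ((single A).obj X) ((single A).obj Y) ≫ Q.map (tensorSingle X Y) := rfl
  rw [e, e, reassoc_of% (toTensor_naturality ((single A).map a) ((single A).map b)),
    Category.assoc, ← Q.map_comp, ← Q.map_comp]
  congr 2
  ext n
  by_cases hn : n = 0
  · subst hn
    refine tensorComplex_single_hom_ext ?_
    have h₁ := tensorComplex.inc_map ((single A).map a) ((single A).map b) 0 0 0 (add_zero 0)
    have h₂ {X X' : A} (a : X ⟶ X') : ((single A).map a).hom.f 0 =
        (singleZero X).hom ≫ a ≫ (singleZero X').inv :=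
      HomologicalComplex.single_map_f_self (.up ℤ) 0 a
    refine ((reassoc_of% h₁) _).trans ((congr_arg (_ ≫ ·) (inc_tensorSingle X' Y')).trans ?_)
    refine Eq.symm (((reassoc_of% (inc_tensorSingle X Y)) _).trans ?_)
    refine (congr_arg (_ ≫ ·) (congr_arg (_ ≫ ·) (h₂ (a ⊗ₘ b)))).trans ?_
    rw [h₂, h₂, Iso.inv_hom_id_assoc, ← Category.assoc, ← Category.assoc,
      MonoidalCategory.tensorHom_comp_tensorHom, MonoidalCategory.tensorHom_comp_tensorHom]
    simp
  · exact (isZero_single (X' ⊗ Y') n hn).eq_of_tgt _ _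

lemma objectCup_naturality (α : HomologyPairing (C := B)) (Φ : DerivedCupPairing f g h)
    (p q n : ℤ) (hpq : p + q = n) {X X' Y Y' : A} (a : X ⟶ X') (b : Y ⟶ Y') :
    (directImageMap f p (Q.map ((single A).map a)) ⊗ₘ
        directImageMap g q (Q.map ((single A).map b))) ≫ objectCup α Φ p q n hpq X' Y' =
      objectCup α Φ p q n hpq X Y ≫ directImageMap h n (Q.map ((single A).map (a ⊗ₘ b))) := by
  have h₁ := derivedCup_naturality α Φ p q n hpq (Q.map ((single A).map a))
    (Q.map ((single A).map b))
  unfold objectCup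
  refine ((reassoc_of% h₁) _).trans ?_
  rw [Category.assoc, ← directImageMap_comp, ← derivedTensorSingle_naturality,
    directImageMap_comp]
  rfl

lemma inducedCup_isNatural (α : HomologyPairing (C := B)) (Φ : DerivedCupPairing f g h) :
    (inducedCup α Φ).IsNatural := by
  intro r s X X' Y Y' a b
  rw [inducedCup_eq, inducedCup_eq]
  exact objectCup_naturality α Φ r s (r + s) rfl a b

section Zero

/-- The morphism from `f X` to the cycles of degree `0` of `f (X[0])`. -/
def toSingleCycles (f : A ⥤ B) [f.Additive] (X : A) :
    f.obj X ⟶ (f.mapCochainComplexPlus.obj ((single A).obj X)).obj.cycles 0 :=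
  (f.mapCochainComplexPlus.obj ((single A).obj X)).obj.liftCycles
    (f.map (singleZero X).inv) (0 + 1) (by simp) (by
      have hd : ((single A).obj X).obj.d 0 (0 + 1) = 0 := single_d ..
      change f.map _ ≫ f.map (((single A).obj X).obj.d 0 (0 + 1)) = 0
      rw [hd, f.map_zero, comp_zero])

lemma toSingleCycles_i (f : A ⥤ B) [f.Additive] (X : A) :
    toSingleCycles f X ≫ (f.mapCochainComplexPlus.obj ((single A).obj X)).obj.iCycles 0 =
      f.map (singleZero X).inv :=
  HomologicalComplex.liftCycles_i _ _ _ _ _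

/-- The morphism from `f X` to the cohomology of degree `0` of `Rf X`. -/
def toDirectImage (f : A ⥤ B) [f.Additive] (X : A) :
    f.obj X ⟶ (homologyFunctor B 0).obj (f.rightDerivedFunctorPlus.obj (Q.obj ((single A).obj X))) :=
  toSingleCycles f X ≫ cyclesToHomology (f.mapCochainComplexPlus.obj ((single A).obj X)) 0 ≫
    (homologyFunctor B 0).map (derivedUnit f ((single A).obj X))

lemma toSingleCycles_cyclesTensor (π : CupPairing f g h) (X Y : A) :
    (toSingleCycles f X ⊗ₘ toSingleCycles g Y) ≫
        cyclesTensor (f.mapCochainComplexPlus.obj ((single A).obj X))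
          (g.mapCochainComplexPlus.obj ((single A).obj Y)) 0 0 0 (add_zero 0) ≫
        HomologicalComplex.cyclesMap (cupComplex π ((single A).obj X) ((single A).obj Y) ≫
          h.mapCochainComplexPlus.map (tensorSingle X Y)).hom 0 =
      π.hom X Y ≫ toSingleCycles h (X ⊗ Y) := by
  rw [← cancel_mono ((h.mapCochainComplexPlus.obj ((single A).obj (X ⊗ Y))).obj.iCycles 0),
    Category.assoc, Category.assoc, Category.assoc, HomologicalComplex.cyclesMap_i,
    toSingleCycles_i, reassoc_of% (cyclesTensor_i (f.mapCochainComplexPlus.obj ((single A).obj X))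
          (g.mapCochainComplexPlus.obj ((single A).obj Y)) 0 0 0 (add_zero 0)),
    ← Category.assoc, MonoidalCategory.tensorHom_comp_tensorHom, toSingleCycles_i,
    toSingleCycles_i]
  have h₁ := inc_cupComplex π ((single A).obj X) ((single A).obj Y) 0 0 0 (add_zero 0)
  have h₂ := congr_arg h.map (inc_tensorSingle X Y)
  have h₃ := π.hom_naturality (singleZero X).inv (singleZero Y).inv
  refine (congr_arg (_ ≫ ·) (((reassoc_of% h₁) _).trans ((Category.assoc _ _ _).trans
    (congr_arg (_ ≫ ·) ((h.map_comp _ _).symm.trans h₂))))).trans ?_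
  refine ((reassoc_of% h₃) _).trans (congr_arg (_ ≫ ·) ?_)
  rw [← h.map_comp, ← Category.assoc, MonoidalCategory.tensorHom_comp_tensorHom,
    Iso.inv_hom_id, Iso.inv_hom_id, id_tensorHom_id, Category.id_comp]

/-- Canonicity replaces the exterior product by the product of cycles, and `Extends` replaces `Φ` by
the pairing of complexes; in degree `0` what remains is `π`. -/
lemma objectCup_zero {α : HomologyPairing (C := B)} (hα : α.IsCanonical)
    {Φ : DerivedCupPairing f g h} {π : CupPairing f g h} (hΦ : Φ.Extends π) (X Y : A) :
    (toDirectImage f X ⊗ₘ toDirectImage g Y) ≫ objectCup α Φ 0 0 0 (add_zero 0) X Y =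
      π.hom X Y ≫ toDirectImage h (X ⊗ Y) := by
  unfold toDirectImage
  rw [← MonoidalCategory.tensorHom_comp_tensorHom, ← MonoidalCategory.tensorHom_comp_tensorHom]
  have h₁ := α.hom_naturality 0 0 0 (add_zero 0) (derivedUnit f ((single A).obj X))
    (derivedUnit g ((single A).obj Y))
  have h₂ := congr_arg (homologyFunctor B 0).map
    (hΦ.derivedUnit_hom ((single A).obj X) ((single A).obj Y))
  have h₃ := derivedUnit_naturality h (tensorSingle X Y)
  have h₄ := hα.cyclesToHomology_hom (f.mapCochainComplexPlus.obj ((single A).obj X))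
    (g.mapCochainComplexPlus.obj ((single A).obj Y)) 0 0 0 (add_zero 0)
  have h₅ := cyclesToHomology_naturality (cupComplex π ((single A).obj X) ((single A).obj Y) ≫
          h.mapCochainComplexPlus.map (tensorSingle X Y)) 0
  have h₆ : objectCup α Φ 0 0 0 (add_zero 0) X Y = α.hom 0 0 0 (add_zero 0) _ _ ≫
      (homologyFunctor B 0).map (Φ.hom _ _) ≫ (homologyFunctor B 0).map
        (h.rightDerivedFunctorPlus.map (toTensor ((single A).obj X) ((single A).obj Y))) ≫
      (homologyFunctor B 0).map
        (h.rightDerivedFunctorPlus.map (Q.map (tensorSingle X Y))) := by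
    unfold objectCup derivedCup directImageMap
    rw [← Functor.map_comp (homologyFunctor B 0) (h.rightDerivedFunctorPlus.map _),
      ← Functor.map_comp h.rightDerivedFunctorPlus, Category.assoc]
    rfl
  simp only [Functor.map_comp] at h₂
  rw [h₆, Category.assoc, Category.assoc, reassoc_of% h₁, reassoc_of% h₂, reassoc_of% h₄,
    ← Functor.map_comp (homologyFunctor B 0) (derivedUnit h _), ← h₃,
    Functor.map_comp (homologyFunctor B 0) (Q.map _)]
  rw [Q.map_comp, Functor.map_comp] at h₅
  rw [← reassoc_of% h₅, reassoc_of% (toSingleCycles_cyclesTensor π X Y)]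

end Zero

variable [SymmetricCategory A] [∀ X : A, PreservesFiniteColimits (tensorLeft X)]
  [SymmetricCategory B] [∀ X : B, PreservesFiniteColimits (tensorLeft X)]
  [hB : Fact (HasFiniteTorDimension B)] [hA : Fact (HasFiniteTorDimension A)]
  {f' g' : B ⥤ A}
  [f'.Additive] [PreservesFiniteLimits f'] [PreservesFiniteColimits f']
  [g'.Additive] [PreservesFiniteLimits g'] [PreservesFiniteColimits g']

/-- Only the relation `hφ` between the outer terms is needed, not a morphism of sequences; in this
form the swapped pairing can use it too. -/
lemma objectCup_connecting_left {α : HomologyPairing (C := B)} (hα : α.IsCanonical)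
    {Φ : DerivedCupPairing f g h} {π : CupPairing f g h} (hΦ : Φ.Extends π) (adjf : f' ⊣ f)
    (adjg : g' ⊣ g) (hf' : ∀ P, IsFlat P → IsFlat (f'.obj P))
    (hg' : ∀ P, IsFlat P → IsFlat (g'.obj P)) (p p' q n n' : ℤ) (hpq : p + q = n)
    (hpq' : p' + q = n') (hp : 1 + p = p') (hn : 1 + n = n') {S T : ShortComplex A}
    (hS : S.ShortExact) (hT : T.ShortExact) (Y : A) (φ₁ : S.X₁ ⊗ Y ⟶ T.X₁)
    (φ₃ : S.X₃ ⊗ Y ⟶ T.X₃)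
    (hφ : derivedTensorSingle S.X₃ Y ≫ Q.map ((single A).map φ₃) ≫ derivedδ hT =
      derivedTensorMap (derivedδ hS) (𝟙 (Q.obj ((single A).obj Y))) ≫
        derivedTensorShift (Q.obj ((single A).obj S.X₁)) (Q.obj ((single A).obj Y)) ≫
        (derivedTensorSingle S.X₁ Y ≫ Q.map ((single A).map φ₁))⟦(1 : ℤ)⟧') :
    objectCup α Φ p q n hpq S.X₃ Y ≫ directImageMap h n (Q.map ((single A).map φ₃)) ≫
        connectingMap h (derivedδ hT) n n' hn =
      connectingMap f (derivedδ hS) p p' hp ▷ (homologyFunctor B q).obj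
          (g.rightDerivedFunctorPlus.obj (Q.obj ((single A).obj Y))) ≫
        objectCup α Φ p' q n' hpq' S.X₁ Y ≫
          directImageMap h n' (Q.map ((single A).map φ₁)) := by
  have h₁ := derivedCup_connectingMap hα hΦ adjf adjg hf' hg' (derivedδ hS)
    (Q.obj ((single A).obj Y)) p p' q n n' hpq hpq' hp hn
  unfold objectCup
  rw [Category.assoc, Category.assoc, ← reassoc_of% h₁, ← directImageMap_comp,
    connectingMap_directImageMap, Category.assoc, ← hφ, directImageMap_connectingMap,
    directImageMap_connectingMap]

lemma inducedCup_isCompatibleLeft {α : HomologyPairing (C := B)} (hα : α.IsCanonical)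
    {Φ : DerivedCupPairing f g h} {π : CupPairing f g h} (hΦ : Φ.Extends π) (adjf : f' ⊣ f)
    (adjg : g' ⊣ g) (hf' : ∀ P, IsFlat P → IsFlat (f'.obj P))
    (hg' : ∀ P, IsFlat P → IsFlat (g'.obj P)) : (inducedCup α Φ).IsCompatibleLeft := by
  intro r s S T hS hT Y φ
  rw [inducedCup_eq, inducedCup_eq]
  exact objectCup_connecting_left hα hΦ adjf adjg hf' hg' r (r + 1 : ℕ) s (r + s)
    ((r + 1 : ℕ) + s) rfl rfl (by push_cast; ring) (by push_cast; ring) hS hT Y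
    φ.τ₁ φ.τ₃ (derivedTensorSingle_derivedδ Y φ hS hT)

end ObjectCup

open DerivedCategory.Plus (Q Qh homologyFunctor)
open tensorComplex (braid inc_braid braid_naturality)

/-! ### The symmetry of the derived tensor product -/

section DerivedBraid

lemma negOnePow_smul_negOnePow_smul {M : Type*} [AddCommGroup M] (p q : ℤ) (x : M) :
    (q * p).negOnePow • (p * q).negOnePow • x = x := by
  rw [smul_smul, mul_comm q p, Int.units_mul_self, one_smul]

variable {C : Type u} [Category.{v} C] [Abelian C] [MonoidalCategory C] [MonoidalPreadditive C]
  [SymmetricCategory C]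

lemma braid_tensorSingle (X Y : C) :
    braid ((single C).obj X) ((single C).obj Y) ≫ tensorSingle Y X =
      tensorSingle X Y ≫ (single C).map (β_ X Y).hom := by
  ext n
  by_cases hn : n = 0
  · subst hn
    refine tensorComplex_single_hom_ext ?_
    have h₁ := inc_braid ((single C).obj X) ((single C).obj Y) 0 0 0 (add_zero 0)
    rw [mul_zero, Int.negOnePow_zero, one_smul] at h₁
    have h₂ : ((single C).map (β_ X Y).hom).hom.f 0 =
        (singleZero (X ⊗ Y)).hom ≫ (β_ X Y).hom ≫ (singleZero (Y ⊗ X)).inv :=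
      HomologicalComplex.single_map_f_self (.up ℤ) 0 (β_ X Y).hom
    refine ((reassoc_of% h₁) _).trans ((congr_arg (_ ≫ ·) (inc_tensorSingle Y X)).trans ?_)
    refine Eq.symm (((reassoc_of% (inc_tensorSingle X Y)) _).trans ?_)
    refine (congr_arg (_ ≫ ·) (congr_arg (_ ≫ ·) h₂)).trans ?_
    rw [Iso.inv_hom_id_assoc, BraidedCategory.braiding_naturality_assoc]
  · exact (isZero_single (Y ⊗ X) n hn).eq_of_tgt _ _

variable [HasDerivedCategory.{w} C]

lemma braid_cyclesTensor (K L : CochainComplex.Plus C) (p q n : ℤ) (h : p + q = n) :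
    (β_ (L.obj.cycles q) (K.obj.cycles p)).hom ≫ cyclesTensor K L p q n h =
      (p * q).negOnePow • (cyclesTensor L K q p n (by omega) ≫
        HomologicalComplex.cyclesMap (braid L K).hom n) := by
  rw [← cancel_mono ((tensorComplex K L).obj.iCycles n), Category.assoc, cyclesTensor_i,
    Linear.units_smul_comp, Category.assoc, HomologicalComplex.cyclesMap_i,
    reassoc_of% (cyclesTensor_i L K q p n (by omega)), inc_braid, Linear.comp_units_smul,
    mul_comm q p, smul_smul, Int.units_mul_self, one_smul,
    BraidedCategory.braiding_naturality_assoc]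

variable [HasDerivedTensor C]
  [∀ X : C, PreservesFiniteColimits (tensorLeft X)] [hC : Fact (HasFiniteTorDimension C)]

variable (C) in
lemma exists_derivedBraid :
    ∃ γ : CategoryTheory.Prod.swap (DerivedCategory.Plus C) (DerivedCategory.Plus C) ⋙ derivedTensor C ⟶
        derivedTensor C ⋙ 𝟭 (DerivedCategory.Plus C),
      ∀ K L : CochainComplex.Plus C, γ.app (Q.obj K, Q.obj L) ≫ (𝟭 _).map (toTensor K L) =
        toTensor L K ≫ Q.map (braid L K) := by
  refine exists_derivedTensor_lift (N := 𝟭 (DerivedCategory.Plus C)) _ ?_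
  intro K K' L L' k l
  refine ((reassoc_of% (toTensor_naturality l k)) _).trans ?_
  rw [← Q.map_comp, braid_naturality, Q.map_comp]
  exact (Category.assoc _ _ _).symm

/-- The symmetry of the derived tensor product. -/
def derivedBraid (X Y : DerivedCategory.Plus C) : derivedTensorObj X Y ⟶ derivedTensorObj Y X :=
  (exists_derivedBraid C).choose.app (Y, X)

lemma derivedBraid_naturality {X X' Y Y' : DerivedCategory.Plus C} (a : X ⟶ X') (b : Y ⟶ Y') :
    derivedTensorMap a b ≫ derivedBraid X' Y' = derivedBraid X Y ≫ derivedTensorMap b a :=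
  (exists_derivedBraid C).choose.naturality (Prod.mkHom b a)

lemma derivedBraid_toTensor (K L : CochainComplex.Plus C) :
    derivedBraid (Q.obj K) (Q.obj L) ≫ toTensor L K = toTensor K L ≫ Q.map (braid K L) :=
  (exists_derivedBraid C).choose_spec L K

lemma derivedBraid_derivedTensorSingle (X Y : C) :
    derivedBraid (Q.obj ((single C).obj X)) (Q.obj ((single C).obj Y)) ≫ derivedTensorSingle Y X =
      derivedTensorSingle X Y ≫ Q.map ((single C).map (β_ X Y).hom) := by
  have e (X Y : C) : derivedTensorSingle X Y =
    toTensor ((single C).obj X) ((single C).obj Y) ≫ Q.map (tensorSingle X Y) := rfl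
  rw [e, e, reassoc_of% (derivedBraid_toTensor ((single C).obj X) ((single C).obj Y)),
    ← Q.map_comp, braid_tensorSingle, Q.map_comp, Category.assoc]

/-- The exterior product is compatible with the symmetry, up to a sign. -/
lemma HomologyPairing.IsCanonical.braid_hom {α : HomologyPairing (C := C)}
    (hα : α.IsCanonical) (X Y : DerivedCategory.Plus C) (p q n : ℤ) (h : p + q = n) :
    (β_ ((homologyFunctor C q).obj Y) ((homologyFunctor C p).obj X)).hom ≫ α.hom p q n h X Y =
      (p * q).negOnePow • (α.hom q p n (by omega) Y X ≫
        (homologyFunctor C n).map (derivedBraid Y X)) := by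
  let G : DerivedCategory.Plus C × DerivedCategory.Plus C ⥤ C :=
    CategoryTheory.Prod.swap (DerivedCategory.Plus C) (DerivedCategory.Plus C) ⋙
      (homologyFunctor C q).prod (homologyFunctor C p) ⋙ tensor C
  let γ₁ : G ⟶ derivedTensor C ⋙ homologyFunctor C n :=
    { app X := (β_ ((homologyFunctor C q).obj X.2) ((homologyFunctor C p).obj X.1)).hom ≫
        α.hom p q n h X.1 X.2
      naturality X Y φ := by
        have h₁ : ((homologyFunctor C q).map φ.2 ⊗ₘ (homologyFunctor C p).map φ.1) ≫
            (β_ ((homologyFunctor C q).obj Y.2) ((homologyFunctor C p).obj Y.1)).hom =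
            (β_ ((homologyFunctor C q).obj X.2) ((homologyFunctor C p).obj X.1)).hom ≫
              ((homologyFunctor C p).map φ.1 ⊗ₘ (homologyFunctor C q).map φ.2) :=
          BraidedCategory.braiding_naturality _ _
        refine ((reassoc_of% h₁) _).trans ?_
        rw [α.hom_naturality]
        exact (Category.assoc _ _ _).symm }
  let γ₂ : G ⟶ derivedTensor C ⋙ homologyFunctor C n :=
    { app X := (p * q).negOnePow • (α.hom q p n (by omega) X.2 X.1 ≫
        (homologyFunctor C n).map (derivedBraid X.2 X.1))
      naturality X Y φ := by
        have h₁ := α.hom_naturality q p n (by omega) φ.2 φ.1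
        have h₂ := congr_arg (homologyFunctor C n).map (derivedBraid_naturality φ.2 φ.1)
        rw [Functor.map_comp, Functor.map_comp] at h₂
        refine (Linear.comp_units_smul _ _ _).trans (Eq.trans ?_
          (Linear.units_smul_comp _ _ _).symm)
        refine congr_arg (_ • ·) (((reassoc_of% h₁) _).trans ?_)
        exact (congr_arg (_ ≫ ·) h₂).trans (Category.assoc _ _ _).symm }
  have hγ : γ₁ = γ₂ := derivedTensor_hom_ext fun K L => by
    have : Epi (cyclesToHomology L q ⊗ₘ cyclesToHomology K p) := epi_tensorHom _ _
    refine (cancel_epi (cyclesToHomology L q ⊗ₘ cyclesToHomology K p)).1 ?_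
    have h₁ := congr_arg (homologyFunctor C n).map (derivedBraid_toTensor L K)
    rw [Functor.map_comp, Functor.map_comp] at h₁
    trans (β_ (L.obj.cycles q) (K.obj.cycles p)).hom ≫ cyclesTensor K L p q n h ≫
      cyclesToHomology (tensorComplex K L) n
    · refine (congr_arg (_ ≫ ·) (Category.assoc _ _ _)).trans ?_
      rw [← hα.cyclesToHomology_hom]
      exact BraidedCategory.braiding_naturality_assoc _ _ _
    · rw [reassoc_of% (braid_cyclesTensor K L p q n h)]
      refine Eq.symm ((congr_arg (_ ≫ ·) (Linear.units_smul_comp _ _ _)).trans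
        ((Linear.comp_units_smul _ _ _).trans (Eq.trans ?_ (Linear.units_smul_comp _ _ _).symm)))
      refine congr_arg (_ • ·) ?_
      rw [Category.assoc, Category.assoc, cyclesToHomology_naturality]
      refine (congr_arg (_ ≫ ·) (congr_arg (_ ≫ ·) h₁)).trans ?_
      exact (reassoc_of% (hα.cyclesToHomology_hom L K q p n (by omega))) _
  exact NatTrans.congr_app hγ (X, Y)

end DerivedBraid

/-! ### Exchanging the variables of the cup product -/

section SwapCup

variable {A : Type u₁} [Category.{v₁} A] [Abelian A] [MonoidalCategory A] [MonoidalPreadditive A]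
  [SymmetricCategory A]
  {B : Type u₂} [Category.{v₂} B] [Abelian B] [MonoidalCategory B] [MonoidalPreadditive B]
  [SymmetricCategory B]
  {f g h : A ⥤ B} [f.Additive] [g.Additive] [h.Additive] (π : CupPairing f g h)

/-- The cup-pairing with the roles of the two variables exchanged. -/
def CupPairing.swap : CupPairing g f h where
  app X := (β_ (g.obj X.1) (f.obj X.2)).hom ≫ π.hom X.2 X.1 ≫ h.map (β_ X.2 X.1).hom
  naturality X Y φ := by
    have h₁ := π.hom_naturality φ.2 φ.1
    have h₂ := congr_arg h.map (BraidedCategory.braiding_naturality φ.2 φ.1)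
    rw [h.map_comp, h.map_comp] at h₂
    refine (BraidedCategory.braiding_naturality_assoc _ _ _).trans ?_
    refine (congr_arg (_ ≫ ·) (((reassoc_of% h₁) _).trans (congr_arg (_ ≫ ·) h₂))).trans ?_
    exact (congr_arg (_ ≫ ·) (Category.assoc _ _ _).symm).trans (Category.assoc _ _ _).symm

lemma CupPairing.swap_hom (X Y : A) :
    π.swap.hom X Y = (β_ (g.obj X) (f.obj Y)).hom ≫ π.hom Y X ≫ h.map (β_ Y X).hom := rfl

/-- The symmetry is applied once in each category, so the two signs `(-1)^(pq)` cancel and the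
swapped pairing carries none. -/
lemma braid_cupComplex (K L : CochainComplex.Plus A) :
    braid (g.mapCochainComplexPlus.obj L) (f.mapCochainComplexPlus.obj K) ≫ cupComplex π K L ≫
        h.mapCochainComplexPlus.map (braid K L) = cupComplex π.swap L K := by
  ext n
  refine tensorComplex.hom_ext fun q p hpq => ?_
  have h₁ := inc_braid (g.mapCochainComplexPlus.obj L) (f.mapCochainComplexPlus.obj K) q p n hpq
  have h₂ := inc_cupComplex π K L p q n (by omega)
  have h₃ := congr_arg h.map (inc_braid K L p q n (by omega))
  have h₄ := inc_cupComplex π.swap L K q p n hpq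
  rw [h.map_comp, Functor.map_units_smul, h.map_comp] at h₃
  refine Eq.trans ?_ h₄.symm
  refine ((reassoc_of% h₁) _).trans ((Linear.units_smul_comp _ _ _).trans ?_)
  have h₅ : ∀ x, (π.hom (K.obj.X p) (L.obj.X q) ≫
      h.map (tensorComplex.inc K L p q n (by omega))) = x → x ≫ h.map ((braid K L).hom.f n) =
      (p * q).negOnePow • (π.hom (K.obj.X p) (L.obj.X q) ≫ h.map (β_ _ _).hom ≫
        h.map (tensorComplex.inc L K q p n hpq)) := by
    rintro _ rfl
    rw [Category.assoc, h₃, Linear.comp_units_smul]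
  have h₆ := h₅ _ h₂.symm
  refine (congr_arg (_ • ·) ((Category.assoc _ _ _).trans (congr_arg (_ ≫ ·)
    ((Category.assoc _ _ _).symm.trans h₆)))).trans ?_
  refine (congr_arg (_ • ·) (Linear.comp_units_smul _ _ _)).trans ?_
  refine (negOnePow_smul_negOnePow_smul p q _).trans ?_
  rw [CupPairing.swap_hom, Category.assoc, Category.assoc]
  rfl

variable [HasDerivedCategory.{w₁} A] [EnoughInjectives A] [HasDerivedTensor A]
  [HasDerivedCategory.{w₂} B] [HasDerivedTensor B]
  [∀ X : A, PreservesFiniteColimits (tensorLeft X)]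
  [∀ X : B, PreservesFiniteColimits (tensorLeft X)]
  [hB : Fact (HasFiniteTorDimension B)] [hA : Fact (HasFiniteTorDimension A)]

/-- The derived cup-pairing with the roles of the two variables exchanged. -/
def DerivedCupPairing.swap (Φ : DerivedCupPairing f g h) : DerivedCupPairing g f h where
  app X := derivedBraid (g.rightDerivedFunctorPlus.obj X.1) (f.rightDerivedFunctorPlus.obj X.2) ≫
    Φ.hom X.2 X.1 ≫ h.rightDerivedFunctorPlus.map (derivedBraid X.2 X.1)
  naturality X Y φ := by
    have h₁ := Φ.hom_naturality φ.2 φ.1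
    have h₂ := congr_arg h.rightDerivedFunctorPlus.map (derivedBraid_naturality φ.2 φ.1)
    rw [Functor.map_comp, Functor.map_comp] at h₂
    have h₃ := derivedBraid_naturality (g.rightDerivedFunctorPlus.map φ.1)
      (f.rightDerivedFunctorPlus.map φ.2)
    refine ((reassoc_of% h₃) _).trans ?_
    rw [reassoc_of% h₁, h₂]
    exact (congr_arg (_ ≫ ·) (Category.assoc _ _ _).symm).trans (Category.assoc _ _ _).symm

lemma DerivedCupPairing.swap_hom (Φ : DerivedCupPairing f g h) (X Y : DerivedCategory.Plus A) :
    Φ.swap.hom X Y =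
      derivedBraid (g.rightDerivedFunctorPlus.obj X) (f.rightDerivedFunctorPlus.obj Y) ≫
        Φ.hom Y X ≫ h.rightDerivedFunctorPlus.map (derivedBraid Y X) := rfl

variable {π}

lemma DerivedCupPairing.Extends.swap {Φ : DerivedCupPairing f g h} (hΦ : Φ.Extends π) :
    Φ.swap.Extends π.swap := by
  intro L K
  change derivedTensorMap (derivedUnit g L) (derivedUnit f K) ≫ Φ.swap.hom (Q.obj L) (Q.obj K) ≫
    h.rightDerivedFunctorPlus.map (toTensor L K) =
      toTensor (g.mapCochainComplexPlus.obj L) (f.mapCochainComplexPlus.obj K) ≫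
        Q.map (cupComplex π.swap L K) ≫ derivedUnit h (tensorComplex L K)
  have h₁ := congr_arg h.rightDerivedFunctorPlus.map (derivedBraid_toTensor K L)
  rw [Functor.map_comp, Functor.map_comp] at h₁
  rw [Φ.swap_hom, Category.assoc, Category.assoc,
    reassoc_of% (derivedBraid_naturality (derivedUnit g L) (derivedUnit f K)), h₁,
    reassoc_of% (hΦ.derivedUnit_hom K L),
    reassoc_of% (derivedBraid_toTensor (g.mapCochainComplexPlus.obj L)
      (f.mapCochainComplexPlus.obj K)), ← derivedUnit_naturality, ← braid_cupComplex, Q.map_comp,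
    Q.map_comp, Category.assoc, Category.assoc]

/-- The sign comes entirely from the exterior product, by `braid_hom`; exchanging the variables of
`Φ` adds none. -/
lemma objectCup_swap {α : HomologyPairing (C := B)} (hα : α.IsCanonical)
    (Φ : DerivedCupPairing f g h) (p q n : ℤ) (hpq : p + q = n) (X Y : A) :
    objectCup α Φ.swap q p n (by omega) Y X =
      (p * q).negOnePow • ((β_ _ _).hom ≫ objectCup α Φ p q n hpq X Y ≫
        directImageMap h n (Q.map ((single A).map (β_ X Y).hom))) := by
  have h₁ := hα.braid_hom (f.rightDerivedFunctorPlus.obj (Q.obj ((single A).obj X)))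
    (g.rightDerivedFunctorPlus.obj (Q.obj ((single A).obj Y))) p q n hpq
  have h₂ := congr_arg ((q * p).negOnePow • ·) h₁
  have h₂ := h₂.trans (negOnePow_smul_negOnePow_smul p q _)
  rw [mul_comm q p] at h₂
  have h₃ := congr_arg (directImageMap h n) (derivedBraid_derivedTensorSingle X Y)
  rw [directImageMap_comp, directImageMap_comp] at h₃
  unfold objectCup derivedCup
  rw [Φ.swap_hom, Functor.map_comp, Functor.map_comp, Category.assoc, Category.assoc,
    Category.assoc, ← reassoc_of% h₂, Linear.units_smul_comp]
  refine congr_arg (_ • ·) ?_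
  rw [Category.assoc, Category.assoc, Category.assoc]
  refine congr_arg (_ ≫ ·) (congr_arg (_ ≫ ·) (congr_arg (_ ≫ ·) ?_))
  exact h₃

variable {f' g' : B ⥤ A}
  [f'.Additive] [PreservesFiniteLimits f'] [PreservesFiniteColimits f']
  [g'.Additive] [PreservesFiniteLimits g'] [PreservesFiniteColimits g']

/-- The cup product is compatible with connecting morphisms in the second variable. -/
lemma objectCup_connecting_right {α : HomologyPairing (C := B)} (hα : α.IsCanonical)
    {Φ : DerivedCupPairing f g h} {π : CupPairing f g h} (hΦ : Φ.Extends π) (adjf : f' ⊣ f)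
    (adjg : g' ⊣ g) (hf' : ∀ P, IsFlat P → IsFlat (f'.obj P))
    (hg' : ∀ P, IsFlat P → IsFlat (g'.obj P)) (p q q' n n' : ℤ) (hpq : p + q = n)
    (hpq' : p + q' = n') (hq : 1 + q = q') (hn : 1 + n = n') {S T : ShortComplex A}
    (hS : S.ShortExact) (hT : T.ShortExact) (X : A) (φ₁ : X ⊗ S.X₁ ⟶ T.X₁)
    (φ₃ : X ⊗ S.X₃ ⟶ T.X₃)
    (hφ : derivedTensorSingle S.X₃ X ≫ Q.map ((single A).map ((β_ S.X₃ X).hom ≫ φ₃)) ≫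
        derivedδ hT =
      derivedTensorMap (derivedδ hS) (𝟙 (Q.obj ((single A).obj X))) ≫
        derivedTensorShift (Q.obj ((single A).obj S.X₁)) (Q.obj ((single A).obj X)) ≫
        (derivedTensorSingle S.X₁ X ≫
          Q.map ((single A).map ((β_ S.X₁ X).hom ≫ φ₁)))⟦(1 : ℤ)⟧') :
    objectCup α Φ p q n hpq X S.X₃ ≫ directImageMap h n (Q.map ((single A).map φ₃)) ≫
        connectingMap h (derivedδ hT) n n' hn =
      p.negOnePow • ((homologyFunctor B p).obj
          (f.rightDerivedFunctorPlus.obj (Q.obj ((single A).obj X))) ◁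
            connectingMap g (derivedδ hS) q q' hq ≫
        objectCup α Φ p q' n' hpq' X S.X₁ ≫
          directImageMap h n' (Q.map ((single A).map φ₁))) := by
  -- The statement for the first variable is applied to the swapped pairing and translated back by
  -- `objectCup_swap` on both sides.
  have h₁ := objectCup_connecting_left hα hΦ.swap adjg adjf hg' hf' q q' p n n' (by omega)
    (by omega) hq hn hS hT X _ _ hφ
  rw [objectCup_swap hα Φ p q n hpq X S.X₃, objectCup_swap hα Φ p q' n' hpq' X S.X₁] at h₁
  have e (m : ℤ) {Z W : A} (φ : X ⊗ Z ⟶ W) :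
      directImageMap h m (Q.map ((single A).map (β_ X Z).hom)) ≫
        directImageMap h m (Q.map ((single A).map ((β_ Z X).hom ≫ φ))) =
      directImageMap h m (Q.map ((single A).map φ)) := by
    rw [← directImageMap_comp, ← Q.map_comp, ← Functor.map_comp (single A),
      SymmetricCategory.symmetry_assoc]
  simp only [Linear.units_smul_comp, Linear.comp_units_smul, Category.assoc] at h₁
  rw [reassoc_of% (e n φ₃), e n' φ₁, BraidedCategory.braiding_naturality_left_assoc] at h₁
  have h₂ := (cancel_epi _).1 ((Linear.comp_units_smul _ _ _).trans
    (h₁.trans (Linear.comp_units_smul _ _ _).symm))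
  rw [← negOnePow_smul_negOnePow_smul p q (_ ≫ _ ≫ connectingMap h (derivedδ hT) n n' hn),
    h₂, smul_smul, ← Int.negOnePow_add]
  congr 1
  -- The two exchanges contribute `p * q` and `p * (q + 1)`, whose sum differs from `p` by `2 * (p *
  -- q)`.
  rw [Int.negOnePow_eq_iff]
  exact ⟨p * q, by subst hq; ring⟩

/-- The morphism of short complexes obtained by composition with the symmetry. -/
def braidShortComplex {S T : ShortComplex A} (X : A) (φ : S.map (tensorLeft X) ⟶ T) :
    S.map (tensorRight X) ⟶ T where
  τ₁ := (β_ S.X₁ X).hom ≫ φ.τ₁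
  τ₂ := (β_ S.X₂ X).hom ≫ φ.τ₂
  τ₃ := (β_ S.X₃ X).hom ≫ φ.τ₃
  comm₁₂ := (Category.assoc _ _ _).trans ((congr_arg (_ ≫ ·) φ.comm₁₂).trans
    (BraidedCategory.braiding_naturality_left_assoc S.f X φ.τ₂).symm)
  comm₂₃ := (Category.assoc _ _ _).trans ((congr_arg (_ ≫ ·) φ.comm₂₃).trans
    (BraidedCategory.braiding_naturality_left_assoc S.g X φ.τ₃).symm)

lemma negOnePow_smul_eq {M : Type*} [AddCommGroup M] (r : ℕ) (x : M) :
    (r : ℤ).negOnePow • x = (-1 : ℤ) ^ r • x := by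
  rw [Int.negOnePow_def, zpow_natCast, Units.smul_def, Units.val_pow_eq_pow_val]
  rfl

lemma inducedCup_isCompatibleRight {α : HomologyPairing (C := B)} (hα : α.IsCanonical)
    {Φ : DerivedCupPairing f g h} {π : CupPairing f g h} (hΦ : Φ.Extends π) (adjf : f' ⊣ f)
    (adjg : g' ⊣ g) (hf' : ∀ P, IsFlat P → IsFlat (f'.obj P))
    (hg' : ∀ P, IsFlat P → IsFlat (g'.obj P)) : (inducedCup α Φ).IsCompatibleRight := by
  intro r s X S T hS hT φ
  rw [inducedCup_eq, inducedCup_eq]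
  refine Eq.trans ?_ (negOnePow_smul_eq r _)
  exact objectCup_connecting_right hα hΦ adjf adjg hf' hg' r s (s + 1 : ℕ) (r + s)
    (r + (s + 1 : ℕ)) rfl rfl (by push_cast; ring) (by push_cast; ring) hS hT X
    φ.τ₁ φ.τ₃ (derivedTensorSingle_derivedδ X (braidShortComplex X φ) hS hT)

lemma inducedCup_isCupProduct {α : HomologyPairing (C := B)} (hα : α.IsCanonical)
    {Φ : DerivedCupPairing f g h} {π : CupPairing f g h} (hΦ : Φ.Extends π) (adjf : f' ⊣ f)
    (adjg : g' ⊣ g) (hf' : ∀ P, IsFlat P → IsFlat (f'.obj P))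
    (hg' : ∀ P, IsFlat P → IsFlat (g'.obj P)) : (inducedCup α Φ).IsCupProduct π where
  zero X Y := by
    rw [inducedCup_eq]
    exact objectCup_zero hα hΦ X Y
  left r s S hS Y hSY := by
    -- When the tensored sequence is exact it serves as its own comparison sequence, with the
    -- identity as morphism.
    have h₁ := inducedCup_isCompatibleLeft hα hΦ adjf adjg hf' hg' r s S _ hS hSY Y (𝟙 _)
    have e (n : ℤ) (Z : A) : (higherDirectImage h n).map (𝟙 Z) = 𝟙 _ :=
      (higherDirectImage h n).map_id Z
    exact ((congr_arg (_ ≫ ·) (((e _ _) =≫ _).trans (Category.id_comp _))).symm.trans h₁).trans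
      (congr_arg (_ ≫ ·) ((congr_arg (_ ≫ ·) (e _ _)).trans (Category.comp_id _)))
  right r s X S hS hXS := by
    have h₁ := inducedCup_isCompatibleRight hα hΦ adjf adjg hf' hg' r s X S _ hS hXS (𝟙 _)
    have e (n : ℤ) (Z : A) : (higherDirectImage h n).map (𝟙 Z) = 𝟙 _ :=
      (higherDirectImage h n).map_id Z
    exact ((congr_arg (_ ≫ ·) (((e _ _) =≫ _).trans (Category.id_comp _))).symm.trans h₁).trans
      (congr_arg (_ • ·) (congr_arg (_ ≫ ·) ((congr_arg (_ ≫ ·) (e _ _)).trans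
        (Category.comp_id _))))

end SwapCup

open DerivedCategory.Plus (Q Qh homologyFunctor)
open Pretriangulated

/-! ### Long exact sequences of right derived functors -/

section DerivedTriangle

variable {A : Type u₁} [Category.{v₁} A] [Abelian A] [HasDerivedCategory.{w₁} A]
  [EnoughInjectives A] {B : Type u₂} [Category.{v₂} B] [Abelian B] [HasDerivedCategory.{w₂} B]
  (f : A ⥤ B) [f.Additive]

/-- The image of a triangle under a right derived functor. -/
def derivedTriangle (T : Triangle (DerivedCategory.Plus A)) : Triangle (DerivedCategory.Plus B) :=
  Triangle.mk (f.rightDerivedFunctorPlus.map T.mor₁) (f.rightDerivedFunctorPlus.map T.mor₂)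
    (f.rightDerivedFunctorPlus.map T.mor₃ ≫ derivedShift f T.obj₁)

/-- Isomorphic triangles have isomorphic images under a right derived functor. -/
def derivedTriangleIso {T T' : Triangle (DerivedCategory.Plus A)} (e : T ≅ T') :
    derivedTriangle f T ≅ derivedTriangle f T' :=
  Triangle.isoMk _ _ (f.rightDerivedFunctorPlus.mapIso (Triangle.π₁.mapIso e))
    (f.rightDerivedFunctorPlus.mapIso (Triangle.π₂.mapIso e))
    (f.rightDerivedFunctorPlus.mapIso (Triangle.π₃.mapIso e))
    (by
      have h := congr_arg f.rightDerivedFunctorPlus.map e.hom.comm₁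
      rw [Functor.map_comp, Functor.map_comp] at h
      exact h)
    (by
      have h := congr_arg f.rightDerivedFunctorPlus.map e.hom.comm₂
      rw [Functor.map_comp, Functor.map_comp] at h
      exact h)
    (by
      have h := congr_arg f.rightDerivedFunctorPlus.map e.hom.comm₃
      rw [Functor.map_comp, Functor.map_comp] at h
      have h' := derivedShift_naturality f e.hom.hom₁
      refine (Category.assoc _ _ _).trans ((congr_arg (_ ≫ ·) h'.symm).trans ?_)
      exact (Category.assoc _ _ _).symm.trans ((h =≫ _).trans (Category.assoc _ _ _)))

/-- The image under a right derived functor of the triangle given by a triangle of complexes is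
computed by complexes for which the unit is an isomorphism. -/
def derivedTriangleQhIso (T : Triangle (HomotopyCategory.Plus A))
    [IsIso (f.rightDerivedFunctorPlusUnit.app T.obj₁)]
    [IsIso (f.rightDerivedFunctorPlusUnit.app T.obj₂)]
    [IsIso (f.rightDerivedFunctorPlusUnit.app T.obj₃)] :
    (f.mapHomotopyCategoryPlus ⋙ Qh).mapTriangle.obj T ≅ derivedTriangle f (Qh.mapTriangle.obj T) :=
  Triangle.isoMk _ _ (@asIso _ _ _ _ (f.rightDerivedFunctorPlusUnit.app T.obj₁) ‹_›)
    (@asIso _ _ _ _ (f.rightDerivedFunctorPlusUnit.app T.obj₂) ‹_›)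
    (@asIso _ _ _ _ (f.rightDerivedFunctorPlusUnit.app T.obj₃) ‹_›)
    (f.rightDerivedFunctorPlusUnit.naturality T.mor₁)
    (f.rightDerivedFunctorPlusUnit.naturality T.mor₂)
    (by
      have h₁ := f.rightDerivedFunctorPlusUnit.naturality T.mor₃
      have h₂ := rightDerivedFunctorPlusUnit_derivedShift f T.obj₁
      have h₃ := f.rightDerivedFunctorPlus.map_comp (Qh.map T.mor₃)
        ((Qh.commShiftIso (1 : ℤ)).hom.app T.obj₁)
      refine (Category.assoc _ _ _).trans ((congr_arg (_ ≫ ·) h₂.symm).trans ?_)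
      refine ((reassoc_of% h₁) _).trans (congr_arg (_ ≫ ·) ?_)
      exact (Category.assoc _ _ _).symm.trans (h₃.symm =≫ _))

/-- Up to isomorphism the triangle comes from the homotopy category of complexes of injectives,
where `Rf` is computed by applying `f` termwise and distinguished triangles are preserved. -/
lemma derivedTriangle_distinguished (T : Triangle (DerivedCategory.Plus A))
    (hT : T ∈ distTriang (DerivedCategory.Plus A)) :
    derivedTriangle f T ∈ distTriang (DerivedCategory.Plus B) := by
  let i := (InjectiveObject.ι A).mapHomotopyCategoryPlus
  have key (X : DerivedCategory.Plus A) : ∃ K : HomotopyCategory.Plus (InjectiveObject A),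
      CochainComplex.IsKInjective (i.obj K).1.as ∧ Nonempty (Qh.obj (i.obj K) ≅ X) := by
    obtain ⟨n, hn⟩ : ∃ n : ℤ, X.IsGE n := by
      obtain ⟨n, hn⟩ := X.property
      exact ⟨n, (DerivedCategory.Plus.isGE_ι_obj_iff X n).1 hn⟩
    obtain ⟨L, -, e⟩ := DerivedCategory.Plus.exists_injective_nonempty_iso X n
    exact ⟨(HomotopyCategory.Plus.quotient _).obj L, inferInstanceAs (CochainComplex.IsKInjective
      (((InjectiveObject.ι A).mapHomologicalComplex (.up ℤ)).obj L.obj)), e⟩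
  obtain ⟨K, -, ⟨e₁⟩⟩ := key T.obj₁
  obtain ⟨L, hL, ⟨e₂⟩⟩ := key T.obj₂
  -- Morphisms into a K-injective complex are the same in the homotopy and derived categories, so
  -- the first arrow of `T` lifts. A triangle on the lift is isomorphic to `T`, two of its vertices
  -- being already identified.
  obtain ⟨u, hu⟩ := (DerivedCategory.Plus.Qh_map_bijective_of_isKInjective (i.obj K) (i.obj L) hL).2
    (e₁.hom ≫ T.mor₁ ≫ e₂.inv)
  obtain ⟨u, rfl⟩ := i.map_surjective u
  obtain ⟨Z, v, w, h⟩ := distinguished_cocone_triangle u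
  have h' := Qh.map_distinguished _ (i.map_distinguished _ h)
  let e := isoTriangleOfIso₁₂ _ T h' hT e₁ e₂ (by
    change Qh.map (i.map u) ≫ e₂.hom = e₁.hom ≫ T.mor₁
    rw [hu]
    simp)
  refine isomorphic_distinguished _ ?_ _ (derivedTriangleIso f e).symm
  have (X : HomotopyCategory.Plus (InjectiveObject A)) :
      IsIso (f.rightDerivedFunctorPlusUnit.app (i.obj X)) := by
    dsimp [i]
    infer_instance
  have h₁ : IsIso (f.rightDerivedFunctorPlusUnit.app (i.mapTriangle.obj (.mk u v w)).obj₁) := this _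
  have h₂ : IsIso (f.rightDerivedFunctorPlusUnit.app (i.mapTriangle.obj (.mk u v w)).obj₂) := this _
  have h₃ : IsIso (f.rightDerivedFunctorPlusUnit.app (i.mapTriangle.obj (.mk u v w)).obj₃) := this _
  refine isomorphic_distinguished _ ?_ _ (derivedTriangleQhIso f _).symm
  exact (f.mapHomotopyCategoryPlus ⋙ Qh).map_distinguished _ (i.map_distinguished _ h)

/-- The distinguished triangle attached to a short exact sequence. -/
lemma sesTriangle_distinguished {S : ShortComplex A} (hS : S.ShortExact) :
    Triangle.mk (Q.map ((single A).map S.f)) (Q.map ((single A).map S.g)) (derivedδ hS) ∈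
      distTriang (DerivedCategory.Plus A) := by
  refine isomorphic_distinguished _ (DerivedCategory.triangleOfSES_distinguished
    (hS.map_of_exact (HomologicalComplex.single A (ComplexShape.up ℤ) 0))) _ ?_
  refine Triangle.isoMk _ _ (Iso.refl _) (Iso.refl _) (Iso.refl _) ?_ ?_ ?_
  · exact (Category.comp_id _).trans (Category.id_comp _).symm
  · exact (Category.comp_id _).trans (Category.id_comp _).symm
  · refine (congr_arg (_ ≫ ·) ((shiftFunctor _ _).map_id _)).trans ?_
    exact (Category.comp_id _).trans ((ι_derivedδ hS).trans (Category.id_comp _).symm)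

lemma epi_connecting {S : ShortComplex A} (hS : S.ShortExact) (n₀ n₁ : ℤ) (hn : 1 + n₀ = n₁)
    (h0 : IsZero ((higherDirectImage f n₁).obj S.X₂)) : Epi (connecting f hS n₀ n₁ hn) := by
  have h := derivedTriangle_distinguished f _ (sesTriangle_distinguished hS)
  have h' := DerivedCategory.HomologySequence.exact₁ _
    (DerivedCategory.Plus.ι.map_distinguished _ h) n₀ n₁ (by omega)
  exact h'.epi_f (h0.eq_of_tgt _ _)

end DerivedTriangle

open DerivedCategory.Plus (Q Qh homologyFunctor)

/-! ### Vanishing on injectives and cohomology of degree zero -/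

section Effaceable

variable {A : Type u₁} [Category.{v₁} A] [Abelian A] [MonoidalCategory A] [MonoidalPreadditive A]
  [HasDerivedCategory.{w₁} A] [HasDerivedTensor A]

lemma derivedδ_naturality {S T : ShortComplex A} (hS : S.ShortExact) (hT : T.ShortExact)
    (φ : S ⟶ T) :
    derivedδ hS ≫ (Q.map ((single A).map φ.τ₁))⟦(1 : ℤ)⟧' =
      Q.map ((single A).map φ.τ₃) ≫ derivedδ hT := by
  apply DerivedCategory.Plus.ι.map_injective
  have h := DerivedCategory.triangleOfSESδ_naturality
    (hS.map_of_exact (HomologicalComplex.single A (ComplexShape.up ℤ) 0))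
    (hT.map_of_exact (HomologicalComplex.single A (ComplexShape.up ℤ) 0))
    ((HomologicalComplex.single A (ComplexShape.up ℤ) 0).mapShortComplex.map φ)
  have h' := (DerivedCategory.Plus.ι.commShiftIso (1 : ℤ)).hom.naturality
    (Q.map ((single A).map φ.τ₁))
  rw [← cancel_mono ((DerivedCategory.Plus.ι.commShiftIso (1 : ℤ)).hom.app _),
    Functor.map_comp, Functor.map_comp, Category.assoc, Category.assoc, ι_derivedδ]
  refine (congr_arg (_ ≫ ·) h').trans ?_
  refine ((Category.assoc _ _ _).symm.trans (ι_derivedδ hS =≫ _)).trans ?_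
  exact h

variable [EnoughInjectives A] {B : Type u₂} [Category.{v₂} B] [Abelian B]
  [MonoidalCategory B] [MonoidalPreadditive B] [HasDerivedCategory.{w₂} B] [HasDerivedTensor B]
  (f : A ⥤ B) [f.Additive]

lemma connecting_naturality {S T : ShortComplex A} (hS : S.ShortExact) (hT : T.ShortExact)
    (φ : S ⟶ T) (n₀ n₁ : ℤ) (hn : 1 + n₀ = n₁) :
    connecting f hS n₀ n₁ hn ≫ (higherDirectImage f n₁).map φ.τ₁ =
      (higherDirectImage f n₀).map φ.τ₃ ≫ connecting f hT n₀ n₁ hn := by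
  have h₁ := connectingMap_directImageMap (f := f) (derivedδ hS) (Q.map ((single A).map φ.τ₁))
    n₀ n₁ hn
  have h₂ := directImageMap_connectingMap (f := f) (Q.map ((single A).map φ.τ₃)) (derivedδ hT)
    n₀ n₁ hn
  exact h₁.trans ((congr_arg (connectingMap f · n₀ n₁ hn) (derivedδ_naturality hS hT φ)).trans
    h₂.symm)

lemma isZero_homology_of_isZero (K : CochainComplex.Plus B) (n : ℤ) (h : IsZero (K.obj.X n)) :
    IsZero ((homologyFunctor B n).obj (Q.obj K)) := by
  have h' : IsZero (K.obj.homology n) := by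
    rw [← HomologicalComplex.exactAt_iff_isZero_homology]
    exact ShortComplex.exact_of_isZero_X₂ _ h
  exact h'.of_iso ((DerivedCategory.homologyFunctorFactors B n).app K.obj)

lemma isZero_higherDirectImage (I : A) [Injective I] (n : ℤ) (hn : n ≠ 0) :
    IsZero ((higherDirectImage f n).obj I) := by
  have (i : ℤ) : Injective (((single A).obj I).obj.X i) := by
    by_cases hi : i = 0
    · subst hi
      exact Injective.of_iso (singleZero I).symm inferInstance
    · exact Injective.of_iso (isZero_single I i hi).isoZero.symm inferInstance
  have h := isZero_homology_of_isZero (f.mapCochainComplexPlus.obj ((single A).obj I)) n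
    (f.map_isZero (isZero_single I n hn))
  exact h.of_iso ((homologyFunctor B n).mapIso (asIso (derivedUnit f ((single A).obj I)))).symm

lemma toSingleCycles_naturality {X Y : A} (a : X ⟶ Y) :
    f.map a ≫ toSingleCycles f Y = toSingleCycles f X ≫
      HomologicalComplex.cyclesMap (f.mapCochainComplexPlus.map ((single A).map a)).hom 0 := by
  rw [← cancel_mono ((f.mapCochainComplexPlus.obj ((single A).obj Y)).obj.iCycles 0),
    Category.assoc, Category.assoc, HomologicalComplex.cyclesMap_i, toSingleCycles_i,
    reassoc_of% (toSingleCycles_i f X)]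
  have h : ((single A).map a).hom.f 0 = (singleZero X).hom ≫ a ≫ (singleZero Y).inv :=
    HomologicalComplex.single_map_f_self (.up ℤ) 0 a
  have h' : (singleZero X).inv ≫ ((single A).map a).hom.f 0 = a ≫ (singleZero Y).inv := by
    rw [h, Iso.inv_hom_id_assoc]
  exact (f.map_comp _ _).symm.trans ((congr_arg f.map h'.symm).trans (f.map_comp _ _))

lemma toDirectImage_naturality {X Y : A} (a : X ⟶ Y) :
    f.map a ≫ toDirectImage f Y = toDirectImage f X ≫ (higherDirectImage f 0).map a := by
  have h₁ := congr_arg (homologyFunctor B 0).map (derivedUnit_naturality f ((single A).map a))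
  rw [Functor.map_comp, Functor.map_comp] at h₁
  have h₂ := cyclesToHomology_naturality (f.mapCochainComplexPlus.map ((single A).map a)) 0
  unfold toDirectImage
  refine ((reassoc_of% (toSingleCycles_naturality f a)) _).trans ?_
  refine (congr_arg (_ ≫ ·) ((reassoc_of% h₂) _)).trans ?_
  refine (congr_arg (_ ≫ ·) (congr_arg (_ ≫ ·) h₁)).trans ?_
  exact (congr_arg (_ ≫ ·) (Category.assoc _ _ _).symm).trans (Category.assoc _ _ _).symm

variable [PreservesFiniteLimits f]

/-- In an injective resolution `J`, the object `X` is the kernel of `J⁰ ⟶ J¹`. As `f` is left exact,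
`f X` is the kernel of `f J⁰ ⟶ f J¹`, which maps onto the cohomology of degree `0`. -/
instance epi_toDirectImage (X : A) : Epi (toDirectImage f X) := by
  have : CochainComplex.IsStrictlyGE ((single A).obj X).obj 0 := by
    rw [CochainComplex.isStrictlyGE_iff]
    exact fun i hi => isZero_single X i (by omega)
  obtain ⟨J, hJ, hJ0, i, hi⟩ : ∃ (J : CochainComplex.Plus A) (_ : ∀ n, Injective (J.obj.X n))
      (_ : IsZero (J.obj.X (-1))) (i : (single A).obj X ⟶ J), QuasiIso i.hom := by
    obtain ⟨L, hL, i, hi⟩ := CochainComplex.Plus.exists_quasiIso_injective ((single A).obj X) 0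
    exact ⟨_, fun n => (L.obj.X n).property, (InjectiveObject.ι A).map_isZero
      (L.obj.isZero_of_isStrictlyGE 0 (-1)), i, hi⟩
  have hQ := isIso_Q_map i hi
  have hsingle : IsIso (((single A).obj X).obj.homologyπ 0) :=
    HomologicalComplex.isIso_homologyπ _ (-1) 0 (by simp) (single_d X _ _)
  have hπ : IsIso (J.obj.homologyπ 0) :=
    HomologicalComplex.isIso_homologyπ _ (-1) 0 (by simp) (hJ0.eq_of_src _ _)
  have hc : IsIso (HomologicalComplex.cyclesMap i.hom 0) := by
    have h : IsIso (HomologicalComplex.cyclesMap i.hom 0 ≫ J.obj.homologyπ 0) := by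
      rw [← HomologicalComplex.homologyπ_naturality]
      infer_instance
    exact IsIso.of_isIso_comp_right _ (J.obj.homologyπ 0)
  let e : ((single A).obj X).obj.cycles 0 ≅ X := HomologicalComplex.singleObjCyclesSelfIso (.up ℤ) 0 X
  have he : e.inv ≫ ((single A).obj X).obj.iCycles 0 = (singleZero X).inv :=
    HomologicalComplex.singleObjCyclesSelfIso_inv_iCycles (.up ℤ) 0 X
  have hce : IsIso (e.inv ≫ HomologicalComplex.cyclesMap i.hom 0) := inferInstance
  let fJ := f.mapCochainComplexPlus.obj J
  -- Left exactness enters here: cycles of `f J` lift through `f` of the cycles of `J`, which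
  -- provides a section of the map from `f X` to the cycles.
  have hk := isLimitForkMapOfIsLimit' f _ (J.obj.cyclesIsKernel 0 1 (by simp))
  obtain ⟨s, hs⟩ := KernelFork.IsLimit.lift' hk (fJ.obj.iCycles 0) (fJ.obj.iCycles_d 0 1)
  have hs : s ≫ f.map (J.obj.iCycles 0) = fJ.obj.iCycles 0 := hs
  have hc' : (e.inv ≫ HomologicalComplex.cyclesMap i.hom 0) ≫ J.obj.iCycles 0 =
      (singleZero X).inv ≫ i.hom.f 0 := by
    rw [Category.assoc, HomologicalComplex.cyclesMap_i, reassoc_of% he]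
  generalize e.inv ≫ HomologicalComplex.cyclesMap i.hom 0 = c at hc' hce
  have hm : (toSingleCycles f X ≫
      HomologicalComplex.cyclesMap (f.mapCochainComplexPlus.map i).hom 0) ≫ fJ.obj.iCycles 0 =
      f.map c ≫ f.map (J.obj.iCycles 0) := by
    rw [Category.assoc, HomologicalComplex.cyclesMap_i, reassoc_of% (toSingleCycles_i f X)]
    exact (f.map_comp _ _).symm.trans ((congr_arg f.map hc'.symm).trans (f.map_comp _ _))
  have hsplit : (s ≫ f.map (inv c)) ≫
      (toSingleCycles f X ≫ HomologicalComplex.cyclesMap (f.mapCochainComplexPlus.map i).hom 0) =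
        𝟙 _ := by
    rw [← cancel_mono (fJ.obj.iCycles 0), Category.assoc, hm, Category.id_comp]
    refine Eq.trans ?_ hs
    refine (Category.assoc _ _ _).trans (congr_arg (s ≫ ·) ?_)
    have h : f.map (inv c) ≫ f.map c = 𝟙 _ := by
      rw [← f.map_comp, IsIso.inv_hom_id, CategoryTheory.Functor.map_id]
    exact (Category.assoc _ _ _).symm.trans ((h =≫ _).trans (Category.id_comp _))
  have h₁ : Epi (toSingleCycles f X ≫
      HomologicalComplex.cyclesMap (f.mapCochainComplexPlus.map i).hom 0) :=
    (IsSplitEpi.mk' ⟨_, hsplit⟩).epi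
  have h₂ := cyclesToHomology_naturality (f.mapCochainComplexPlus.map i) 0
  have h₃ := congr_arg (homologyFunctor B 0).map (derivedUnit_naturality f i)
  rw [Functor.map_comp, Functor.map_comp] at h₃
  have h₄ : toDirectImage f X ≫
      (homologyFunctor B 0).map (f.rightDerivedFunctorPlus.map (Q.map i)) =
      (toSingleCycles f X ≫
        HomologicalComplex.cyclesMap (f.mapCochainComplexPlus.map i).hom 0) ≫
          cyclesToHomology fJ 0 ≫ (homologyFunctor B 0).map (derivedUnit f J) := by
    unfold toDirectImage
    rw [Category.assoc, Category.assoc, ← h₃, Category.assoc, reassoc_of% h₂]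
  have h₅ : Epi (toDirectImage f X ≫
      (homologyFunctor B 0).map (f.rightDerivedFunctorPlus.map (Q.map i))) := by
    rw [h₄]
    exact epi_comp' h₁ inferInstance
  have h₆ : toDirectImage f X = (toDirectImage f X ≫
      (homologyFunctor B 0).map (f.rightDerivedFunctorPlus.map (Q.map i))) ≫
      inv ((homologyFunctor B 0).map (f.rightDerivedFunctorPlus.map (Q.map i))) := by
    rw [Category.assoc, IsIso.hom_inv_id, Category.comp_id]
  rw [h₆]
  infer_instance

end Effaceable

open DerivedCategory.Plus (Q Qh homologyFunctor)

/-! ### Sequences with flat quotient stay exact -/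

section FlatTensor

variable {C : Type u} [Category.{v} C] [Abelian C] [MonoidalCategory C] [MonoidalPreadditive C]
  [SymmetricCategory C] [∀ X : C, PreservesFiniteColimits (tensorLeft X)]

/-- Flatness of the quotient suffices, whatever `Y` is. This provides the exactness hypothesis under
which the connecting identities of a cup product are available. -/
lemma shortExact_map_tensorRight (hC : ∀ X : C, ∃ (P : C) (p : P ⟶ X), IsFlat P ∧ Epi p)
    {S : ShortComplex C} (hS : S.ShortExact) (hF : IsFlat S.X₃) (Y : C) :
    (S.map (tensorRight Y)).ShortExact := by
  have := hS.mono_f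
  have := hS.epi_g
  exact { exact := hS.exact.map_of_epi_of_preservesCokernel (tensorRight Y) inferInstance
            inferInstance
          mono_f := IsSES.mono_whiskerRight hC (i := S.f) (p := S.g) ⟨S.zero, hS⟩ hF Y
          epi_g := inferInstanceAs (Epi ((tensorRight Y).map S.g)) }

lemma shortExact_map_tensorLeft (hC : ∀ X : C, ∃ (P : C) (p : P ⟶ X), IsFlat P ∧ Epi p)
    {S : ShortComplex C} (hS : S.ShortExact) (hF : IsFlat S.X₃) (Y : C) :
    (S.map (tensorLeft Y)).ShortExact := by
  have := hS.mono_f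
  have := hS.epi_g
  have h := IsSES.mono_whiskerRight hC (i := S.f) (p := S.g) ⟨S.zero, hS⟩ hF Y
  have h' : Y ◁ S.f = (β_ Y S.X₁).hom ≫ S.f ▷ Y ≫ (β_ Y S.X₂).inv := by
    rw [← BraidedCategory.braiding_naturality_right_assoc, Iso.hom_inv_id, Category.comp_id]
  have h'' : Mono (Y ◁ S.f) := by
    rw [h']
    infer_instance
  exact { exact := hS.exact.map_of_epi_of_preservesCokernel (tensorLeft Y) inferInstance
            inferInstance
          mono_f := h''
          epi_g := inferInstanceAs (Epi ((tensorLeft Y).map S.g)) }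

end FlatTensor

/-! ### Effacing cohomology by extensions of flat objects -/

section Effacement

variable {A : Type u₁} [Category.{v₁} A] [Abelian A] [MonoidalCategory A] [MonoidalPreadditive A]
  [HasDerivedCategory.{w₁} A] [HasDerivedTensor A] [EnoughInjectives A]
  {B : Type u₂} [Category.{v₂} B] [Abelian B] [MonoidalCategory B] [MonoidalPreadditive B]
  [HasDerivedCategory.{w₂} B] [HasDerivedTensor B] (f : A ⥤ B) [f.Additive]

lemma epi_connecting_of_epi_map {S T : ShortComplex A} (hS : S.ShortExact) (hT : T.ShortExact)
    (φ : S ⟶ T) [IsIso φ.τ₁] (n₀ n₁ : ℤ) (hn : 1 + n₀ = n₁)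
    (h₃ : Epi ((higherDirectImage f n₀).map φ.τ₃)) (h : Epi (connecting f hT n₀ n₁ hn)) :
    Epi (connecting f hS n₀ n₁ hn) := by
  have h' : connecting f hS n₀ n₁ hn = ((higherDirectImage f n₀).map φ.τ₃ ≫
      connecting f hT n₀ n₁ hn) ≫ inv ((higherDirectImage f n₁).map φ.τ₁) := by
    rw [← connecting_naturality f hS hT φ, Category.assoc, IsIso.hom_inv_id, Category.comp_id]
  rw [h']
  exact epi_comp' (epi_comp' h₃ h) inferInstance

lemma exists_epi_connecting (X : A) : ∃ (I C : A) (i : X ⟶ I) (p : I ⟶ C) (w : i ≫ p = 0)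
    (hS : (ShortComplex.mk i p w).ShortExact), ∀ (n₀ n₁ : ℤ) (hn : 1 + n₀ = n₁), n₁ ≠ 0 →
      Epi (connecting f hS n₀ n₁ hn) := by
  refine ⟨Injective.under X, cokernel (Injective.ι X), Injective.ι X, cokernel.π _,
    cokernel.condition _, ?_, ?_⟩
  · exact { exact := ShortComplex.exact_of_g_is_cokernel _ (cokernelIsCokernel _)
            mono_f := inferInstanceAs (Mono (Injective.ι X))
            epi_g := inferInstanceAs (Epi (cokernel.π _)) }
  · exact fun n₀ n₁ hn h => epi_connecting f _ n₀ n₁ hn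
      (isZero_higherDirectImage f (Injective.under X) n₁ h)

variable {f} in
lemma IsSES.exists_pullback_epi_connecting {X I C F : A} {i : X ⟶ I} {p : I ⟶ C} {w : i ≫ p = 0}
    (hS : (ShortComplex.mk i p w).ShortExact) (m : F ⟶ C) (n₀ n₁ : ℤ) (hn : 1 + n₀ = n₁)
    (hm : Epi ((higherDirectImage f n₀).map m)) (h : Epi (connecting f hS n₀ n₁ hn)) :
    ∃ (Y : A) (j : X ⟶ Y) (q : Y ⟶ F) (w' : j ≫ q = 0)
      (hT : (ShortComplex.mk j q w').ShortExact), Epi (connecting f hT n₀ n₁ hn) := by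
  obtain ⟨j, ⟨w', hT⟩, hj⟩ := IsSES.pullback (i := i) (p := p) ⟨w, hS⟩ m
  let φ : ShortComplex.mk j (pullback.snd p m) w' ⟶ ShortComplex.mk i p w :=
    { τ₁ := 𝟙 X
      τ₂ := pullback.fst p m
      τ₃ := m
      comm₁₂ := (Category.id_comp _).trans hj.symm
      comm₂₃ := pullback.condition }
  have : IsIso φ.τ₁ := inferInstanceAs (IsIso (𝟙 X))
  exact ⟨_, j, _, w', hT, epi_connecting_of_epi_map f hT hS φ n₀ n₁ hn hm h⟩

variable [PreservesFiniteLimits f] {f} {f' : B ⥤ A}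

/-- A flat cover `P ⟶ f C` corresponds by adjunction to a map `m` from the flat object `f' P` to
`C`. The cover factors through `f m`, so `f m` is an epimorphism, and so is `R⁰f m` because `f C ⟶
R⁰f C` is. -/
lemma exists_flat_epi_map (hB : ∀ X : B, ∃ (P : B) (p : P ⟶ X), IsFlat P ∧ Epi p) (adj : f' ⊣ f)
    (hf' : ∀ P, IsFlat P → IsFlat (f'.obj P)) (C : A) :
    ∃ (F : A) (m : F ⟶ C), IsFlat F ∧ Epi ((higherDirectImage f 0).map m) := by
  obtain ⟨P, p, hP, hp⟩ := hB (f.obj C)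
  have h₁ : adj.unit.app P ≫ f.map ((adj.homEquiv P C).symm p) = p :=
    (adj.homEquiv_unit ..).symm.trans (Equiv.apply_symm_apply _ _)
  have h₂ : Epi (adj.unit.app P ≫ f.map ((adj.homEquiv P C).symm p)) := by rwa [h₁]
  have h₃ : Epi (f.map ((adj.homEquiv P C).symm p)) := epi_of_epi (adj.unit.app P) _
  have h₄ : Epi (toDirectImage f (f'.obj P) ≫
      (higherDirectImage f 0).map ((adj.homEquiv P C).symm p)) := by
    rw [← toDirectImage_naturality]
    exact epi_comp' h₃ (epi_toDirectImage f C)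
  exact ⟨f'.obj P, (adj.homEquiv P C).symm p, hf' P hP, epi_of_epi (toDirectImage f (f'.obj P)) _⟩

variable [SymmetricCategory A] [∀ X : A, PreservesFiniteColimits (tensorLeft X)]

/-- The cohomology of positive degree is effaced by extensions by flat objects. -/
lemma exists_flat_epi_connecting (hA : ∀ X : A, ∃ (P : A) (p : P ⟶ X), IsFlat P ∧ Epi p)
    (hB : ∀ X : B, ∃ (P : B) (p : P ⟶ X), IsFlat P ∧ Epi p) (adj : f' ⊣ f)
    (hf' : ∀ P, IsFlat P → IsFlat (f'.obj P)) (k : ℕ) (n₀ n₁ : ℤ) (hn : 1 + n₀ = n₁) (hk : n₀ = k)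
    (X : A) : ∃ (Y F : A) (j : X ⟶ Y) (q : Y ⟶ F) (w : j ≫ q = 0)
      (hS : (ShortComplex.mk j q w).ShortExact), IsFlat F ∧ Epi (connecting f hS n₀ n₁ hn) := by
  induction k generalizing n₀ n₁ X with
  | zero =>
    -- An embedding in an injective object has a surjective connecting morphism, but its cokernel
    -- `C` is not flat. Pulling the extension back along a flat object that is surjective over `C`
    -- on `R⁰f` repairs this.
    obtain ⟨I, C, i, p, w, hS, h⟩ := exists_epi_connecting f X
    obtain ⟨F, m, hF, hm⟩ := exists_flat_epi_map hB adj hf' C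
    obtain rfl : n₀ = 0 := hk
    obtain ⟨Y, j, q, w', hT, hc⟩ := IsSES.exists_pullback_epi_connecting hS m 0 n₁ hn hm
      (h 0 n₁ hn (by omega))
    exact ⟨Y, F, j, q, w', hT, hF, hc⟩
  | succ k ih =>
    obtain ⟨I, C, i, p, w, hS, h⟩ := exists_epi_connecting f X
    -- The induction hypothesis for `C` gives a flat object with epimorphic connecting morphism onto
    -- `R^{n₀}f C`. Covering `E` by a flat `G`, the kernel of `G ⟶ F` is flat and maps to `C`; the
    -- connecting morphism onto `R^{n₀}f C` factors through its cohomology, so that map is an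
    -- epimorphism in degree `n₀`. The extension of `C` by `X` is then pulled back along it.
    obtain ⟨E, F, j, q, w', hT, hF, hc⟩ := ih k n₀ (by omega) rfl C
    obtain ⟨G, g, hG, hg⟩ := hA E
    have hses : IsSES j q := ⟨w', hT⟩
    have hN := (hses.pullback_fst g).isFlat_left hA hF hG
    obtain ⟨w'', hT'⟩ := hses.pullback_fst g
    let φ : ShortComplex.mk (pullback.fst g j) (g ≫ q) w'' ⟶ ShortComplex.mk j q w' :=
      { τ₁ := pullback.snd g j
        τ₂ := g
        τ₃ := 𝟙 F
        comm₁₂ := pullback.condition.symm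
        comm₂₃ := (Category.comp_id _).symm }
    have hφ := connecting_naturality f hT' hT φ k n₀ (by omega)
    have h₁ : Epi ((higherDirectImage f k).map φ.τ₃ ≫ connecting f hT k n₀ (by omega)) := by
      have : IsIso φ.τ₃ := inferInstanceAs (IsIso (𝟙 F))
      exact epi_comp' inferInstance hc
    rw [← hφ] at h₁
    have hm : Epi ((higherDirectImage f n₀).map (pullback.snd g j)) :=
      epi_of_epi (connecting f hT' k n₀ _) _
    obtain ⟨Y, j', q', w₃, hT₃, hc₃⟩ := IsSES.exists_pullback_epi_connecting hS
      (pullback.snd g j) n₀ n₁ hn hm (h n₀ n₁ hn (by omega))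
    exact ⟨Y, _, j', q', w₃, hT₃, hN, hc₃⟩

end Effacement

/-! ### Uniqueness of the cup product -/

section Uniqueness

variable {A : Type u₁} [Category.{v₁} A] [Abelian A] [MonoidalCategory A] [MonoidalPreadditive A]
  [SymmetricCategory A] [∀ X : A, PreservesFiniteColimits (tensorLeft X)]
  [HasDerivedCategory.{w₁} A] [EnoughInjectives A] [HasDerivedTensor A]
  {B : Type u₂} [Category.{v₂} B] [Abelian B] [MonoidalCategory B] [MonoidalPreadditive B]
  [SymmetricCategory B] [∀ X : B, PreservesFiniteColimits (tensorLeft X)]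
  [HasDerivedCategory.{w₂} B] [HasDerivedTensor B]
  {f g h : A ⥤ B} [f.Additive] [g.Additive] [h.Additive]
  [PreservesFiniteLimits f] [PreservesFiniteLimits g] {f' g' : B ⥤ A}

lemma epi_whiskerRight_of_epi {X Y : B} (p : X ⟶ Y) (hp : Epi p) (Z : B) : Epi (p ▷ Z) :=
  inferInstanceAs (Epi ((tensorRight Z).map p))

lemma epi_whiskerLeft_of_epi (Z : B) {X Y : B} (p : X ⟶ Y) (hp : Epi p) : Epi (Z ◁ p) :=
  inferInstanceAs (Epi ((tensorLeft Z).map p))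

/-- A family of cup products is determined by the pairing in degree `0`. -/
lemma CupFamily.IsCupProduct.eq (hA : ∀ X : A, ∃ (P : A) (p : P ⟶ X), IsFlat P ∧ Epi p)
    (hB : ∀ X : B, ∃ (P : B) (p : P ⟶ X), IsFlat P ∧ Epi p) (adjf : f' ⊣ f) (adjg : g' ⊣ g)
    (hf' : ∀ P, IsFlat P → IsFlat (f'.obj P)) (hg' : ∀ P, IsFlat P → IsFlat (g'.obj P))
    {c c' : CupFamily f g h} {π : CupPairing f g h} (hc : c.IsCupProduct π)
    (hc' : c'.IsCupProduct π) : c = c' := by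
  suffices key : ∀ (r s : ℕ) (X Y : A), c r s X Y = c' r s X Y by
    funext r s X Y
    exact key r s X Y
  intro r
  -- The second variable is shifted only while `r = 0`, where its sign is trivial; after that only
  -- the first variable is shifted, for all `s` at once.
  induction r with
  | zero =>
    intro s
    induction s with
    | zero =>
      intro X Y
      have h₁ : Epi (toHigherDirectImage f X ((0 : ℕ) : ℤ) rfl) := epi_toDirectImage f X
      have h₂ : Epi (toHigherDirectImage g Y ((0 : ℕ) : ℤ) rfl) := epi_toDirectImage g Y
      have h₃ : Epi (toHigherDirectImage f X ((0 : ℕ) : ℤ) rfl ⊗ₘ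
          toHigherDirectImage g Y ((0 : ℕ) : ℤ) rfl) := by
        rw [MonoidalCategory.tensorHom_def]
        exact epi_comp' (epi_whiskerRight_of_epi _ h₁ _) (epi_whiskerLeft_of_epi _ _ h₂)
      rw [← cancel_epi (toHigherDirectImage f X ((0 : ℕ) : ℤ) rfl ⊗ₘ
        toHigherDirectImage g Y ((0 : ℕ) : ℤ) rfl)]
      exact (hc.zero X Y).trans (hc'.zero X Y).symm
    | succ s ih =>
      intro X Y
      obtain ⟨E, F, j, q, w, hS, hF, hepi⟩ := exists_flat_epi_connecting hA hB adjg hg' s s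
        (s + 1 : ℕ) (by push_cast; ring) rfl Y
      have hXS := shortExact_map_tensorLeft hA hS hF X
      have e := hc.right 0 s X _ hS hXS
      have e' := hc'.right 0 s X _ hS hXS
      rw [pow_zero, one_smul] at e e'
      have := epi_whiskerLeft_of_epi ((higherDirectImage f (0 : ℕ)).obj X) _ hepi
      -- The two families agree before the connecting morphism, hence agree after precomposition
      -- with it; it is an epimorphism and remains one under the right exact tensor product.
      exact (cancel_epi _).1 (e.symm.trans ((ih X F =≫ _).trans e'))
  | succ r ih =>
    intro s X Y
    obtain ⟨E, F, j, q, w, hS, hF, hepi⟩ := exists_flat_epi_connecting hA hB adjf hf' r r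
      (r + 1 : ℕ) (by push_cast; ring) rfl X
    have hSY := shortExact_map_tensorRight hA hS hF Y
    have e := hc.left r s _ hS Y hSY
    have e' := hc'.left r s _ hS Y hSY
    have := epi_whiskerRight_of_epi _ hepi ((higherDirectImage g s).obj Y)
    exact (cancel_epi _).1 (e.symm.trans ((ih s F Y =≫ _).trans e'))

end Uniqueness

end CupProduct

end

/-! ### Assembly of the theorem -/

theorem mainTheorem5
    {A : Type u₁} [Category.{v₁} A] [Abelian A] [MonoidalCategory A] [SymmetricCategory A]
    [MonoidalPreadditive A] [HasDerivedCategory.{w₁} A] [EnoughInjectives A]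
    {B : Type u₂} [Category.{v₂} B] [Abelian B] [MonoidalCategory B] [SymmetricCategory B]
    [MonoidalPreadditive B] [HasDerivedCategory.{w₂} B]
    [∀ X : A, PreservesFiniteColimits (tensorLeft X)]
    [∀ X : B, PreservesFiniteColimits (tensorLeft X)]
    (hA : CupProduct.HasFiniteTorDimension A) (hB : CupProduct.HasFiniteTorDimension B)
    (f g h : A ⥤ B) [CupProduct.IsPreCupFunctor f] [CupProduct.IsPreCupFunctor g]
    [CupProduct.IsPreCupFunctor h] (π : CupProduct.CupPairing f g h) :
    ∃ (_ : CupProduct.HasDerivedTensor A) (_ : CupProduct.HasDerivedTensor B),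
      CupProduct.IsComputedByFlat A ∧ CupProduct.IsComputedByFlat B ∧
      ∃ α : CupProduct.HomologyPairing (C := B),
        α.IsCanonical ∧ (∀ α' : CupProduct.HomologyPairing (C := B), α'.IsCanonical → α' = α) ∧
        ∃ Φ : CupProduct.DerivedCupPairing f g h,
          Φ.Extends π ∧
          (CupProduct.inducedCup α Φ).IsNatural ∧
          (CupProduct.inducedCup α Φ).IsCupProduct π ∧
          (CupProduct.inducedCup α Φ).IsCompatibleLeft ∧
          (CupProduct.inducedCup α Φ).IsCompatibleRight ∧
          ∀ c : CupProduct.CupFamily f g h, c.IsCupProduct π →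
            c = CupProduct.inducedCup α Φ := by
  have := CupProduct.IsPreCupFunctor.isRightAdjoint (f := f)
  have := CupProduct.IsPreCupFunctor.isRightAdjoint (f := g)
  have := CupProduct.IsPreCupFunctor.exact (f := f)
  have := CupProduct.IsPreCupFunctor.exact (f := g)
  let adjf := Adjunction.ofIsRightAdjoint f
  let adjg := Adjunction.ofIsRightAdjoint g
  -- Left adjoints preserve colimits, which with the assumed left exactness makes them exact; right
  -- adjoints preserve limits, which gives the left exactness of `f` and `g` used for uniqueness.
  have : PreservesColimitsOfSize.{0, 0} f.leftAdjoint := adjf.leftAdjoint_preservesColimits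
  have : PreservesColimitsOfSize.{0, 0} g.leftAdjoint := adjg.leftAdjoint_preservesColimits
  have : PreservesLimitsOfSize.{0, 0} f := adjf.rightAdjoint_preservesLimits
  have : PreservesLimitsOfSize.{0, 0} g := adjg.rightAdjoint_preservesLimits
  have := f.leftAdjoint.additive_of_preserves_binary_products
  have := g.leftAdjoint.additive_of_preserves_binary_products
  have hf' := CupProduct.IsPreCupFunctor.flat (f := f)
  have hg' := CupProduct.IsPreCupFunctor.flat (f := g)
  have : Fact (CupProduct.HasFiniteTorDimension A) := ⟨hA⟩
  have : Fact (CupProduct.HasFiniteTorDimension B) := ⟨hB⟩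
  have hTA := hA.hasDerivedTensor
  have hTB := hB.hasDerivedTensor
  obtain ⟨Φ, hΦ⟩ := CupProduct.exists_derivedCupPairing π adjf adjg hf' hg'
  have hα := CupProduct.homologyPairing_isCanonical (C := B)
  have hcup := CupProduct.inducedCup_isCupProduct hα hΦ adjf adjg hf' hg'
  exact ⟨hTA, hTB, hA.isComputedByFlat, hB.isComputedByFlat, CupProduct.homologyPairing B, hα,
    fun α' hα' => hα'.eq hα, Φ, hΦ, CupProduct.inducedCup_isNatural _ Φ, hcup,
    CupProduct.inducedCup_isCompatibleLeft hα hΦ adjf adjg hf' hg',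
    CupProduct.inducedCup_isCompatibleRight hα hΦ adjf adjg hf' hg',
    fun c hc => hc.eq hA.enoughFlats hB.enoughFlats adjf adjg hf' hg' hcup⟩
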